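/- For $\tau=x+iy$ in the upper half-plane $\mathbb H$ and $z\in\mathbb C$ write $q^r=e^{2\pi i r\tau}$, $\zeta^r=e^{2\pi i r z}$. For $a,b\in\mathbb R$ let $$\vartheta_{a,b}(z;\tau)=\sum_{n\in\mathbb Z}e^{2\pi i(n+a)b}q^{\frac12(n+a)^2}\zeta^{n+a},\qquad \theta_1=-\vartheta_{\frac12,\frac12},\quad \theta_2=\vartheta_{\frac12,0},\quad \theta_3=\vartheta_{0,0},$$ and, for $z\notin\mathbb Z\tau+\mathbb Z$, let $\mu$ be $i$ times Zwegers' function $\mu(z,z;\tau)$: $$\mu(z;\tau)=\frac{i\,\zeta^{1/2}}{\vartheta_{\frac12,\frac12}(z;\tau)}\sum_{n\in\mathbb Z}\frac{(-1)^nq^{\frac12n(n+1)}\zeta^n}{1-\zeta q^n}.$$ For $\ell\in\mathbb Z$ let $S_\ell(\tau)$ be the coefficient of $q^{\ell^2/4}\zeta^\ell$ in $\theta_1(z;\tau)^2\mu(z;\tau)$, i.e. $S_\ell(\tau)=q^{-\ell^2/4}\int_0^1\theta_1(z;\tau)^2\mu(z;\tau)\,\zeta^{-\ell}\,dt$ with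 $z=t+\tfrac{iy}{2}$. Let $A=\begin{pmatrix}1&2\\2&2\end{pmatrix}$, $Q(\nu)=\frac12\nu^TA\nu$, $B(\nu,\nu')=\nu^TA\nu'$, $a(\ell)=(\frac12,-\frac{\ell}2)^T$, $b=(\frac12,0)^T$, $c_1=(-1,1)^T$, $c_2=(-2,1)^T$, $\beta(u)=\int_u^\infty s^{-1/2}e^{-\pi s}\,ds$, and let $\vartheta^\ell$ be Zwegers' indefinite theta function $$\vartheta^\ell(\tau)=\sum_{\nu\in a(\ell)+\mathbb Z^2}\Bigl(\rho_{c_1}(\nu)-\rho_{c_2}(\nu)\Bigr)e^{2\pi iB(\nu,b)}q^{Q(\nu)},\qquad \rho_{c}(\nu)=\operatorname{sgn}B(\nu,c)\Bigl(1-\beta\bigl(-\tfrac{B(\nu,c)^2}{Q(c)}y\bigr)\Bigr).$$ For an integer $k$ and a subgroup $\Gamma\le\mathrm{SL}_2(\mathbb Z)$, call $h$ the holomorphic part of a function $H$ on $\mathbb H$ (in weight $k$, for $\Gamma$) if $h$ is holomorphic on $\mathbb H$, bounded at $i\infty$, and $H-h$ is a finite sum of products $f\cdot g^*$, where, for some $w\in\frac12\mathbb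 Z$, $f$ is a holomorphic modular form of weight $w$ and $g$ a cusp form of weight $2-(k-w)$, both on $\Gamma$ with unitary multiplier systems, and $g^*(\tau)=\int_y^\infty (t+y)^{-(k-w)}\,\overline{g(x+it)}\,dt$ is the non-holomorphic Eichler integral of $g$. Such an $h$ is called a (mixed) mock modular form of weight $k$ on $\Gamma$ with unitary multiplier $\chi$ and completion $H$ if moreover $H(\gamma\tau)=\chi(\gamma)(c\tau+d)^kH(\tau)$ for $\gamma=\begin{pmatrix}*&*\\c&d\end{pmatrix}\in\Gamma$ and $(c\tau+d)^{-k}H(\gamma\tau)$ is bounded at $i\infty$ for every $\gamma\in\mathrm{SL}_2(\mathbb Z)$. A tuple $(h_i)$ is a vector-valued (mixed) mock modular form of weight $k$ on $\mathrm{SL}_2(\mathbb Z)$ with representation $\rho$ and completion $H=(H_i)^T$ if the $H_i$ are bounded at $i\infty$, $H(\gamma\tau)=(c\tau+d)^k\rho(\gamma)H(\tau)$ for all $\gamma\in\mathrm{SL}_2(\mathbb Z)$, and for some finite-index subgroup $\Gamma$ each $h_i$ is the holomorphic part of $H_i$ in weight $k$ for $\Gamma$. **Proposition.** 1. For $\tau\in\mathbb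 H$ and $z\notin\mathbb Z\tau+\mathbb Z$, $\ \theta_1(z;\tau)^2\mu(z;\tau)=S_0(\tau)\theta_3(2z;2\tau)+S_1(\tau)\theta_2(2z;2\tau)$. 2. $A$ is symmetric with $\det A<0$, and $Q(c_1),Q(c_2),B(c_1,c_2)<0$. For all $\ell\in\mathbb Z$ and $\tau\in\mathbb H$ the series $\vartheta^\ell(\tau)$ and the following series converge absolutely, and $$2i\,S_\ell(\tau)=\sum_{\nu\in a(\ell)+\mathbb Z^2}\bigl(\operatorname{sgn}B(\nu,c_1)-\operatorname{sgn}B(\nu,c_2)\bigr)e^{2\pi iB(\nu,b)}q^{Q(\nu)},$$ $$\vartheta^\ell(\tau)=2i\,S_\ell(\tau)+\sum_{j=1}^2(-1)^j\sum_{\nu\in a(\ell)+\mathbb Z^2}\operatorname{sgn}B(\nu,c_j)\,\beta\bigl(-\tfrac{B(\nu,c_j)^2}{Q(c_j)}y\bigr)e^{2\pi iB(\nu,b)}q^{Q(\nu)}.$$ 3. For $\ell=0,1$, $S_\ell$ is a (mixed) mock modular form of weight $1$ on $\Gamma_0(4)$ with completion $\frac1{2i}\vartheta^\ell$ and some unitary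 character $\chi_\ell$ of $\Gamma_0(4)$ as multiplier; in particular it is the holomorphic part of $\frac{1}{2i}\vartheta^\ell$. 4. $(S_0,S_1)$ is a vector-valued (mixed) mock modular form of weight $1$ on $\mathrm{SL}_2(\mathbb Z)$ with completion $\frac1{2i}(\vartheta^0,\vartheta^1)^T$ and a representation $\rho$ satisfying $$\rho\begin{pmatrix}1&1\\0&1\end{pmatrix}=\begin{pmatrix}e^{\pi i/4}&0\\0&e^{-\pi i/4}\end{pmatrix},\qquad \rho\begin{pmatrix}0&-1\\1&0\end{pmatrix}=-\frac{i}{\sqrt2}\begin{pmatrix}1&1\\1&-1\end{pmatrix}.$$ -/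

import Mathlib

open Complex MeasureTheory Matrix
open scoped UpperHalfPlane MatrixGroups Manifold

noncomputable section

namespace MockTheta

/-! ### Jacobi theta series and the `μ`-function -/

/-- The theta series with characteristics,
`∑ₙ e^{2πi(n+a)b} q^{(n+a)²/2} ζ^{n+a}` with `q = e^{2πiτ}`, `ζ = e^{2πiz}`. -/
def thetaChar (a b : ℝ) (z τ : ℂ) : ℂ :=
  ∑' n : ℤ, cexp (2 * Real.pi * I * ((n + a) * b) + Real.pi * I * (n + a) ^ 2 * τ
    + 2 * Real.pi * I * (n + a) * z)

def theta1 (z τ : ℂ) : ℂ := -thetaChar (1 / 2) (1 / 2) z τ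

def theta2 (z τ : ℂ) : ℂ := thetaChar (1 / 2) 0 z τ

def theta3 (z τ : ℂ) : ℂ := thetaChar 0 0 z τ

/-- Zwegers' function `μ(z, z; τ)` multiplied by `i`. -/
def mu (z τ : ℂ) : ℂ :=
  I * cexp (Real.pi * I * z) / thetaChar (1 / 2) (1 / 2) z τ *
    ∑' n : ℤ, (-1 : ℂ) ^ n * cexp (Real.pi * I * (n * (n + 1)) * τ + 2 * Real.pi * I * n * z) /
      (1 - cexp (2 * Real.pi * I * (z + n * τ)))

/-- `S_ℓ(τ)`: the coefficient of `q^{ℓ²/4} ζ^ℓ` in `θ₁(z;τ)² μ(z;τ)`, i.e. `q^{-ℓ²/4}` times the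
`ℓ`-th Fourier coefficient in `z`, computed on the line `Im z = Im τ / 2`, which avoids `ℤτ + ℤ`. -/
def S (l : ℤ) (τ : ℍ) : ℂ :=
  cexp (-2 * Real.pi * I * ((l : ℂ) ^ 2 / 4) * τ) *
    ∫ x in (0 : ℝ)..1,
      theta1 (x + I * (τ.im / 2)) τ ^ 2 * mu (x + I * (τ.im / 2)) τ *
        cexp (-2 * Real.pi * I * l * (x + I * (τ.im / 2)))

/-! ### Zwegers' indefinite theta functions of rank two -/

/-- `B(x, y) = xᵀ A y`. -/
def bilin (A : Matrix (Fin 2) (Fin 2) ℝ) (x y : Fin 2 → ℝ) : ℝ := x ⬝ᵥ (A *ᵥ y)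

/-- `Q(x) = ½ xᵀ A x`. -/
def quad (A : Matrix (Fin 2) (Fin 2) ℝ) (x : Fin 2 → ℝ) : ℝ := bilin A x x / 2

/-- `β(x) = ∫_x^∞ u^{-1/2} e^{-πu} du`. -/
def beta (x : ℝ) : ℝ := ∫ u in Set.Ioi x, u ^ (-(1 / 2) : ℝ) * Real.exp (-Real.pi * u)

/-- `e^{2πi B(ν,b)} q^{Q(ν)}`. -/
def qTerm (A : Matrix (Fin 2) (Fin 2) ℝ) (b ν : Fin 2 → ℝ) (τ : ℍ) : ℂ :=
  cexp (2 * Real.pi * I * bilin A ν b + 2 * Real.pi * I * quad A ν * τ)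

/-- `sgn B(ν,c) · β(-B(ν,c)² y / Q(c))`, with `y = Im τ`. -/
def betaTerm (A : Matrix (Fin 2) (Fin 2) ℝ) (c ν : Fin 2 → ℝ) (τ : ℍ) : ℝ :=
  Real.sign (bilin A ν c) * beta (-(bilin A ν c ^ 2 / quad A c) * τ.im)

/-- `ρ_{c₁,c₂}(ν)`. -/
def rho (A : Matrix (Fin 2) (Fin 2) ℝ) (c₁ c₂ ν : Fin 2 → ℝ) (τ : ℍ) : ℝ :=
  Real.sign (bilin A ν c₁) * (1 - beta (-(bilin A ν c₁ ^ 2 / quad A c₁) * τ.im)) -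
    Real.sign (bilin A ν c₂) * (1 - beta (-(bilin A ν c₂ ^ 2 / quad A c₂) * τ.im))

/-- The point `a + n` of the coset `a + ℤ²`. -/
def shift (a : Fin 2 → ℝ) (n : Fin 2 → ℤ) : Fin 2 → ℝ := fun i => a i + n i

/-- The indefinite theta function `∑_{ν ∈ a + ℤ²} ρ_{c₁,c₂}(ν) e^{2πi B(ν,b)} q^{Q(ν)}`. -/
def indefTheta (A : Matrix (Fin 2) (Fin 2) ℝ) (a b c₁ c₂ : Fin 2 → ℝ) (τ : ℍ) : ℂ :=
  ∑' n : Fin 2 → ℤ, (rho A c₁ c₂ (shift a n) τ : ℂ) * qTerm A b (shift a n) τ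

def A₀ : Matrix (Fin 2) (Fin 2) ℝ := !![1, 2; 2, 2]

def a₀ (l : ℤ) : Fin 2 → ℝ := ![1 / 2, -(l / 2)]

def b₀ : Fin 2 → ℝ := ![1 / 2, 0]

def c₁ : Fin 2 → ℝ := ![-1, 1]

def c₂ : Fin 2 → ℝ := ![-2, 1]

/-- `ϑ^ℓ`. -/
def vartheta (l : ℤ) (τ : ℍ) : ℂ := indefTheta A₀ (a₀ l) b₀ c₁ c₂ τ

/-! ### Modular forms with multiplier and mock modular forms -/

/-- The factor of automorphy `cτ + d`. -/
def autFactor (γ : SL(2, ℤ)) (τ : ℍ) : ℂ := (γ 1 0 : ℂ) * τ + (γ 1 1 : ℂ)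

/-- Holomorphic modular forms of real weight `w` on `Γ` with a unitary multiplier system;
`(cτ + d)^w` is the principal branch. -/
structure IsModularForm (Γ : Subgroup SL(2, ℤ)) (w : ℝ) (f : ℍ → ℂ) : Prop where
  holo : MDifferentiable 𝓘(ℂ) 𝓘(ℂ) f
  modular : ∃ v : Γ → ℂ, (∀ γ, ‖v γ‖ = 1) ∧
    ∀ (γ : Γ) (τ : ℍ), f ((γ : SL(2, ℤ)) • τ) = v γ * autFactor γ τ ^ (w : ℂ) * f τ
  cusps : ∀ γ : SL(2, ℤ),
    UpperHalfPlane.IsBoundedAtImInfty fun τ => autFactor γ τ ^ (-w : ℂ) * f (γ • τ)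

/-- Cusp forms of real weight `w` on `Γ` with a unitary multiplier system. -/
structure IsCuspForm (Γ : Subgroup SL(2, ℤ)) (w : ℝ) (f : ℍ → ℂ) : Prop
    extends IsModularForm Γ w f where
  cusps_zero : ∀ γ : SL(2, ℤ),
    UpperHalfPlane.IsZeroAtImInfty fun τ => autFactor γ τ ^ (-w : ℂ) * f (γ • τ)

/-- The non-holomorphic Eichler integral `∫_{-τ̄}^{i∞} (z + τ)^{-κ} \overline{g(-z̄)} dz` of a cusp
form `g` of weight `2 - κ`, up to the constant factor `i^{1-κ}`: on the vertical path
`z = -x + it`, `t > y`, where `τ = x + iy`, one has `z + τ = i(t + y)` and `-z̄ = x + it`. -/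
def eichlerIntegral (κ : ℝ) (g : ℍ → ℂ) (τ : ℍ) : ℂ :=
  ∫ t in Set.Ioi τ.im, (((t + τ.im) ^ (-κ) : ℝ) : ℂ) *
    (starRingEnd ℂ) (g (UpperHalfPlane.ofComplex (τ.re + I * t)))

/-- `h` is the holomorphic part of the weight `k` function `H`: `h` is holomorphic on `ℍ`, bounded
at `i∞`, and `H - h` is a finite sum of products `f · g*`, where `f` is a modular form of weight
`w ∈ ½ℤ` and `g*` is the non-holomorphic Eichler integral of a cusp form `g` of weight
`2 - (k - w)`. -/
def IsHolomorphicPart (Γ : Subgroup SL(2, ℤ)) (k : ℤ) (h H : ℍ → ℂ) : Prop :=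
  MDifferentiable 𝓘(ℂ) 𝓘(ℂ) h ∧ UpperHalfPlane.IsBoundedAtImInfty h ∧
    ∃ (n : ℕ) (w : Fin n → ℤ) (f g : Fin n → ℍ → ℂ),
      (∀ j, IsModularForm Γ ((w j : ℝ) / 2) (f j)) ∧
      (∀ j, IsCuspForm Γ (2 - (k - (w j : ℝ) / 2)) (g j)) ∧
      ∀ τ, H τ = h τ + ∑ j, f j τ * eichlerIntegral (k - (w j : ℝ) / 2) (g j) τ

/-- `h` is a (mixed) mock modular form of weight `k` on `Γ` with multiplier system `χ` and
completion `H`. -/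
structure IsMockModularForm (Γ : Subgroup SL(2, ℤ)) (k : ℤ) (χ : Γ →* ℂ) (h H : ℍ → ℂ) :
    Prop where
  unitary : ∀ γ, ‖χ γ‖ = 1
  holomorphicPart : IsHolomorphicPart Γ k h H
  modular : ∀ (γ : Γ) (τ : ℍ), H ((γ : SL(2, ℤ)) • τ) = χ γ * autFactor γ τ ^ k * H τ
  cusps : ∀ γ : SL(2, ℤ),
    UpperHalfPlane.IsBoundedAtImInfty fun τ => autFactor γ τ ^ (-k) * H (γ • τ)

/-- `h` is a vector-valued (mixed) mock modular form of weight `k` on `SL₂(ℤ)` with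
representation `R` and completion `H`. -/
structure IsVectorMockModularForm {d : ℕ} (k : ℤ)
    (R : SL(2, ℤ) →* Matrix (Fin d) (Fin d) ℂ) (h H : Fin d → ℍ → ℂ) : Prop where
  holomorphicPart : ∃ Γ : Subgroup SL(2, ℤ), Γ.FiniteIndex ∧
    ∀ i, IsHolomorphicPart Γ k (h i) (H i)
  modular : ∀ (γ : SL(2, ℤ)) (τ : ℍ) (i : Fin d),
    H i (γ • τ) = autFactor γ τ ^ k * ∑ j, R γ i j * H j τ
  cusp : ∀ i, UpperHalfPlane.IsBoundedAtImInfty (H i)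

end MockTheta

end

open MockTheta

/-!
*Decomposition.* Expanding the denominators of `μ` into geometric series and multiplying by `θ₁`
makes `θ₁² μ` an absolutely convergent triple series on the strip `0 < Im z < Im τ`. Its
coefficients are lattice sums over two quadrants; they differ from those of the indefinite theta
function by inner theta sums that vanish, and they depend only on `ℓ` modulo `2`. Quasi-periodicity
and continuity carry the decomposition from the strip to all `z` off the lattice.

*Modularity.* The negative vectors `(-s, 1)`, `1 ≤ s ≤ 2`, join `c₁` to `c₂`, and `ρ_{c₁} - ρ_{c₂}`,
a difference of two values of the error function, is the integral over `s` of its derivative, a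
Gaussian. Hence `ϑ^ℓ` is an integral of Siegel theta kernels, each of which transforms by Poisson
summation.

*Non-holomorphic part.* Both `β`-sums split into theta series of rank one. One of them vanishes, and
the other is the product of `f_ℓ = ∑ q^{k²}`, `k ∈ (1 + ℓ)/2 + ℤ`, with the Eichler integral of a
theta function `g` of weight `3/2`.

*Multipliers.* `ϑ⁰` and `ϑ¹` are linearly independent, so their transformations under `S` and `T`
determine a representation. The subgroup acting by diagonal unitary matrices contains `-1`, `T` and
`S T⁴ S⁻¹`, which generate `Γ₀(4)`.
-/

noncomputable section

namespace MockTheta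

open Filter Topology

/-! ### One-dimensional theta series with a linear factor -/

/-- The term `(α + l x) e^{πi d x² + 2πi w x}`, `x = n + a`, of a one-dimensional theta series with
a linear factor. The weights `1/2` (`l = 0`) and `3/2` (`α = 0`) are treated together, so that
Poisson summation can be applied to one variable of a binary series. -/
def thetaTerm (α l a w d : ℂ) (n : ℤ) : ℂ :=
  (α + l * (n + a)) * cexp (Real.pi * I * d * (n + a) ^ 2 + 2 * Real.pi * I * (n + a) * w)

lemma thetaTerm_eq_jacobiTheta₂_term (α l a w d : ℂ) (n : ℤ) : thetaTerm α l a w d n =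
    cexp (Real.pi * I * d * a ^ 2 + 2 * Real.pi * I * a * w) *
      ((α + l * a) * jacobiTheta₂_term n (w + d * a) d +
        l / (2 * Real.pi * I) * jacobiTheta₂'_term n (w + d * a) d) := by
  have hexp : cexp (Real.pi * I * d * (n + a) ^ 2 + 2 * Real.pi * I * (n + a) * w) =
      cexp (Real.pi * I * d * a ^ 2 + 2 * Real.pi * I * a * w) *
        jacobiTheta₂_term n (w + d * a) d := by
    rw [jacobiTheta₂_term, ← Complex.exp_add]
    ring_nf
  rw [thetaTerm, hexp, jacobiTheta₂'_term]
  field_simp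
  ring

section

variable {d : ℂ} (hd : 0 < d.im)
include hd

lemma ne_zero_of_im_pos : d ≠ 0 := by
  rintro rfl
  simp at hd

lemma im_neg_one_div_pos : 0 < (-1 / d).im := by
  rw [div_eq_mul_inv, neg_one_mul, neg_im, inv_im, neg_div, neg_neg]
  exact div_pos hd (normSq_pos.mpr (ne_zero_of_im_pos hd))

lemma hasSum_thetaTerm (α l a w : ℂ) : HasSum (thetaTerm α l a w d)
    (cexp (Real.pi * I * d * a ^ 2 + 2 * Real.pi * I * a * w) *
      ((α + l * a) * jacobiTheta₂ (w + d * a) d +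
        l / (2 * Real.pi * I) * jacobiTheta₂' (w + d * a) d)) := by
  rw [funext (thetaTerm_eq_jacobiTheta₂_term α l a w d)]
  exact (((hasSum_jacobiTheta₂_term _ hd).mul_left _).add
    ((hasSum_jacobiTheta₂'_term _ hd).mul_left _)).mul_left _

lemma summable_thetaTerm (α l a w : ℂ) : Summable (thetaTerm α l a w d) :=
  (hasSum_thetaTerm hd α l a w).summable

theorem tsum_thetaTerm_inversion (α l a w : ℂ) :
    ∑' n, thetaTerm α (l / d) (-w) a (-1 / d) n =
      cexp (-(2 * Real.pi * I * (a * w))) * (-I * d) ^ (1 / 2 : ℂ) *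
        ∑' n, thetaTerm α l a w d n := by
  have hd0 := ne_zero_of_im_pos hd
  have hroot : (-I * d) ^ (1 / 2 : ℂ) ≠ 0 :=
    cpow_ne_zero_iff.mpr (Or.inl (mul_ne_zero (neg_ne_zero.mpr I_ne_zero) hd0))
  rw [(hasSum_thetaTerm hd α l a w).tsum_eq,
    (hasSum_thetaTerm (im_neg_one_div_pos hd) α (l / d) (-w) a).tsum_eq,
    jacobiTheta₂_functional_equation (w + d * a) d,
    jacobiTheta₂'_functional_equation (w + d * a) d,
    show a + -1 / d * -w = (w + d * a) / d by field_simp; ring]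
  have hexp : cexp (Real.pi * I * (-1 / d) * (-w) ^ 2 + 2 * Real.pi * I * -w * a) =
      cexp (-(2 * Real.pi * I * (a * w))) *
        (cexp (Real.pi * I * d * a ^ 2 + 2 * Real.pi * I * a * w) *
          cexp (-Real.pi * I * (w + d * a) ^ 2 / d)) := by
    rw [← Complex.exp_add, ← Complex.exp_add]
    congr 1
    field_simp
    ring
  rw [hexp]
  generalize (-I * d) ^ (1 / 2 : ℂ) = r at *
  field_simp
  ring

end

/-! ### Gaussians on lattices -/

section

variable {ε : ℝ} (hε : 0 < ε)
include hε

lemma summable_one_add_abs_mul_gaussian (a : ℝ) :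
    Summable fun n : ℤ => (1 + |n + a|) * Real.exp (-ε * (n + a) ^ 2) := by
  have hd : 0 < ((ε / Real.pi : ℝ) * I : ℂ).im := by
    rw [im_ofReal_mul, I_im, mul_one]
    exact div_pos hε Real.pi_pos
  have norm_term (α l : ℝ) (n : ℤ) : ‖thetaTerm α l a 0 ((ε / Real.pi : ℝ) * I) n‖ =
      |α + l * (n + a)| * Real.exp (-ε * (n + a) ^ 2) := by
    have hexponent : (Real.pi * I * ((ε / Real.pi : ℝ) * I) * (n + a) ^ 2 +
        2 * Real.pi * I * (n + a) * 0 : ℂ) = (-ε * (n + a) ^ 2 : ℝ) := by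
      push_cast
      field_simp
      linear_combination (ε * (n + a) ^ 2 : ℂ) * I_sq
    rw [thetaTerm, norm_mul, hexponent, norm_exp_ofReal]
    congr 1
    exact_mod_cast norm_real (α + l * (n + a))
  have hconst := (summable_thetaTerm hd (1 : ℝ) (0 : ℝ) a 0).norm
  have hlin := (summable_thetaTerm hd (0 : ℝ) (1 : ℝ) a 0).norm
  simp only [norm_term, zero_mul, add_zero, zero_add, one_mul, abs_one] at hconst hlin
  simpa only [add_mul, one_mul] using hconst.add hlin

lemma summable_gaussian_int (a : ℝ) : Summable fun n : ℤ => Real.exp (-ε * (n + a) ^ 2) :=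
  (summable_one_add_abs_mul_gaussian hε a).of_nonneg_of_le (fun _ => (Real.exp_pos _).le)
    fun _ => le_mul_of_one_le_left (Real.exp_pos _).le (le_add_of_nonneg_right (abs_nonneg _))

lemma summable_one_add_abs_mul_gaussian_prod (a b : ℝ) :
    Summable fun p : ℤ × ℤ => (1 + |p.1 + a|) * (1 + |p.2 + b|) *
      Real.exp (-ε * ((p.1 + a) ^ 2 + (p.2 + b) ^ 2)) := by
  refine ((summable_one_add_abs_mul_gaussian hε a).mul_of_nonneg
    (summable_one_add_abs_mul_gaussian hε b) (fun _ => by positivity)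
    (fun _ => by positivity)).congr fun p => ?_
  rw [mul_add (-ε), Real.exp_add]
  ring

lemma summable_gaussian_prod (a b : ℝ) :
    Summable fun p : ℤ × ℤ => Real.exp (-ε * ((p.1 + a) ^ 2 + (p.2 + b) ^ 2)) :=
  (summable_one_add_abs_mul_gaussian_prod hε a b).of_nonneg_of_le
    (fun _ => (Real.exp_pos _).le) fun _ => le_mul_of_one_le_left (Real.exp_pos _).le <|
      one_le_mul_of_one_le_of_one_le (le_add_of_nonneg_right (abs_nonneg _))
        (le_add_of_nonneg_right (abs_nonneg _))

end

/-! ### Binary theta series with a linear factor -/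

/-- The complex binary form `a x² + 2 b x y + d y²` lies in the Siegel upper half-space: its
imaginary part is positive definite. -/
def ImPosDef (a b d : ℂ) : Prop :=
  0 < d.im ∧ b.im ^ 2 < a.im * d.im

lemma det_mul_le_trace_mul (α β γ x y : ℝ) : (α * γ - β ^ 2) * (x ^ 2 + y ^ 2) ≤
    (α + γ) * (α * x ^ 2 + 2 * β * x * y + γ * y ^ 2) := by
  linarith [sq_nonneg (α * x + β * y), sq_nonneg (β * x + γ * y)]

/-- The term `(x₁ u + x₂ v) e^{πi(a u² + 2 b u v + d v²) + 2πi(b₁ u + b₂ v)}`, `u = n₁ + a₁`,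
`v = n₂ + a₂`, of a binary theta series with characteristics and a linear factor. -/
def binaryThetaTerm (x₁ x₂ a b d : ℂ) (a₁ a₂ b₁ b₂ : ℝ) (p : ℤ × ℤ) : ℂ :=
  (x₁ * (p.1 + a₁) + x₂ * (p.2 + a₂)) * cexp (Real.pi * I *
    (a * (p.1 + a₁) ^ 2 + 2 * b * (p.1 + a₁) * (p.2 + a₂) + d * (p.2 + a₂) ^ 2) +
    2 * Real.pi * I * ((p.1 + a₁) * b₁ + (p.2 + a₂) * b₂))

lemma binaryThetaTerm_swap (x₁ x₂ a b d : ℂ) (a₁ a₂ b₁ b₂ : ℝ) (p : ℤ × ℤ) :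
    binaryThetaTerm x₂ x₁ d b a a₂ a₁ b₂ b₁ p.swap =
      binaryThetaTerm x₁ x₂ a b d a₁ a₂ b₁ b₂ p := by
  simp only [binaryThetaTerm, Prod.fst_swap, Prod.snd_swap]
  ring_nf

lemma tsum_binaryThetaTerm_swap (x₁ x₂ a b d : ℂ) (a₁ a₂ b₁ b₂ : ℝ) :
    ∑' p, binaryThetaTerm x₂ x₁ d b a a₂ a₁ b₂ b₁ p =
      ∑' p, binaryThetaTerm x₁ x₂ a b d a₁ a₂ b₁ b₂ p := by
  rw [← (Equiv.prodComm ℤ ℤ).tsum_eq]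
  exact tsum_congr (binaryThetaTerm_swap x₁ x₂ a b d a₁ a₂ b₁ b₂)

lemma binaryThetaTerm_eq_mul_thetaTerm (x₁ x₂ a b d : ℂ) (a₁ a₂ b₁ b₂ : ℝ) (n m : ℤ) :
    binaryThetaTerm x₁ x₂ a b d a₁ a₂ b₁ b₂ (n, m) =
      cexp (Real.pi * I * (a * (n + a₁) ^ 2) + 2 * Real.pi * I * ((n + a₁) * b₁)) *
        thetaTerm (x₁ * (n + a₁)) x₂ a₂ (b * (n + a₁) + b₂) d m := by
  rw [binaryThetaTerm, thetaTerm, mul_left_comm, ← Complex.exp_add]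
  ring_nf

lemma norm_exp_add_ofReal_mul_I (z : ℂ) (r : ℝ) : ‖cexp (z + r * I)‖ = ‖cexp z‖ := by
  rw [Complex.exp_add, norm_mul, Complex.norm_exp_ofReal_mul_I, mul_one]

lemma norm_binaryThetaTerm (x₁ x₂ a b d : ℂ) (a₁ a₂ b₁ b₂ : ℝ) (p : ℤ × ℤ) :
    ‖binaryThetaTerm x₁ x₂ a b d a₁ a₂ b₁ b₂ p‖ =
      ‖x₁ * (p.1 + a₁ : ℝ) + x₂ * (p.2 + a₂ : ℝ)‖ * Real.exp (-Real.pi *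
        (a.im * (p.1 + a₁) ^ 2 + 2 * b.im * (p.1 + a₁) * (p.2 + a₂) + d.im * (p.2 + a₂) ^ 2)) := by
  have hsplit : Real.pi * I * (a * (p.1 + a₁) ^ 2 + 2 * b * (p.1 + a₁) * (p.2 + a₂) +
      d * (p.2 + a₂) ^ 2) + 2 * Real.pi * I * ((p.1 + a₁) * b₁ + (p.2 + a₂) * b₂) =
      (((Real.pi * (p.1 + a₁) ^ 2 : ℝ) * a + (Real.pi * (2 * (p.1 + a₁) * (p.2 + a₂)) : ℝ) * b +
        (Real.pi * (p.2 + a₂) ^ 2 : ℝ) * d) +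
          (2 * Real.pi * ((p.1 + a₁) * b₁ + (p.2 + a₂) * b₂) : ℝ)) * I := by
    push_cast
    ring
  rw [binaryThetaTerm, norm_mul, hsplit, add_mul, norm_exp_add_ofReal_mul_I, Complex.norm_exp,
    mul_I_re, add_im, add_im, im_ofReal_mul, im_ofReal_mul, im_ofReal_mul]
  push_cast
  ring_nf

lemma norm_binaryThetaTerm_le (x₁ x₂ : ℂ) {a b d : ℂ} (a₁ a₂ b₁ b₂ : ℝ) {ε : ℝ}
    (h : ∀ x y : ℝ, ε * (x ^ 2 + y ^ 2) ≤ a.im * x ^ 2 + 2 * b.im * x * y + d.im * y ^ 2)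
    (p : ℤ × ℤ) : ‖binaryThetaTerm x₁ x₂ a b d a₁ a₂ b₁ b₂ p‖ ≤
      (‖x₁‖ + ‖x₂‖) * ((1 + |p.1 + a₁|) * (1 + |p.2 + a₂|) *
        Real.exp (-(Real.pi * ε) * ((p.1 + a₁) ^ 2 + (p.2 + a₂) ^ 2))) := by
  rw [norm_binaryThetaTerm, ← mul_assoc]
  have hx := abs_nonneg (p.1 + a₁)
  have hy := abs_nonneg (p.2 + a₂)
  gcongr ?_ * Real.exp ?_
  · calc ‖x₁ * (p.1 + a₁ : ℝ) + x₂ * (p.2 + a₂ : ℝ)‖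
      _ ≤ ‖x₁‖ * |p.1 + a₁| + ‖x₂‖ * |p.2 + a₂| := by
        simpa only [norm_mul, norm_real, Real.norm_eq_abs] using
          norm_add_le (x₁ * (p.1 + a₁ : ℝ)) (x₂ * (p.2 + a₂ : ℝ))
      _ ≤ ‖x₁‖ * ((1 + |p.1 + a₁|) * (1 + |p.2 + a₂|)) +
          ‖x₂‖ * ((1 + |p.1 + a₁|) * (1 + |p.2 + a₂|)) := by
        gcongr <;> nlinarith
      _ = _ := (add_mul _ _ _).symm
  · linarith [mul_le_mul_of_nonneg_left (h (p.1 + a₁) (p.2 + a₂)) Real.pi_pos.le]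

namespace ImPosDef

variable {a b d : ℂ} (h : ImPosDef a b d)
include h

lemma im_pos_fst : 0 < a.im :=
  pos_of_mul_pos_left ((sq_nonneg _).trans_lt h.2) h.1.le

lemma swap : ImPosDef d b a :=
  ⟨h.im_pos_fst, mul_comm a.im d.im ▸ h.2⟩

lemma exists_forall_mul_le : ∃ ε > 0, ∀ x y : ℝ, ε * (x ^ 2 + y ^ 2) ≤
    a.im * x ^ 2 + 2 * b.im * x * y + d.im * y ^ 2 := by
  have htrace : 0 < a.im + d.im := add_pos h.im_pos_fst h.1
  refine ⟨(a.im * d.im - b.im ^ 2) / (a.im + d.im), div_pos (sub_pos.mpr h.2) htrace,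
    fun x y => ?_⟩
  rw [div_mul_eq_mul_div, div_le_iff₀' htrace]
  exact det_mul_le_trace_mul _ _ _ x y

lemma partialInversion : ImPosDef (a - b ^ 2 / d) (b / d) (-1 / d) := by
  refine ⟨im_neg_one_div_pos h.1, sub_pos.mp ?_⟩
  have hnorm := normSq_pos.mpr (ne_zero_of_im_pos h.1)
  have hdet : (a - b ^ 2 / d).im * (-1 / d).im - (b / d).im ^ 2 =
      (a.im * d.im - b.im ^ 2) / normSq d := by
    simp only [sub_im, div_im, neg_im, neg_re, one_im, one_re, pow_two, mul_re, mul_im]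
    field_simp
    rw [normSq_apply]
    ring
  rw [hdet]
  exact div_pos (sub_pos.mpr h.2) hnorm

lemma summable (x₁ x₂ : ℂ) (a₁ a₂ b₁ b₂ : ℝ) :
    Summable (binaryThetaTerm x₁ x₂ a b d a₁ a₂ b₁ b₂) := by
  obtain ⟨ε, hε, hform⟩ := h.exists_forall_mul_le
  exact .of_norm_bounded
    ((summable_one_add_abs_mul_gaussian_prod (mul_pos Real.pi_pos hε) a₁ a₂).mul_left _)
    (norm_binaryThetaTerm_le x₁ x₂ a₁ a₂ b₁ b₂ hform)

lemma tsum_partialInversion (x₁ x₂ : ℂ) (a₁ a₂ b₁ b₂ : ℝ) :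
    ∑' p, binaryThetaTerm (x₁ - x₂ * b / d) (x₂ / d) (a - b ^ 2 / d) (b / d) (-1 / d)
        a₁ (-b₂) b₁ a₂ p =
      cexp (-(2 * Real.pi * I * (a₂ * b₂))) * (-I * d) ^ (1 / 2 : ℂ) *
        ∑' p, binaryThetaTerm x₁ x₂ a b d a₁ a₂ b₁ b₂ p := by
  have hd0 := ne_zero_of_im_pos h.1
  rw [(h.partialInversion.summable _ _ _ _ _ _).tsum_prod, (h.summable _ _ _ _ _ _).tsum_prod,
    ← tsum_mul_left]
  refine tsum_congr fun n => ?_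
  have hdual (m : ℤ) : binaryThetaTerm (x₁ - x₂ * b / d) (x₂ / d) (a - b ^ 2 / d) (b / d) (-1 / d)
      a₁ (-b₂) b₁ a₂ (n, m) =
        cexp (Real.pi * I * (a * (n + a₁) ^ 2) + 2 * Real.pi * I * ((n + a₁) * b₁)) *
          cexp (2 * Real.pi * I * (a₂ * (b * (n + a₁)))) *
            thetaTerm (x₁ * (n + a₁)) (x₂ / d) (-(b * (n + a₁) + b₂)) a₂ (-1 / d) m := by
    rw [binaryThetaTerm, thetaTerm, mul_left_comm, ← Complex.exp_add, ← Complex.exp_add]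
    push_cast
    congr 1
    · field_simp
      ring
    · congr 1
      field_simp
      ring
  simp_rw [hdual, binaryThetaTerm_eq_mul_thetaTerm, tsum_mul_left,
    tsum_thetaTerm_inversion h.1 (x₁ * (n + a₁)) x₂ a₂ (b * (n + a₁) + b₂)]
  have hphase : cexp (-(2 * Real.pi * I * (a₂ * (b * (n + a₁) + b₂)))) =
      cexp (-(2 * Real.pi * I * (a₂ * b₂))) *
        (cexp (2 * Real.pi * I * (a₂ * (b * (n + a₁)))))⁻¹ := by
    rw [← Complex.exp_neg, ← Complex.exp_add]
    ring_nf
  rw [hphase]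
  field_simp

lemma sub_sq_div_eq : a - b ^ 2 / d = (a * d - b ^ 2) / d := by
  have hd0 := ne_zero_of_im_pos h.1
  field_simp

lemma det_ne_zero : a * d - b ^ 2 ≠ 0 := fun hzero =>
  ne_zero_of_im_pos h.partialInversion.im_pos_fst (by rw [h.sub_sq_div_eq, hzero, zero_div])

lemma inversion :
    ImPosDef (-d / (a * d - b ^ 2)) (b / (a * d - b ^ 2)) (-a / (a * d - b ^ 2)) := by
  have hd0 := ne_zero_of_im_pos h.1
  have hdet := h.det_ne_zero
  convert h.partialInversion.swap.partialInversion.swap using 1 <;> rw [h.sub_sq_div_eq]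
  · field_simp
  · field_simp
  · field_simp
    ring

theorem tsum_inversion (x₁ x₂ : ℂ) (a₁ a₂ b₁ b₂ : ℝ) :
    ∑' p, binaryThetaTerm ((d * x₁ - b * x₂) / (a * d - b ^ 2))
        ((a * x₂ - b * x₁) / (a * d - b ^ 2)) (-d / (a * d - b ^ 2)) (b / (a * d - b ^ 2))
        (-a / (a * d - b ^ 2)) (-b₁) (-b₂) a₁ a₂ p =
      cexp (-(2 * Real.pi * I * (a₁ * b₁ + a₂ * b₂))) *
        ((-I * d) ^ (1 / 2 : ℂ) * (-I * ((a * d - b ^ 2) / d)) ^ (1 / 2 : ℂ)) *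
          ∑' p, binaryThetaTerm x₁ x₂ a b d a₁ a₂ b₁ b₂ p := by
  have hd0 := ne_zero_of_im_pos h.1
  have hdet := h.det_ne_zero
  have hsecond := h.partialInversion.swap.tsum_partialInversion (x₂ / d) (x₁ - x₂ * b / d)
    (-b₂) a₁ a₂ b₁
  rw [tsum_binaryThetaTerm_swap, tsum_binaryThetaTerm_swap (x₁ - x₂ * b / d) (x₂ / d)
    (a - b ^ 2 / d) (b / d) (-1 / d), h.tsum_partialInversion, h.sub_sq_div_eq] at hsecond
  rw [mul_add, neg_add, Complex.exp_add]
  convert hsecond using 1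
  · refine tsum_congr fun p => ?_
    congr 1 <;> field_simp <;> ring
  · ring

end ImPosDef

/-! ### The theta kernel attached to a negative vector `(-s, 1)` -/

/-- `-Q(c)` for `c = (-s, 1)` and the form `2 Q = u² + 4 u v + 2 v²`. -/
def negQuad (s : ℝ) : ℝ := 2 * s - 1 - s ^ 2 / 2

lemma negQuad_mem_Icc {s : ℝ} (hs : s ∈ Set.Icc (1 : ℝ) 2) :
    negQuad s ∈ Set.Icc (1 / 2 : ℝ) 1 := by
  obtain ⟨h1, h2⟩ := hs
  unfold negQuad
  constructor <;> nlinarith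

lemma negQuad_pos {s : ℝ} (hs : s ∈ Set.Icc (1 : ℝ) 2) : 0 < negQuad s :=
  one_half_pos.trans_le (negQuad_mem_Icc hs).1

/-- The coefficient of `u²` in the form `τ X² - τ̄ Y²`, where
`2 Q = u² + 4 u v + 2 v² = X² - Y²` with `X = (u + s v) / √(-Q(c))` orthogonal to `c = (-s, 1)` and
`Y` proportional to `B(·, c)`. -/
def kernelA (τ : ℂ) (s : ℝ) : ℂ :=
  (τ - starRingEnd ℂ τ * ((2 - s) ^ 2 / 2)) / negQuad s

/-- Half the coefficient of `u v` in the form of `kernelA`. -/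
def kernelB (τ : ℂ) (s : ℝ) : ℂ :=
  (τ * s - starRingEnd ℂ τ * ((2 - s) * (1 - s))) / negQuad s

/-- The coefficient of `v²` in the form of `kernelA`. -/
def kernelD (τ : ℂ) (s : ℝ) : ℂ :=
  (τ * s ^ 2 - starRingEnd ℂ τ * (2 * (1 - s) ^ 2)) / negQuad s

lemma im_mul_sub_conj_mul_div (τ : ℂ) (x y r : ℝ) :
    ((τ * x - starRingEnd ℂ τ * y) / r).im = τ.im * (x + y) / r := by
  rw [div_ofReal_im, sub_im, im_mul_ofReal, im_mul_ofReal, conj_im]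
  ring

lemma kernelA_im (τ : ℂ) (s : ℝ) :
    (kernelA τ s).im = τ.im * (1 + (2 - s) ^ 2 / 2) / negQuad s := by
  rw [← im_mul_sub_conj_mul_div, kernelA]
  push_cast
  rw [mul_one]

lemma kernelB_im (τ : ℂ) (s : ℝ) :
    (kernelB τ s).im = τ.im * (s + (2 - s) * (1 - s)) / negQuad s := by
  rw [← im_mul_sub_conj_mul_div, kernelB]
  push_cast
  rfl

lemma kernelD_im (τ : ℂ) (s : ℝ) :
    (kernelD τ s).im = τ.im * (s ^ 2 + 2 * (1 - s) ^ 2) / negQuad s := by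
  rw [← im_mul_sub_conj_mul_div, kernelD]
  push_cast
  rfl

section

variable (τ : ℂ) {s : ℝ} (hs : s ∈ Set.Icc (1 : ℝ) 2)
include hs

lemma kernel_det :
    kernelA τ s * kernelD τ s - kernelB τ s ^ 2 = -2 * (τ * starRingEnd ℂ τ) := by
  have hQ : (negQuad s : ℂ) ≠ 0 := ofReal_ne_zero.mpr (negQuad_pos hs).ne'
  rw [kernelA, kernelB, kernelD]
  field_simp
  rw [negQuad]
  push_cast
  ring

lemma kernel_im_det :
    (kernelA τ s).im * (kernelD τ s).im - (kernelB τ s).im ^ 2 = 2 * τ.im ^ 2 := by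
  have hQ := (negQuad_pos hs).ne'
  rw [kernelA_im, kernelB_im, kernelD_im]
  field_simp
  rw [negQuad]
  ring

lemma smul_kernelB_sub_kernelD : s * kernelB τ s - kernelD τ s = 2 * starRingEnd ℂ τ * (s - 1) := by
  have hQ : (negQuad s : ℂ) ≠ 0 := ofReal_ne_zero.mpr (negQuad_pos hs).ne'
  rw [kernelB, kernelD]
  field_simp
  rw [negQuad]
  push_cast
  ring

lemma kernelB_sub_smul_kernelA :
    kernelB τ s - s * kernelA τ s = 2 * starRingEnd ℂ τ * (1 - s / 2) := by
  have hQ : (negQuad s : ℂ) ≠ 0 := ofReal_ne_zero.mpr (negQuad_pos hs).ne'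
  rw [kernelA, kernelB]
  field_simp
  rw [negQuad]
  push_cast
  ring

variable {τ} (hτ : 0 < τ.im)
include hτ

lemma kernel_im_trace_le : (kernelA τ s).im + (kernelD τ s).im ≤ 15 * τ.im := by
  obtain ⟨hQ, -⟩ := negQuad_mem_Icc hs
  have htrace : 1 + (2 - s) ^ 2 / 2 + (s ^ 2 + 2 * (1 - s) ^ 2) ≤ 15 * negQuad s := by
    nlinarith [hs.1, hs.2]
  rw [kernelA_im, kernelD_im, ← add_div, div_le_iff₀ (negQuad_pos hs)]
  linarith [mul_le_mul_of_nonneg_left htrace hτ.le]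

lemma kernel_imPosDef : ImPosDef (kernelA τ s) (kernelB τ s) (kernelD τ s) := by
  refine ⟨?_, sub_pos.mp (by rw [kernel_im_det τ hs]; positivity)⟩
  have hs0 : 0 < s := one_pos.trans_le hs.1
  have hQ := negQuad_pos hs
  rw [kernelD_im]
  positivity

lemma kernel_im_lower (u v : ℝ) : 2 / 15 * τ.im * (u ^ 2 + v ^ 2) ≤
    (kernelA τ s).im * u ^ 2 + 2 * (kernelB τ s).im * u * v + (kernelD τ s).im * v ^ 2 := by
  have hpd := kernel_imPosDef hs hτ
  have hform := det_mul_le_trace_mul (kernelA τ s).im (kernelB τ s).im (kernelD τ s).im u v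
  rw [kernel_im_det τ hs] at hform
  set F := (kernelA τ s).im * u ^ 2 + 2 * (kernelB τ s).im * u * v + (kernelD τ s).im * v ^ 2
  have hF : 0 ≤ F :=
    nonneg_of_mul_nonneg_right ((by positivity : (0 : ℝ) ≤ _).trans hform)
      (add_pos hpd.im_pos_fst hpd.1)
  have htrace := hform.trans (mul_le_mul_of_nonneg_right (kernel_im_trace_le hs hτ) hF)
  have hcancel : τ.im * (2 * τ.im * (u ^ 2 + v ^ 2)) ≤ τ.im * (15 * F) := by linarith
  linarith [le_of_mul_le_mul_left hcancel hτ]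

end

/-- The term of index `ν = (n₁ + 1/2, n₂ - l/2)` of the theta kernel, whose integral over `s`
gives the term of `ϑ^l`. -/
def kernelTerm (l : ℤ) (τ : ℂ) (s : ℝ) : ℤ × ℤ → ℂ :=
  binaryThetaTerm 1 s (kernelA τ s) (kernelB τ s) (kernelD τ s) (1 / 2) (-(l / 2)) (1 / 2) 1

/-! ### Inversion of the theta kernel -/

lemma tsum_eq_add_of_isCompl {ι κ₀ κ₁ M : Type*} [NormedAddCommGroup M] [CompleteSpace M]
    {f : ι → M} (hf : Summable f) {g₀ : κ₀ → ι} {g₁ : κ₁ → ι} (h₀ : Function.Injective g₀)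
    (h₁ : Function.Injective g₁) (h : IsCompl (Set.range g₀) (Set.range g₁)) :
    ∑' i, f i = ∑' k, f (g₀ k) + ∑' k, f (g₁ k) := by
  rw [← hf.tsum_subtype_add_tsum_subtype_compl (Set.range g₀), h.compl_eq, tsum_range f h₀,
    tsum_range f h₁]

lemma cpow_half_mul_cpow_half {z : ℂ} (hz : 0 < z.im) {r : ℝ} (hr : 0 < r) :
    (-I * z) ^ (1 / 2 : ℂ) * (-I * (-(r : ℂ) ^ 2 / z)) ^ (1 / 2 : ℂ) = r := by
  have hIz : -I * z ≠ 0 := mul_ne_zero (neg_ne_zero.mpr I_ne_zero) (ne_zero_of_im_pos hz)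
  have hslit : -I * z ∈ slitPlane := Or.inl (by simpa using hz)
  have hr2 : 0 < r ^ 2 := by positivity
  have hw : -I * (-(r : ℂ) ^ 2 / z) = (r ^ 2 : ℝ) * (-I * z)⁻¹ := by
    push_cast
    rw [mul_inv, ← neg_inv, inv_I]
    ring
  rw [hw, cpow_def_of_ne_zero hIz, cpow_def_of_ne_zero
    (mul_ne_zero (ofReal_ne_zero.mpr hr2.ne') (inv_ne_zero hIz)), ← Complex.exp_add,
    log_ofReal_mul hr2 (inv_ne_zero hIz), log_inv _ (slitPlane_arg_ne_pi hslit), Real.log_pow]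
  conv_rhs => rw [← Real.exp_log hr, ofReal_exp]
  push_cast
  ring_nf

/-- The lattice points of the dual lattice in the class of `l`, in the coordinates of
`(1/2, -l/2) + ℤ²`. -/
def dualIndex (l : ℤ) (p : ℤ × ℤ) : ℤ × ℤ :=
  (p.1 + 2 * p.2 + 1 - l, 2 * (p.1 + p.2 + 1 - l) + l)

lemma dualIndex_injective (l : ℤ) : Function.Injective (dualIndex l) := by
  rintro ⟨a, b⟩ ⟨c, d⟩ h
  simp only [dualIndex, Prod.mk.injEq] at h ⊢
  lia

lemma dualIndex_isCompl : IsCompl (Set.range (dualIndex 0)) (Set.range (dualIndex 1)) := by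
  constructor
  · rw [Set.disjoint_left]
    rintro _ ⟨p, rfl⟩ ⟨p', h⟩
    simp only [dualIndex, Prod.mk.injEq] at h
    lia
  · rw [codisjoint_iff_le_sup]
    rintro ⟨a, b⟩ -
    obtain ⟨k, rfl | rfl⟩ := Int.even_or_odd' b
    · exact Or.inl ⟨(2 * k - a - 1, a - k), by simp only [dualIndex, Prod.mk.injEq]; lia⟩
    · exact Or.inr ⟨(2 * k - a, a - k), by simp only [dualIndex, Prod.mk.injEq]; lia⟩

lemma binaryThetaTerm_smul (c x₁ x₂ a b d : ℂ) (a₁ a₂ b₁ b₂ : ℝ) (p : ℤ × ℤ) :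
    binaryThetaTerm (c * x₁) (c * x₂) a b d a₁ a₂ b₁ b₂ p =
      c * binaryThetaTerm x₁ x₂ a b d a₁ a₂ b₁ b₂ p := by
  simp only [binaryThetaTerm]
  ring

/-- In the coordinates of `dualIndex`, a form with coefficients `a`, `b`, `d` at `(v - u, u - v/2)`
becomes a form at `(u, v)`. -/
lemma binaryThetaTerm_dualIndex (x₁ x₂ a b d : ℂ) (l l' : ℤ) (p : ℤ × ℤ) :
    binaryThetaTerm (x₂ - x₁) (x₁ - x₂ / 2) (a - 2 * b + d) (3 / 2 * b - a - d / 2)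
        (a - b + d / 4) (-(1 / 2)) (-1) (1 / 2) (-(l / 2)) (dualIndex l' p) =
      (-1) ^ (l * (1 + l')) * binaryThetaTerm x₁ x₂ a b d (1 / 2) (-(l' / 2)) (1 / 2) 1 p := by
  have hphase : ((-1 : ℂ)) ^ (l * (1 + l')) =
      cexp ((l * (1 + l') : ℤ) * (Real.pi * I)) := by
    rw [Complex.exp_int_mul, exp_pi_mul_I]
  rw [binaryThetaTerm, binaryThetaTerm, hphase, mul_left_comm, ← Complex.exp_add]
  congr 1
  · simp only [dualIndex]
    push_cast
    ring
  · rw [Complex.exp_eq_exp_iff_exists_int]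
    refine ⟨-(l * (p.1 + p.2 + 1)), ?_⟩
    simp only [dualIndex]
    push_cast
    ring

section

variable {τ : ℂ} (hτ : 0 < τ.im) {s : ℝ} (hs : s ∈ Set.Icc (1 : ℝ) 2)
include hτ hs

lemma kernelTerm_dualIndex (l l' : ℤ) (p : ℤ × ℤ) :
    binaryThetaTerm
        ((kernelD τ s * 1 - kernelB τ s * s) / (-2 * (τ * starRingEnd ℂ τ)))
        ((kernelA τ s * s - kernelB τ s * 1) / (-2 * (τ * starRingEnd ℂ τ)))
        (-kernelD τ s / (-2 * (τ * starRingEnd ℂ τ))) (kernelB τ s / (-2 * (τ * starRingEnd ℂ τ)))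
        (-kernelA τ s / (-2 * (τ * starRingEnd ℂ τ))) (-(1 / 2)) (-1) (1 / 2) (-(l / 2))
        (dualIndex l' p) =
      1 / τ * ((-1) ^ (l * (1 + l')) * kernelTerm l' (-1 / τ) s p) := by
  have hτ0 := ne_zero_of_im_pos hτ
  have hconj : starRingEnd ℂ τ ≠ 0 := (map_ne_zero _).mpr hτ0
  have hQ : (negQuad s : ℂ) ≠ 0 := ofReal_ne_zero.mpr (negQuad_pos hs).ne'
  have hx₁ : (kernelD τ s * 1 - kernelB τ s * s) / (-2 * (τ * starRingEnd ℂ τ)) =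
      1 / τ * (s - 1) := by
    field_simp
    linear_combination smul_kernelB_sub_kernelD τ hs
  have hx₂ : (kernelA τ s * s - kernelB τ s * 1) / (-2 * (τ * starRingEnd ℂ τ)) =
      1 / τ * (1 - s / 2) := by
    field_simp
    linear_combination kernelB_sub_smul_kernelA τ hs
  have hA : -kernelD τ s / (-2 * (τ * starRingEnd ℂ τ)) =
      kernelA (-1 / τ) s - 2 * kernelB (-1 / τ) s + kernelD (-1 / τ) s := by
    simp only [kernelA, kernelB, kernelD, map_div₀, map_neg, map_one]
    field_simp
    ring
  have hB : kernelB τ s / (-2 * (τ * starRingEnd ℂ τ)) =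
      3 / 2 * kernelB (-1 / τ) s - kernelA (-1 / τ) s - kernelD (-1 / τ) s / 2 := by
    simp only [kernelA, kernelB, kernelD, map_div₀, map_neg, map_one]
    field_simp
    ring
  have hD : -kernelA τ s / (-2 * (τ * starRingEnd ℂ τ)) =
      kernelA (-1 / τ) s - kernelB (-1 / τ) s + kernelD (-1 / τ) s / 4 := by
    simp only [kernelA, kernelB, kernelD, map_div₀, map_neg, map_one]
    field_simp
    ring
  rw [hx₁, hx₂, hA, hB, hD, binaryThetaTerm_smul, binaryThetaTerm_dualIndex, kernelTerm]

theorem kernel_inversion (l : ℤ) : (Real.sqrt 2 * ‖τ‖ : ℝ) * ∑' p, kernelTerm l τ s p =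
    I / τ * (∑' p, kernelTerm 0 (-1 / τ) s p + (-1) ^ l * ∑' p, kernelTerm 1 (-1 / τ) s p) := by
  have hpd := kernel_imPosDef hs hτ
  have hinv := hpd.tsum_inversion 1 s (1 / 2) (-(l / 2)) (1 / 2) 1
  have hdet : -2 * (τ * starRingEnd ℂ τ) = -((Real.sqrt 2 * ‖τ‖ : ℝ) : ℂ) ^ 2 := by
    rw [← ofReal_pow, mul_pow, Real.sq_sqrt zero_le_two, mul_conj, normSq_eq_norm_sq]
    push_cast
    ring
  have hphase : cexp (-(2 * Real.pi * I * ((1 / 2 : ℝ) * (1 / 2 : ℝ) +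
      (-(l / 2) : ℝ) * (1 : ℝ)))) = -I * (-1) ^ l := by
    rw [← exp_pi_mul_I, ← Complex.exp_int_mul, ← exp_neg_pi_div_two_mul_I, ← Complex.exp_add]
    push_cast
    ring_nf
  have hroots := cpow_half_mul_cpow_half hpd.1
    (mul_pos (Real.sqrt_pos.mpr two_pos) (norm_pos_iff.mpr (ne_zero_of_im_pos hτ)))
  rw [tsum_eq_add_of_isCompl (hpd.inversion.summable _ _ _ _ _ _) (dualIndex_injective 0)
    (dualIndex_injective 1) dualIndex_isCompl, kernel_det τ hs, hphase] at hinv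
  simp_rw [kernelTerm_dualIndex hτ hs, tsum_mul_left, hdet, hroots] at hinv
  change _ = _ * ∑' p, kernelTerm l τ s p at hinv
  have hneg : (-1 : ℂ) ≠ 0 := neg_ne_zero.mpr one_ne_zero
  have hsign : (-1 : ℂ) ^ l * (-1) ^ l = 1 := by
    rw [← mul_zpow, neg_one_mul, neg_neg, _root_.one_zpow]
  rw [add_zero, mul_one, mul_add, mul_one, zpow_add₀ hneg, hsign] at hinv
  set K := ∑' p, kernelTerm l τ s p
  set K₀ := ∑' p, kernelTerm 0 (-1 / τ) s p
  set K₁ := ∑' p, kernelTerm 1 (-1 / τ) s p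
  linear_combination -(I * (-1) ^ l) * hinv +
    (I / τ * K₀ + I ^ 2 * (Real.sqrt 2 * ‖τ‖ : ℝ) * K) * hsign +
    (Real.sqrt 2 * ‖τ‖ : ℝ) * K * I_sq

end

/-! ### The function `β` and the error function -/

lemma integrableOn_gaussian (x : ℝ) :
    IntegrableOn (fun t : ℝ => Real.exp (-Real.pi * t ^ 2)) (Set.Ioi x) :=
  (integrable_exp_neg_mul_sq Real.pi_pos).integrableOn

lemma integral_gaussian_Ioi_zero :
    ∫ t in Set.Ioi (0 : ℝ), Real.exp (-Real.pi * t ^ 2) = 1 / 2 := by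
  rw [integral_gaussian_Ioi, div_self Real.pi_pos.ne', Real.sqrt_one]

lemma image_sq_Ioi {x : ℝ} (hx : 0 ≤ x) : (fun t : ℝ => t ^ 2) '' Set.Ioi x = Set.Ioi (x ^ 2) := by
  ext w
  constructor
  · rintro ⟨t, ht, rfl⟩
    exact pow_lt_pow_left₀ ht hx two_ne_zero
  · intro hw
    exact ⟨Real.sqrt w, Real.lt_sqrt_of_sq_lt hw, Real.sq_sqrt ((sq_nonneg x).trans hw.le)⟩

lemma beta_sq {x : ℝ} (hx : 0 ≤ x) :
    beta (x ^ 2) = 2 * ∫ t in Set.Ioi x, Real.exp (-Real.pi * t ^ 2) := by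
  have hinj : Set.InjOn (fun t : ℝ => t ^ 2) (Set.Ioi x) := fun a ha b hb hab =>
    (sq_eq_sq₀ (hx.trans ha.le) (hx.trans hb.le)).mp hab
  rw [beta, ← image_sq_Ioi hx, integral_image_eq_integral_abs_deriv_smul measurableSet_Ioi
    (fun t _ => (hasDerivAt_pow 2 t).hasDerivWithinAt) hinj, ← integral_const_mul]
  refine setIntegral_congr_fun measurableSet_Ioi fun t ht => ?_
  have ht0 : 0 < t := hx.trans_lt ht
  have hrpow : (t ^ 2) ^ (-(1 / 2) : ℝ) = t⁻¹ := by
    rw [Real.rpow_neg (sq_nonneg t), ← Real.sqrt_eq_rpow, Real.sqrt_sq ht0.le]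
  simp only [smul_eq_mul, hrpow, Nat.cast_ofNat, Nat.add_one_sub_one, pow_one]
  rw [abs_of_pos (by positivity)]
  field_simp

/-- `2 ∫₀ˣ e^{-πt²} dt`. -/
def erfPi (x : ℝ) : ℝ := 2 * ∫ t in (0 : ℝ)..x, Real.exp (-Real.pi * t ^ 2)

lemma hasDerivAt_erfPi (x : ℝ) : HasDerivAt erfPi (2 * Real.exp (-Real.pi * x ^ 2)) x := by
  have hc : Continuous fun t : ℝ => Real.exp (-Real.pi * t ^ 2) := by fun_prop
  exact (intervalIntegral.integral_hasDerivAt_right (hc.intervalIntegrable _ _)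
    (hc.stronglyMeasurableAtFilter _ _) hc.continuousAt).const_mul 2

lemma erfPi_neg (x : ℝ) : erfPi (-x) = -erfPi x := by
  have h := intervalIntegral.integral_comp_neg (a := 0) (b := x)
    (fun t : ℝ => Real.exp (-Real.pi * t ^ 2))
  simp only [neg_sq, neg_zero] at h
  rw [erfPi, erfPi, h, intervalIntegral.integral_symm]
  ring

lemma erfPi_of_nonneg {x : ℝ} (hx : 0 ≤ x) : erfPi x = 1 - beta (x ^ 2) := by
  have h := intervalIntegral.integral_interval_add_Ioi (integrableOn_gaussian 0)
    (integrableOn_gaussian x)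
  rw [integral_gaussian_Ioi_zero] at h
  rw [erfPi, beta_sq hx]
  linarith

lemma sign_mul_one_sub_beta (x : ℝ) : Real.sign x * (1 - beta (x ^ 2)) = erfPi x := by
  rcases lt_trichotomy x 0 with h | h | h
  · rw [Real.sign_of_neg h, ← neg_neg x, erfPi_neg, erfPi_of_nonneg (by linarith), neg_neg, neg_sq]
    ring
  · simp [h, erfPi]
  · rw [Real.sign_of_pos h, erfPi_of_nonneg h.le, one_mul]

lemma beta_nonneg {x : ℝ} (hx : 0 ≤ x) : 0 ≤ beta x :=
  setIntegral_nonneg measurableSet_Ioi fun _ hu =>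
    mul_nonneg (Real.rpow_nonneg (hx.trans hu.le) _) (Real.exp_pos _).le

lemma beta_le {x : ℝ} (hx : 0 ≤ x) : beta x ≤ Real.exp (-Real.pi * x) := by
  obtain ⟨r, hr, rfl⟩ : ∃ r, 0 ≤ r ∧ r ^ 2 = x := ⟨Real.sqrt x, Real.sqrt_nonneg x, Real.sq_sqrt hx⟩
  have hshift : ∫ t in Set.Ioi (0 : ℝ), Real.exp (-Real.pi * (t + r) ^ 2) =
      ∫ t in Set.Ioi r, Real.exp (-Real.pi * t ^ 2) := by
    simpa only [Set.preimage_add_const_Ioi, sub_self] using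
      (measurePreserving_add_right volume r).setIntegral_preimage_emb
        (measurableEmbedding_addRight r) (fun t => Real.exp (-Real.pi * t ^ 2)) (Set.Ioi r)
  have hmono : ∫ t in Set.Ioi (0 : ℝ), Real.exp (-Real.pi * (t + r) ^ 2) ≤
      ∫ t in Set.Ioi (0 : ℝ), Real.exp (-Real.pi * r ^ 2) * Real.exp (-Real.pi * t ^ 2) := by
    refine setIntegral_mono_on
      ((integrable_exp_neg_mul_sq Real.pi_pos).comp_add_right r).integrableOn
      ((integrableOn_gaussian 0).const_mul _) measurableSet_Ioi fun t ht => ?_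
    rw [← Real.exp_add, Real.exp_le_exp]
    linarith [mul_nonneg Real.pi_pos.le (mul_nonneg (le_of_lt ht) hr)]
  rw [hshift, integral_const_mul, integral_gaussian_Ioi_zero] at hmono
  rw [beta_sq hr]
  linarith

/-! ### The data of the indefinite theta functions in coordinates -/

lemma bilin_A₀ (μ ν : Fin 2 → ℝ) :
    bilin A₀ μ ν = μ 0 * (ν 0 + 2 * ν 1) + μ 1 * (2 * ν 0 + 2 * ν 1) := by
  simp [bilin, A₀, Matrix.mulVec, dotProduct, Fin.sum_univ_two]

lemma bilin_c₁ (ν : Fin 2 → ℝ) : bilin A₀ ν c₁ = ν 0 := by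
  norm_num [bilin_A₀, c₁]

lemma bilin_c₂ (ν : Fin 2 → ℝ) : bilin A₀ ν c₂ = -2 * ν 1 := by
  norm_num [bilin_A₀, c₂, mul_comm]

lemma bilin_b₀ (ν : Fin 2 → ℝ) : bilin A₀ ν b₀ = ν 0 / 2 + ν 1 := by
  norm_num [bilin_A₀, b₀, div_eq_mul_inv]

lemma quad_A₀ (ν : Fin 2 → ℝ) : quad A₀ ν = ν 0 ^ 2 / 2 + 2 * ν 0 * ν 1 + ν 1 ^ 2 := by
  rw [quad, bilin_A₀]
  ring

lemma quad_c₁ : quad A₀ c₁ = -(1 / 2) := by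
  norm_num [quad_A₀, c₁]

lemma quad_c₂ : quad A₀ c₂ = -1 := by
  norm_num [quad_A₀, c₂]

lemma isSymm_A₀ : A₀.IsSymm := by
  ext i j
  fin_cases i <;> fin_cases j <;> simp [A₀]

lemma det_A₀ : A₀.det = -2 := by
  norm_num [A₀, Matrix.det_fin_two_of]

lemma bilin_c₁_c₂ : bilin A₀ c₁ c₂ = -2 := by
  norm_num [bilin_c₂, c₁]

/-- The point `(n₁ + 1/2, n₂ - l/2)` of the coset `a(l) + ℤ²`. -/
def cosetPoint (l : ℤ) (p : ℤ × ℤ) : Fin 2 → ℝ := ![p.1 + 1 / 2, p.2 + -(l / 2)]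

lemma shift_a₀ (l : ℤ) (n : Fin 2 → ℤ) :
    shift (a₀ l) n = cosetPoint l (finTwoArrowEquiv ℤ n) := by
  funext i
  fin_cases i <;> exact add_comm _ _

lemma hasSum_shift_a₀ {f : (Fin 2 → ℝ) → ℂ} {l : ℤ} {a : ℂ} :
    HasSum (fun n => f (shift (a₀ l) n)) a ↔ HasSum (fun p => f (cosetPoint l p)) a := by
  rw [← (finTwoArrowEquiv ℤ).hasSum_iff]
  simp only [Function.comp_def, shift_a₀]

lemma tsum_shift_a₀ (f : (Fin 2 → ℝ) → ℂ) (l : ℤ) :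
    ∑' n, f (shift (a₀ l) n) = ∑' p, f (cosetPoint l p) := by
  rw [← (finTwoArrowEquiv ℤ).tsum_eq]
  simp only [shift_a₀]

lemma sign_mul_of_pos {r : ℝ} (hr : 0 < r) (x : ℝ) : Real.sign (r * x) = Real.sign x := by
  rcases lt_trichotomy x 0 with h | rfl | h
  · rw [Real.sign_of_neg h, Real.sign_of_neg (mul_neg_of_pos_of_neg hr h)]
  · rw [mul_zero]
  · rw [Real.sign_of_pos h, Real.sign_of_pos (mul_pos hr h)]

lemma sign_neg_two_mul (x : ℝ) : Real.sign (-2 * x) = -Real.sign x := by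
  rw [neg_mul, Real.sign_neg, sign_mul_of_pos two_pos]

lemma rho_eq (ν : Fin 2 → ℝ) (τ : ℍ) : rho A₀ c₁ c₂ ν τ =
    erfPi (Real.sqrt (2 * τ.im) * ν 0) + erfPi (2 * Real.sqrt τ.im * ν 1) := by
  have hy := τ.im_pos
  have hsq₁ : (Real.sqrt (2 * τ.im) * ν 0) ^ 2 = -(ν 0 ^ 2 / -(1 / 2)) * τ.im := by
    rw [mul_pow, Real.sq_sqrt (by positivity)]
    ring
  have hsq₂ : (2 * Real.sqrt τ.im * ν 1) ^ 2 = -((-2 * ν 1) ^ 2 / -1) * τ.im := by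
    rw [mul_pow, mul_pow, Real.sq_sqrt hy.le]
    ring
  rw [rho, bilin_c₁, bilin_c₂, quad_c₁, quad_c₂, sign_neg_two_mul, ← sign_mul_one_sub_beta,
    ← sign_mul_one_sub_beta, sign_mul_of_pos (Real.sqrt_pos.mpr (mul_pos two_pos hy)),
    sign_mul_of_pos (mul_pos two_pos (Real.sqrt_pos.mpr hy)), hsq₁, hsq₂]
  ring

lemma betaTerm_c₁ (ν : Fin 2 → ℝ) (τ : ℍ) :
    betaTerm A₀ c₁ ν τ = Real.sign (ν 0) * beta (2 * ν 0 ^ 2 * τ.im) := by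
  rw [betaTerm, bilin_c₁, quad_c₁]
  ring_nf

lemma betaTerm_c₂ (ν : Fin 2 → ℝ) (τ : ℍ) :
    betaTerm A₀ c₂ ν τ = -(Real.sign (ν 1) * beta (4 * ν 1 ^ 2 * τ.im)) := by
  rw [betaTerm, bilin_c₂, quad_c₂, sign_neg_two_mul]
  ring_nf

lemma qTerm_eq (ν : Fin 2 → ℝ) (τ : ℍ) : qTerm A₀ b₀ ν τ =
    cexp (2 * Real.pi * I * (ν 0 / 2 + ν 1) +
      2 * Real.pi * I * (ν 0 ^ 2 / 2 + 2 * ν 0 * ν 1 + ν 1 ^ 2) * τ) := by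
  rw [qTerm, bilin_b₀, quad_A₀]
  push_cast
  rfl

lemma norm_qTerm (A : Matrix (Fin 2) (Fin 2) ℝ) (b ν : Fin 2 → ℝ) (τ : ℍ) :
    ‖qTerm A b ν τ‖ = Real.exp (-2 * Real.pi * τ.im * quad A ν) := by
  have hsplit : 2 * Real.pi * I * bilin A ν b + 2 * Real.pi * I * quad A ν * τ =
      (2 * Real.pi * quad A ν : ℝ) * τ * I + (2 * Real.pi * bilin A ν b : ℝ) * I := by
    push_cast
    ring
  rw [qTerm, hsplit, norm_exp_add_ofReal_mul_I, Complex.norm_exp, mul_I_re, im_ofReal_mul,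
    UpperHalfPlane.coe_im]
  ring_nf

/-! ### `ϑ^ℓ` as an integral of theta kernels -/

lemma continuous_negQuad : Continuous negQuad := by
  unfold negQuad
  fun_prop

lemma hasDerivAt_negQuad (s : ℝ) : HasDerivAt negQuad (2 - s) s := by
  refine ((((hasDerivAt_id s).const_mul 2).sub_const 1).sub
    ((hasDerivAt_pow 2 s).div_const 2)).congr_deriv ?_
  norm_num

/-- The density against which the theta kernels are integrated. -/
def kernelWeight (s : ℝ) : ℝ := 2 / (negQuad s * Real.sqrt (negQuad s))

lemma continuousOn_kernelWeight : ContinuousOn kernelWeight (Set.Icc 1 2) :=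
  continuousOn_const.div (continuous_negQuad.mul continuous_negQuad.sqrt).continuousOn fun _ hs =>
    (mul_pos (negQuad_pos hs) (Real.sqrt_pos.mpr (negQuad_pos hs))).ne'

lemma norm_kernelWeight_le {s : ℝ} (hs : s ∈ Set.Icc (1 : ℝ) 2) : ‖(kernelWeight s : ℂ)‖ ≤ 8 := by
  have hQ := negQuad_pos hs
  have hhalf := (negQuad_mem_Icc hs).1
  have hsqrt : 1 / 2 ≤ Real.sqrt (negQuad s) := Real.le_sqrt_of_sq_le (by linarith)
  rw [norm_real, Real.norm_of_nonneg (by unfold kernelWeight; positivity), kernelWeight,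
    div_le_iff₀ (by positivity)]
  linarith [mul_le_mul hhalf hsqrt (by norm_num) hQ.le]

lemma continuousOn_kernelTerm (l : ℤ) (τ : ℂ) (p : ℤ × ℤ) :
    ContinuousOn (fun s => kernelTerm l τ s p) (Set.Icc 1 2) := by
  have hQ : ContinuousOn (fun s => (negQuad s : ℂ)) (Set.Icc 1 2) :=
    (continuous_ofReal.comp continuous_negQuad).continuousOn
  have hQ0 : ∀ s ∈ Set.Icc (1 : ℝ) 2, (negQuad s : ℂ) ≠ 0 := fun s hs =>
    ofReal_ne_zero.mpr (negQuad_pos hs).ne'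
  have hA : ContinuousOn (kernelA τ) (Set.Icc 1 2) := ContinuousOn.div (by fun_prop) hQ hQ0
  have hB : ContinuousOn (kernelB τ) (Set.Icc 1 2) := ContinuousOn.div (by fun_prop) hQ hQ0
  have hD : ContinuousOn (kernelD τ) (Set.Icc 1 2) := ContinuousOn.div (by fun_prop) hQ hQ0
  unfold kernelTerm binaryThetaTerm
  fun_prop

/-- A summable bound for the weighted theta kernel, uniform in `s ∈ [1, 2]`. -/
def kernelBound (l : ℤ) (y : ℝ) (p : ℤ × ℤ) : ℝ :=
  24 * ((1 + |(p.1 : ℝ) + 1 / 2|) * (1 + |(p.2 : ℝ) + -(l / 2)|) *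
    Real.exp (-(Real.pi * (2 / 15 * y)) * ((p.1 + 1 / 2) ^ 2 + (p.2 + -(l / 2)) ^ 2)))

lemma summable_kernelBound (l : ℤ) {y : ℝ} (hy : 0 < y) : Summable (kernelBound l y) :=
  (summable_one_add_abs_mul_gaussian_prod (by positivity) _ _).mul_left _

section

variable (l : ℤ) {τ : ℂ} (hτ : 0 < τ.im)
include hτ

lemma norm_kernelTerm_le {s : ℝ} (hs : s ∈ Set.Icc (1 : ℝ) 2) (p : ℤ × ℤ) :
    ‖kernelWeight s * kernelTerm l τ s p‖ ≤ kernelBound l τ.im p := by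
  have hterm : ‖kernelTerm l τ s p‖ ≤ _ :=
    norm_binaryThetaTerm_le 1 s _ _ _ _ (kernel_im_lower hs hτ) p
  have hs3 : ‖(1 : ℂ)‖ + ‖(s : ℂ)‖ ≤ 3 := by
    rw [norm_one, norm_real, Real.norm_of_nonneg (by linarith [hs.1])]
    linarith [hs.2]
  calc ‖kernelWeight s * kernelTerm l τ s p‖
    _ ≤ 8 * (3 * _) := by
      rw [norm_mul]
      exact mul_le_mul (norm_kernelWeight_le hs)
        (hterm.trans (mul_le_mul_of_nonneg_right hs3 (by positivity))) (norm_nonneg _)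
        (by norm_num)
    _ = kernelBound l τ.im p := by
      rw [kernelBound, ← mul_assoc]
      norm_num

lemma summable_kernelTerm {s : ℝ} (hs : s ∈ Set.Icc (1 : ℝ) 2) : Summable (kernelTerm l τ s) :=
  (kernel_imPosDef hs hτ).summable _ _ _ _ _ _

lemma continuousOn_tsum_kernelTerm :
    ContinuousOn (fun s => kernelWeight s * ∑' p, kernelTerm l τ s p) (Set.Icc 1 2) := by
  simp_rw [← tsum_mul_left]
  exact continuousOn_tsum (fun p => (continuous_ofReal.comp_continuousOn
    continuousOn_kernelWeight).mul (continuousOn_kernelTerm l τ p))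
    (summable_kernelBound l hτ) fun p _ hs => norm_kernelTerm_le l hτ hs p

lemma intervalIntegrable_tsum_kernelTerm :
    IntervalIntegrable (fun s => kernelWeight s * ∑' p, kernelTerm l τ s p) volume 1 2 :=
  (continuousOn_tsum_kernelTerm l hτ).intervalIntegrable_of_Icc one_le_two

end

/-- `√y · B(ν, c) / √(-Q(c))` for `ν = (u, v)` and `c = (-s, 1)`, the argument of the error function
attached to `c`. -/
def erfArg (y u v s : ℝ) : ℝ :=
  Real.sqrt y * (((2 - s) * u + 2 * (1 - s) * v) / Real.sqrt (negQuad s))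

lemma erfArg_one {y : ℝ} (u v : ℝ) : erfArg y u v 1 = Real.sqrt (2 * y) * u := by
  have hQ : negQuad 1 = 2⁻¹ := by norm_num [negQuad]
  rw [erfArg, hQ, Real.sqrt_inv, Real.sqrt_mul zero_le_two]
  field_simp
  ring

lemma erfArg_two (y u v : ℝ) : erfArg y u v 2 = -(2 * Real.sqrt y * v) := by
  have hQ : negQuad 2 = 1 := by norm_num [negQuad]
  rw [erfArg, hQ, Real.sqrt_one]
  ring

lemma erfArg_sq {y s : ℝ} (hy : 0 ≤ y) (hs : s ∈ Set.Icc (1 : ℝ) 2) (u v : ℝ) :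
    erfArg y u v s ^ 2 = y * (((2 - s) * u + 2 * (1 - s) * v) ^ 2 / negQuad s) := by
  rw [erfArg, mul_pow, div_pow, Real.sq_sqrt hy, Real.sq_sqrt (negQuad_pos hs).le]

lemma continuousOn_erfArg (y u v : ℝ) : ContinuousOn (erfArg y u v) (Set.Icc 1 2) :=
  continuousOn_const.mul (ContinuousOn.div (by fun_prop) continuous_negQuad.sqrt.continuousOn
    fun _ hs => (Real.sqrt_pos.mpr (negQuad_pos hs)).ne')

lemma hasDerivAt_erfArg (y u v : ℝ) {s : ℝ} (hs : s ∈ Set.Icc (1 : ℝ) 2) :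
    HasDerivAt (erfArg y u v) (-(Real.sqrt y * (kernelWeight s / 2 * (u + s * v)))) s := by
  have hQ := negQuad_pos hs
  have hsqrt : Real.sqrt (negQuad s) ≠ 0 := (Real.sqrt_pos.mpr hQ).ne'
  have hnum : HasDerivAt (fun s : ℝ => (2 - s) * u + 2 * (1 - s) * v)
      (-1 * u + 2 * -1 * v) s :=
    (((hasDerivAt_id s).const_sub 2).mul_const u).add
      ((((hasDerivAt_id s).const_sub 1).const_mul 2).mul_const v)
  refine ((hnum.div ((hasDerivAt_negQuad s).sqrt hQ.ne') hsqrt).const_mul (Real.sqrt y)).congr_deriv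
    ?_
  rw [kernelWeight, Real.sq_sqrt hQ.le]
  field_simp
  rw [Real.sq_sqrt hQ.le, negQuad]
  ring

lemma integral_erfArg (y u v : ℝ) :
    ∫ s in (1 : ℝ)..2, Real.sqrt y *
      (kernelWeight s * ((u + s * v) * Real.exp (-Real.pi * erfArg y u v s ^ 2))) =
        erfPi (Real.sqrt (2 * y) * u) + erfPi (2 * Real.sqrt y * v) := by
  have hderiv (s : ℝ) (hs : s ∈ Set.uIcc (1 : ℝ) 2) : HasDerivAt (fun s => -erfPi (erfArg y u v s))
      (Real.sqrt y * (kernelWeight s * ((u + s * v) *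
        Real.exp (-Real.pi * erfArg y u v s ^ 2)))) s := by
    rw [Set.uIcc_of_le one_le_two] at hs
    refine ((hasDerivAt_erfPi _).comp s (hasDerivAt_erfArg y u v hs)).neg.congr_deriv ?_
    ring
  have hcont : ContinuousOn (fun s => Real.sqrt y * (kernelWeight s * ((u + s * v) *
      Real.exp (-Real.pi * erfArg y u v s ^ 2)))) (Set.Icc 1 2) := by
    have hweight := continuousOn_kernelWeight
    have harg := continuousOn_erfArg y u v
    fun_prop
  rw [intervalIntegral.integral_eq_sub_of_hasDerivAt hderiv
    (hcont.intervalIntegrable_of_Icc one_le_two), erfArg_one, erfArg_two, erfPi_neg]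
  ring

lemma kernelTerm_eq_mul_qTerm (l : ℤ) (τ : ℍ) {s : ℝ} (hs : s ∈ Set.Icc (1 : ℝ) 2) (p : ℤ × ℤ) :
    kernelTerm l τ s p = ((cosetPoint l p 0 + s * cosetPoint l p 1) *
      Real.exp (-Real.pi * erfArg τ.im (cosetPoint l p 0) (cosetPoint l p 1) s ^ 2) : ℝ) *
        qTerm A₀ b₀ (cosetPoint l p) τ := by
  have hQ : (negQuad s : ℂ) ≠ 0 := ofReal_ne_zero.mpr (negQuad_pos hs).ne'
  have hconj : starRingEnd ℂ (τ : ℂ) = τ - 2 * I * τ.im := by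
    rw [eq_sub_iff_add_eq, ← eq_sub_iff_add_eq', Complex.sub_conj, UpperHalfPlane.coe_im]
    push_cast
    ring
  have hfst : ((p.1 : ℂ) + ((1 / 2 : ℝ) : ℂ)) = (cosetPoint l p 0 : ℝ) := (ofReal_add _ _).symm
  have hsnd : ((p.2 : ℂ) + ((-(l / 2) : ℝ) : ℂ)) = (cosetPoint l p 1 : ℝ) := (ofReal_add _ _).symm
  rw [kernelTerm, binaryThetaTerm, hfst, hsnd, qTerm_eq, erfArg_sq τ.im_pos.le hs]
  generalize cosetPoint l p 0 = u
  generalize cosetPoint l p 1 = v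
  push_cast
  rw [mul_assoc (u + s * v : ℂ), ← Complex.exp_add, one_mul, kernelA, kernelB, kernelD, hconj]
  congr 2
  field_simp
  rw [negQuad]
  push_cast
  linear_combination (2 * τ.im * ((2 - s) * u + 2 * (1 - s) * v) ^ 2 : ℂ) * I_sq

lemma rho_mul_qTerm (l : ℤ) (τ : ℍ) (p : ℤ × ℤ) :
    (rho A₀ c₁ c₂ (cosetPoint l p) τ : ℂ) * qTerm A₀ b₀ (cosetPoint l p) τ =
      ∫ s in (1 : ℝ)..2, Real.sqrt τ.im * (kernelWeight s * kernelTerm l τ s p) := by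
  rw [rho_eq, ← integral_erfArg, ← intervalIntegral.integral_ofReal,
    ← intervalIntegral.integral_mul_const]
  refine intervalIntegral.integral_congr fun s hs => ?_
  rw [Set.uIcc_of_le one_le_two] at hs
  simp only [kernelTerm_eq_mul_qTerm l τ hs, ofReal_mul, mul_assoc]

theorem hasSum_rho (l : ℤ) (τ : ℍ) : HasSum (fun p : ℤ × ℤ =>
    (rho A₀ c₁ c₂ (cosetPoint l p) τ : ℂ) * qTerm A₀ b₀ (cosetPoint l p) τ)
      (Real.sqrt τ.im * ∫ s in (1 : ℝ)..2, kernelWeight s * ∑' p, kernelTerm l τ s p) := by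
  simp_rw [rho_mul_qTerm, intervalIntegral.integral_const_mul]
  refine HasSum.mul_left _ ?_
  refine intervalIntegral.hasSum_integral_of_dominated_convergence
    (fun p _ => kernelBound l τ.im p) (fun p => ?_) (fun p => ?_) ?_ ?_ ?_
  · rw [Set.uIoc_of_le one_le_two]
    exact (((continuous_ofReal.comp_continuousOn continuousOn_kernelWeight).mul
      (continuousOn_kernelTerm l τ p)).mono Set.Ioc_subset_Icc_self).aestronglyMeasurable
      measurableSet_Ioc
  · refine .of_forall fun s hs => ?_
    rw [Set.uIoc_of_le one_le_two] at hs
    exact norm_kernelTerm_le l τ.im_pos (Set.Ioc_subset_Icc_self hs) p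
  · exact .of_forall fun _ _ => summable_kernelBound l τ.im_pos
  · exact intervalIntegrable_const
  · refine .of_forall fun s hs => ?_
    rw [Set.uIoc_of_le one_le_two] at hs
    exact (summable_kernelTerm l τ.im_pos (Set.Ioc_subset_Icc_self hs)).hasSum.mul_left _

lemma vartheta_eq_tsum (l : ℤ) (τ : ℍ) : vartheta l τ = ∑' p : ℤ × ℤ,
    (rho A₀ c₁ c₂ (cosetPoint l p) τ : ℂ) * qTerm A₀ b₀ (cosetPoint l p) τ :=
  tsum_shift_a₀ (fun ν => (rho A₀ c₁ c₂ ν τ : ℂ) * qTerm A₀ b₀ ν τ) l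

lemma vartheta_eq_integral (l : ℤ) (τ : ℍ) : vartheta l τ =
    Real.sqrt τ.im * ∫ s in (1 : ℝ)..2, kernelWeight s * ∑' p, kernelTerm l τ s p := by
  rw [vartheta_eq_tsum, (hasSum_rho l τ).tsum_eq]

lemma integral_kernel_inversion {τ : ℂ} (hτ : 0 < τ.im) (l : ℤ) :
    (Real.sqrt 2 * ‖τ‖ : ℝ) * ∫ s in (1 : ℝ)..2, kernelWeight s * ∑' p, kernelTerm l τ s p =
      I / τ * ((∫ s in (1 : ℝ)..2, kernelWeight s * ∑' p, kernelTerm 0 (-1 / τ) s p) +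
        (-1) ^ l * ∫ s in (1 : ℝ)..2, kernelWeight s * ∑' p, kernelTerm 1 (-1 / τ) s p) := by
  have hint (k : ℤ) := intervalIntegrable_tsum_kernelTerm k (im_neg_one_div_pos hτ)
  rw [← intervalIntegral.integral_const_mul, ← intervalIntegral.integral_const_mul,
    ← intervalIntegral.integral_add (hint 0) ((hint 1).const_mul _),
    ← intervalIntegral.integral_const_mul]
  refine intervalIntegral.integral_congr fun s hs => ?_
  rw [Set.uIcc_of_le one_le_two] at hs
  rw [mul_left_comm, kernel_inversion hτ hs]
  ring

lemma coe_S_smul (τ : ℍ) : ((ModularGroup.S • τ : ℍ) : ℂ) = -1 / τ := by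
  rw [UpperHalfPlane.modular_S_smul, UpperHalfPlane.coe_mk, inv_neg, neg_div, one_div]

lemma im_S_smul (τ : ℍ) : (ModularGroup.S • τ : ℍ).im = τ.im / ‖(τ : ℂ)‖ ^ 2 := by
  rw [UpperHalfPlane.modular_S_smul, UpperHalfPlane.mk_im, inv_im, normSq_neg, neg_im, neg_neg,
    UpperHalfPlane.coe_im, normSq_eq_norm_sq]

theorem vartheta_inversion (l : ℤ) (τ : ℍ) : vartheta l τ = I / (Real.sqrt 2 * τ) *
    (vartheta 0 (ModularGroup.S • τ) + (-1) ^ l * vartheta 1 (ModularGroup.S • τ)) := by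
  have hτ0 : (τ : ℂ) ≠ 0 := τ.ne_zero
  have hsqrt2 : (Real.sqrt 2 : ℂ) ≠ 0 := ofReal_ne_zero.mpr (Real.sqrt_pos.mpr two_pos).ne'
  have hnorm : (‖(τ : ℂ)‖ : ℂ) ≠ 0 := ofReal_ne_zero.mpr (norm_pos_iff.mpr hτ0).ne'
  have hint := integral_kernel_inversion (τ := τ) τ.im_pos l
  simp only [vartheta_eq_integral, coe_S_smul, im_S_smul, Real.sqrt_div' _ (sq_nonneg ‖(τ : ℂ)‖),
    Real.sqrt_sq (norm_nonneg (τ : ℂ))]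
  generalize (∫ s in (1 : ℝ)..2, kernelWeight s * ∑' p, kernelTerm l τ s p) = J at hint ⊢
  push_cast at hint ⊢
  field_simp at hint ⊢
  linear_combination (τ.im.sqrt : ℂ) * hint

/-! ### Vanishing of the inner theta sums -/

lemma neg_exp (z : ℂ) : -cexp z = cexp (z + Real.pi * I) := by
  rw [Complex.exp_add, exp_pi_mul_I, mul_neg_one]

lemma qTerm_reflect (l m n : ℤ) (τ : ℍ) :
    qTerm A₀ b₀ (cosetPoint l (-1 - 2 * (2 * n - l) - m, n)) τ =
      -qTerm A₀ b₀ (cosetPoint l (m, n)) τ := by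
  rw [qTerm_eq, qTerm_eq, neg_exp, Complex.exp_eq_exp_iff_exists_int]
  refine ⟨-1 - m - (2 * n - l), ?_⟩
  simp only [cosetPoint, Matrix.cons_val_zero, Matrix.cons_val_one]
  push_cast
  ring

lemma tsum_qTerm_fst (l n : ℤ) (τ : ℍ) :
    ∑' m : ℤ, qTerm A₀ b₀ (cosetPoint l (m, n)) τ = 0 := by
  have hreflect := (Equiv.subLeft (-1 - 2 * (2 * n - l))).tsum_eq
    (fun m : ℤ => qTerm A₀ b₀ (cosetPoint l (m, n)) τ)
  simp only [Equiv.subLeft_apply, qTerm_reflect, tsum_neg] at hreflect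
  exact self_eq_neg.mp hreflect.symm

lemma tsum_snd_mul_qTerm {l : ℤ} {τ : ℍ} (c : ℤ → ℂ)
    (hc : Summable fun p : ℤ × ℤ => c p.2 * qTerm A₀ b₀ (cosetPoint l p) τ) :
    ∑' p : ℤ × ℤ, c p.2 * qTerm A₀ b₀ (cosetPoint l p) τ = 0 := by
  rw [hc.tsum_prod,
    ← Summable.tsum_comm (f := fun m n => c n * qTerm A₀ b₀ (cosetPoint l (m, n)) τ) hc]
  simp only [tsum_mul_left, tsum_qTerm_fst, mul_zero, tsum_zero]

/-! ### Absolute convergence -/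

lemma abs_sign_le_one (x : ℝ) : |Real.sign x| ≤ 1 := by
  rcases Real.sign_apply_eq x with h | h | h <;> simp [h]

lemma norm_betaTerm_mul_qTerm_le (A : Matrix (Fin 2) (Fin 2) ℝ) (b : Fin 2 → ℝ) {c : Fin 2 → ℝ}
    (hc : quad A c < 0) (ν : Fin 2 → ℝ) (τ : ℍ) :
    ‖(betaTerm A c ν τ : ℂ) * qTerm A b ν τ‖ ≤
      Real.exp (-(2 * Real.pi * τ.im) * (quad A ν - bilin A ν c ^ 2 / (2 * quad A c))) := by
  have hx : 0 ≤ -(bilin A ν c ^ 2 / quad A c) * τ.im :=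
    mul_nonneg (neg_nonneg.mpr (div_nonpos_of_nonneg_of_nonpos (sq_nonneg _) hc.le)) τ.im_pos.le
  have hbeta : ‖(betaTerm A c ν τ : ℂ)‖ ≤
      Real.exp (-Real.pi * (-(bilin A ν c ^ 2 / quad A c) * τ.im)) := by
    rw [norm_real, betaTerm, norm_mul, Real.norm_eq_abs, Real.norm_of_nonneg (beta_nonneg hx)]
    exact (mul_le_of_le_one_left (beta_nonneg hx) (abs_sign_le_one _)).trans (beta_le hx)
  rw [norm_mul, norm_qTerm]
  refine (mul_le_mul_of_nonneg_right hbeta (Real.exp_pos _).le).trans_eq ?_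
  rw [← Real.exp_add]
  congr 1
  field_simp
  ring

lemma summable_betaTerm_mul_qTerm {A : Matrix (Fin 2) (Fin 2) ℝ} (b : Fin 2 → ℝ) {c : Fin 2 → ℝ}
    (hc : quad A c < 0) {ε : ℝ} (hε : 0 < ε)
    (hle : ∀ ν, ε * (ν 0 ^ 2 + ν 1 ^ 2) ≤ quad A ν - bilin A ν c ^ 2 / (2 * quad A c))
    (l : ℤ) (τ : ℍ) : Summable fun p : ℤ × ℤ =>
      (betaTerm A c (cosetPoint l p) τ : ℂ) * qTerm A b (cosetPoint l p) τ := by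
  have hbound := summable_gaussian_prod (mul_pos (mul_pos Real.two_pi_pos τ.im_pos) hε) (1 / 2)
    (-(l / 2))
  refine hbound.of_norm_bounded fun p =>
    (norm_betaTerm_mul_qTerm_le A b hc _ τ).trans (Real.exp_le_exp.mpr ?_)
  rw [neg_mul, neg_mul, neg_le_neg_iff, mul_assoc _ ε]
  exact mul_le_mul_of_nonneg_left (hle (cosetPoint l p)) (mul_pos Real.two_pi_pos τ.im_pos).le

lemma summable_betaTerm_c₁ (l : ℤ) (τ : ℍ) : Summable fun p : ℤ × ℤ =>
    (betaTerm A₀ c₁ (cosetPoint l p) τ : ℂ) * qTerm A₀ b₀ (cosetPoint l p) τ := by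
  refine summable_betaTerm_mul_qTerm b₀ (by norm_num [quad_c₁]) (ε := 1 / 6) (by norm_num)
    (fun ν => ?_) l τ
  rw [bilin_c₁, quad_c₁, quad_A₀]
  field_simp
  linarith [sq_nonneg (6 / 5 * ν 0 + ν 1), sq_nonneg (ν 0)]

lemma summable_betaTerm_c₂ (l : ℤ) (τ : ℍ) : Summable fun p : ℤ × ℤ =>
    (betaTerm A₀ c₂ (cosetPoint l p) τ : ℂ) * qTerm A₀ b₀ (cosetPoint l p) τ := by
  refine summable_betaTerm_mul_qTerm b₀ (by norm_num [quad_c₂]) (ε := 1 / 10) (by norm_num)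
    (fun ν => ?_) l τ
  rw [bilin_c₂, quad_c₂, quad_A₀]
  field_simp
  linarith [sq_nonneg (ν 0 + 5 / 2 * ν 1), sq_nonneg (ν 1)]

/-- The coefficients `sgn B(ν, c₁) - sgn B(ν, c₂)`. -/
def sgnCoeff (ν : Fin 2 → ℝ) : ℝ := Real.sign (bilin A₀ ν c₁) - Real.sign (bilin A₀ ν c₂)

lemma sgnCoeff_eq (ν : Fin 2 → ℝ) : sgnCoeff ν = Real.sign (ν 0) + Real.sign (ν 1) := by
  rw [sgnCoeff, bilin_c₁, bilin_c₂, sign_neg_two_mul, sub_neg_eq_add]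

lemma abs_sgnCoeff_le (ν : Fin 2 → ℝ) : |sgnCoeff ν| ≤ 2 := by
  rw [sgnCoeff_eq]
  linarith [abs_add_le (Real.sign (ν 0)) (Real.sign (ν 1)), abs_sign_le_one (ν 0),
    abs_sign_le_one (ν 1)]

lemma mul_nonneg_of_sgnCoeff_ne_zero {ν : Fin 2 → ℝ} (h : sgnCoeff ν ≠ 0) : 0 ≤ ν 0 * ν 1 := by
  contrapose! h
  rw [sgnCoeff_eq]
  rcases mul_neg_iff.mp h with ⟨h₀, h₁⟩ | ⟨h₀, h₁⟩
  · rw [Real.sign_of_pos h₀, Real.sign_of_neg h₁, add_neg_cancel]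
  · rw [Real.sign_of_neg h₀, Real.sign_of_pos h₁, neg_add_cancel]

lemma norm_sgnTerm_le (ν : Fin 2 → ℝ) (τ : ℍ) : ‖(sgnCoeff ν : ℂ) * qTerm A₀ b₀ ν τ‖ ≤
    2 * Real.exp (-(Real.pi * τ.im) * (ν 0 ^ 2 + ν 1 ^ 2)) := by
  by_cases h : sgnCoeff ν = 0
  · rw [h, ofReal_zero, zero_mul, norm_zero]
    positivity
  · rw [norm_mul, norm_qTerm, norm_real, Real.norm_eq_abs, quad_A₀]
    refine mul_le_mul (abs_sgnCoeff_le ν) (Real.exp_le_exp.mpr ?_) (Real.exp_pos _).le zero_le_two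
    have hcross := mul_nonneg_of_sgnCoeff_ne_zero h
    have hdiff : 0 ≤ Real.pi * τ.im * (4 * (ν 0 * ν 1) + ν 1 ^ 2) :=
      mul_nonneg (mul_pos Real.pi_pos τ.im_pos).le (by positivity)
    linarith

lemma summable_sgnTerm (l : ℤ) (τ : ℍ) : Summable fun p : ℤ × ℤ =>
    (sgnCoeff (cosetPoint l p) : ℂ) * qTerm A₀ b₀ (cosetPoint l p) τ :=
  ((summable_gaussian_prod (mul_pos Real.pi_pos τ.im_pos) (1 / 2) (-(l / 2))).mul_left
    2).of_norm_bounded fun _ => norm_sgnTerm_le _ τ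

lemma rho_eq_sgnCoeff (ν : Fin 2 → ℝ) (τ : ℍ) : rho A₀ c₁ c₂ ν τ =
    sgnCoeff ν - betaTerm A₀ c₁ ν τ + betaTerm A₀ c₂ ν τ := by
  rw [rho, sgnCoeff, betaTerm, betaTerm]
  ring

/-! ### The expansion of the Appell–Lerch sum -/

/-- `±1` on the two quadrants where geometric series in `ζ qⁿ` converge, and `0` elsewhere. -/
def quadrant (n m : ℤ) : ℂ := if 0 ≤ n then (if 0 ≤ m then 1 else 0) else (if 0 ≤ m then 0 else -1)

lemma quadrant_cases (n m : ℤ) : quadrant n m = 0 ∨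
    ‖quadrant n m‖ = 1 ∧ (0 ≤ n ∧ 0 ≤ m ∨ n ≤ -1 ∧ m ≤ -1) := by
  unfold quadrant
  split_ifs with hn hm hm
  · exact .inr ⟨norm_one, .inl ⟨hn, hm⟩⟩
  · exact .inl rfl
  · exact .inl rfl
  · exact .inr ⟨by rw [norm_neg, norm_one], .inr ⟨by lia, by lia⟩⟩

lemma hasSum_quadrant_mul_zpow_of_nonneg {w : ℂ} (hw : ‖w‖ < 1) {n : ℤ} (hn : 0 ≤ n) :
    HasSum (fun m : ℤ => quadrant n m * w ^ m) (1 - w)⁻¹ := by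
  have hnat (m : ℕ) : quadrant n m * w ^ (m : ℤ) = w ^ m := by
    rw [quadrant, if_pos hn, if_pos m.cast_nonneg, one_mul, zpow_natCast]
  have hneg (m : ℕ) : quadrant n (-(m + 1)) * w ^ (-(m + 1) : ℤ) = 0 := by
    rw [quadrant, if_pos hn, if_neg (by lia), zero_mul]
  rw [← add_zero (1 - w)⁻¹]
  exact HasSum.of_nat_of_neg_add_one ((hasSum_geometric_of_norm_lt_one hw).congr_fun hnat)
    (hasSum_zero.congr_fun hneg)

lemma hasSum_quadrant_mul_zpow_of_neg {w : ℂ} (hw : 1 < ‖w‖) {n : ℤ} (hn : n < 0) :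
    HasSum (fun m : ℤ => quadrant n m * w ^ m) (1 - w)⁻¹ := by
  have hw0 : w ≠ 0 := norm_pos_iff.mp (one_pos.trans hw)
  have hw' : ‖w⁻¹‖ < 1 := norm_inv w ▸ inv_lt_one_of_one_lt₀ hw
  have hnat (m : ℕ) : quadrant n m * w ^ (m : ℤ) = 0 := by
    rw [quadrant, if_neg hn.not_ge, if_pos m.cast_nonneg, zero_mul]
  have hneg (m : ℕ) : quadrant n (-(m + 1)) * w ^ (-(m + 1) : ℤ) = -w⁻¹ * w⁻¹ ^ m := by
    rw [quadrant, if_neg hn.not_ge, if_neg (by lia), ← _root_.inv_zpow',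
      zpow_add_one₀ (inv_ne_zero hw0), zpow_natCast]
    ring
  have hval : (1 - w)⁻¹ = 0 + -w⁻¹ * (1 - w⁻¹)⁻¹ := by
    rw [zero_add, neg_mul, ← mul_inv, mul_one_sub, mul_inv_cancel₀ hw0, neg_inv, neg_sub]
  rw [hval]
  exact HasSum.of_nat_of_neg_add_one (hasSum_zero.congr_fun hnat)
    (((hasSum_geometric_of_norm_lt_one hw').mul_left _).congr_fun hneg)

/-- The sum in the definition of `mu`. -/
def appell (z τ : ℂ) : ℂ :=
  ∑' n : ℤ, (-1 : ℂ) ^ n * cexp (Real.pi * I * (n * (n + 1)) * τ + 2 * Real.pi * I * n * z) /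
      (1 - cexp (2 * Real.pi * I * (z + n * τ)))

lemma mu_eq (z τ : ℂ) :
    mu z τ = I * cexp (Real.pi * I * z) / thetaChar (1 / 2) (1 / 2) z τ * appell z τ :=
  rfl

lemma theta1_sq_mul_mu (z τ : ℂ) : theta1 z τ ^ 2 * mu z τ =
    I * cexp (Real.pi * I * z) * (thetaChar (1 / 2) (1 / 2) z τ * appell z τ) := by
  rw [theta1, mu_eq]
  generalize thetaChar (1 / 2) (1 / 2) z τ = t
  rcases eq_or_ne t 0 with rfl | h
  · simp
  · field_simp

/-- The terms of the double series obtained by expanding the denominators of `appell`. -/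
def appellTerm (z τ : ℂ) (p : ℤ × ℤ) : ℂ :=
  quadrant p.1 p.2 * ((-1 : ℂ) ^ p.1 *
    cexp (Real.pi * I * (p.1 * (p.1 + 1)) * τ + 2 * Real.pi * I * p.1 * z +
      2 * Real.pi * I * p.2 * (z + p.1 * τ)))

lemma norm_exp_two_pi_I_mul (z : ℂ) :
    ‖cexp (2 * Real.pi * I * z)‖ = Real.exp (-2 * Real.pi * z.im) := by
  have h : 2 * Real.pi * I * z = (2 * Real.pi : ℝ) * z * I := by
    push_cast
    ring
  rw [h, Complex.norm_exp, mul_I_re, im_ofReal_mul, neg_mul, neg_mul]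

lemma norm_neg_one_zpow (n : ℤ) : ‖(-1 : ℂ) ^ n‖ = 1 := by
  rw [norm_zpow, norm_neg, norm_one, _root_.one_zpow]

lemma norm_appellTerm (z τ : ℂ) (p : ℤ × ℤ) : ‖appellTerm z τ p‖ = ‖quadrant p.1 p.2‖ *
    Real.exp (-Real.pi * (p.1 * (p.1 + 1) * τ.im + 2 * p.1 * z.im +
      2 * p.2 * (z.im + p.1 * τ.im))) := by
  have hexp : (Real.pi * I * (p.1 * (p.1 + 1)) * τ + 2 * Real.pi * I * p.1 * z +
      2 * Real.pi * I * p.2 * (z + p.1 * τ) : ℂ) =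
      ((Real.pi * (p.1 * (p.1 + 1) + 2 * p.2 * p.1) : ℝ) * τ +
        (Real.pi * (2 * p.1 + 2 * p.2) : ℝ) * z) * I := by
    push_cast
    ring
  rw [appellTerm, norm_mul, norm_mul, norm_neg_one_zpow, one_mul, hexp, Complex.norm_exp, mul_I_re,
    add_im, im_ofReal_mul, im_ofReal_mul]
  ring_nf

lemma appell_exponent_le {v y κ n m : ℝ} (hκ : 0 ≤ κ) (hv : κ ≤ v) (hy : κ ≤ y - v)
    (h : 0 ≤ n ∧ 0 ≤ m ∨ n ≤ -1 ∧ m ≤ -1) :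
    y * n ^ 2 - 3 * y * |n| + 2 * κ * |m| ≤
      n * (n + 1) * y + 2 * n * v + 2 * m * (v + n * y) := by
  rcases h with ⟨hn, hm⟩ | ⟨hn, hm⟩
  · rw [abs_of_nonneg hn, abs_of_nonneg hm]
    have hvm := mul_nonneg hm (sub_nonneg.mpr hv)
    have hny : 0 ≤ n * y := mul_nonneg hn (by linarith)
    linarith [mul_nonneg hn (hκ.trans hv), mul_nonneg hm hny]
  · rw [abs_of_nonpos (by linarith), abs_of_nonpos (by linarith)]
    have hvn : 0 ≤ -n * (y - v) := mul_nonneg (by linarith) (hκ.trans hy)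
    have hvm : 0 ≤ -m * (y - v - κ) := mul_nonneg (by linarith) (by linarith)
    have hmn : 0 ≤ -m * (-n - 1) * y :=
      mul_nonneg (mul_nonneg (by linarith) (by linarith)) (by linarith)
    linarith

lemma summable_exp_neg_mul_abs {c : ℝ} (hc : 0 < c) :
    Summable fun m : ℤ => Real.exp (-c * |(m : ℝ)|) := by
  have hnat : Summable fun n : ℕ => Real.exp (-c * n) :=
    (Real.summable_exp_nat_mul_iff.mpr (neg_lt_zero.mpr hc)).congr fun n => by rw [mul_comm]
  apply Summable.of_nat_of_neg <;>
    simpa only [Int.cast_neg, Int.cast_natCast, abs_neg, Nat.abs_cast] using hnat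

section

variable {z τ : ℂ} (hz : 0 < z.im) (hz' : z.im < τ.im)
include hz hz'

lemma norm_appellTerm_le (p : ℤ × ℤ) : ‖appellTerm z τ p‖ ≤
    Real.exp (-Real.pi * (τ.im * p.1 ^ 2 - 3 * τ.im * |(p.1 : ℝ)|)) *
      Real.exp (-(2 * Real.pi * min z.im (τ.im - z.im)) * |(p.2 : ℝ)|) := by
  rcases quadrant_cases p.1 p.2 with h0 | ⟨h1, hp⟩
  · rw [norm_appellTerm, h0, norm_zero, zero_mul]
    positivity
  · rw [norm_appellTerm, h1, one_mul, ← Real.exp_add, Real.exp_le_exp]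
    have hle := appell_exponent_le (le_min hz.le (sub_pos.mpr hz').le) (min_le_left _ _)
      (min_le_right z.im (τ.im - z.im)) (n := p.1) (m := p.2) (by exact_mod_cast hp)
    linarith [mul_le_mul_of_nonneg_left hle Real.pi_pos.le]

lemma summable_norm_appellTerm : Summable fun p => ‖appellTerm z τ p‖ := by
  have hfst : Summable fun n : ℤ =>
      Real.exp (-Real.pi * (τ.im * n ^ 2 - 3 * τ.im * |(n : ℝ)|)) := by
    refine (summable_pow_mul_jacobiTheta₂_term_bound (3 / 2 * τ.im) (hz.trans hz') 0).congr
      fun n => ?_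
    rw [pow_zero, one_mul, Int.cast_abs]
    ring_nf
  have hsnd := summable_exp_neg_mul_abs (c := 2 * Real.pi * min z.im (τ.im - z.im))
    (mul_pos Real.two_pi_pos (lt_min hz (sub_pos.mpr hz')))
  exact (hfst.mul_of_nonneg hsnd (fun _ => (Real.exp_pos _).le)
    fun _ => (Real.exp_pos _).le).of_nonneg_of_le (fun _ => norm_nonneg _)
      (norm_appellTerm_le hz hz')

lemma hasSum_quadrant_mul_exp (n : ℤ) :
    HasSum (fun m : ℤ => quadrant n m * cexp (2 * Real.pi * I * (z + n * τ)) ^ m)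
      (1 - cexp (2 * Real.pi * I * (z + n * τ)))⁻¹ := by
  have hnorm : ‖cexp (2 * Real.pi * I * (z + n * τ))‖ =
      Real.exp (-(2 * Real.pi * (z.im + n * τ.im))) := by
    rw [norm_exp_two_pi_I_mul, add_im, ← ofReal_intCast, im_ofReal_mul]
    ring_nf
  have hy := hz.trans hz'
  rcases le_or_gt 0 n with hn | hn
  · refine hasSum_quadrant_mul_zpow_of_nonneg ?_ hn
    rw [hnorm, Real.exp_lt_one_iff, neg_lt_zero]
    exact mul_pos Real.two_pi_pos
      (add_pos_of_pos_of_nonneg hz (mul_nonneg (Int.cast_nonneg hn) hy.le))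
  · refine hasSum_quadrant_mul_zpow_of_neg ?_ hn
    have hn' : (n : ℝ) ≤ -1 := by exact_mod_cast Int.le_sub_one_of_lt hn
    have hny : n * τ.im ≤ -1 * τ.im := mul_le_mul_of_nonneg_right hn' hy.le
    rw [hnorm, Real.one_lt_exp_iff, neg_pos]
    exact mul_neg_of_pos_of_neg Real.two_pi_pos (by linarith)

lemma tsum_appellTerm : ∑' p, appellTerm z τ p = appell z τ := by
  rw [(summable_norm_appellTerm hz hz').of_norm.tsum_prod, appell]
  refine tsum_congr fun n => ?_
  have hterm (m : ℤ) : appellTerm z τ (n, m) =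
      (-1 : ℂ) ^ n * cexp (Real.pi * I * (n * (n + 1)) * τ + 2 * Real.pi * I * n * z) *
        (quadrant n m * cexp (2 * Real.pi * I * (z + n * τ)) ^ m) := by
    rw [appellTerm, Complex.exp_add, ← Complex.exp_int_mul]
    ring_nf
  rw [tsum_congr hterm, tsum_mul_left, (hasSum_quadrant_mul_exp hz hz' n).tsum_eq, div_eq_mul_inv]

end

/-! ### The Fourier expansion of `θ₁² μ` -/

lemma thetaChar_eq_tsum (a b : ℝ) (z τ : ℂ) :
    thetaChar a b z τ = ∑' n, thetaTerm 1 0 a (z + b) τ n := by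
  refine tsum_congr fun n => ?_
  rw [thetaTerm, zero_mul, add_zero, one_mul]
  ring_nf

/-- The `p`-th term of the lattice sum for the coefficient of `q^{l²/4} ζ^l` in `i θ₁² μ`. -/
def fourierTerm (τ : ℍ) (l : ℤ) (p : ℤ × ℤ) : ℂ :=
  quadrant p.2 p.1 * qTerm A₀ b₀ (cosetPoint l p) τ

/-- The monomial `q^{l²/4} ζ^l`. -/
def fourierMode (τ : ℂ) (l : ℤ) (z : ℂ) : ℂ :=
  cexp (2 * Real.pi * I * l * z + 2 * Real.pi * I * ((l : ℂ) ^ 2 / 4) * τ)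

/-- The reindexing `(l, (m, n)) ↦ (l - n - m - 1, (n, m))` collecting the terms of the product
`ϑ_{½,½} · appell` that contribute to the exponent `l` of `ζ`. -/
def modeEquiv : ℤ × (ℤ × ℤ) ≃ ℤ × (ℤ × ℤ) where
  toFun x := (x.1 - x.2.2 - x.2.1 - 1, (x.2.2, x.2.1))
  invFun x := (x.1 + x.2.1 + x.2.2 + 1, (x.2.2, x.2.1))
  left_inv _ := by ext <;> simp only; ring
  right_inv _ := by ext <;> simp only; ring

/-- The terms of the triple series for `θ₁² μ`. -/
def productTerm (z : ℂ) (τ : ℍ) (x : ℤ × (ℤ × ℤ)) : ℂ :=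
  I * cexp (Real.pi * I * z) *
    (thetaTerm 1 0 (1 / 2 : ℝ) (z + (1 / 2 : ℝ)) τ x.1 * appellTerm z τ x.2)

lemma productTerm_modeEquiv (z : ℂ) (τ : ℍ) (x : ℤ × (ℤ × ℤ)) :
    productTerm z τ (modeEquiv x) = fourierMode τ x.1 z * (-I * fourierTerm τ x.1 x.2) := by
  obtain ⟨l, m, n⟩ := x
  have hsign : (-1 : ℂ) ^ n = cexp (n * (Real.pi * I)) := by rw [Complex.exp_int_mul, exp_pi_mul_I]
  have hexp : cexp (Real.pi * I * z + (Real.pi * I * τ * (((l - n - m - 1 : ℤ) : ℂ) + 1 / 2) ^ 2 +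
        2 * Real.pi * I * (((l - n - m - 1 : ℤ) : ℂ) + 1 / 2) * (z + 1 / 2)) +
        n * (Real.pi * I) + (Real.pi * I * (n * (n + 1)) * τ + 2 * Real.pi * I * n * z +
          2 * Real.pi * I * m * (z + n * τ))) =
      cexp (Real.pi * I + (2 * Real.pi * I * l * z + 2 * Real.pi * I * ((l : ℂ) ^ 2 / 4) * τ) +
        (2 * Real.pi * I * (cosetPoint l (m, n) 0 / 2 + cosetPoint l (m, n) 1) +
          2 * Real.pi * I * (cosetPoint l (m, n) 0 ^ 2 / 2 +
            2 * cosetPoint l (m, n) 0 * cosetPoint l (m, n) 1 + cosetPoint l (m, n) 1 ^ 2) *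
              τ)) := by
    rw [Complex.exp_eq_exp_iff_exists_int]
    refine ⟨l - m - n - 1, ?_⟩
    simp only [cosetPoint, Matrix.cons_val_zero, Matrix.cons_val_one]
    push_cast
    ring
  simp only [Complex.exp_add, exp_pi_mul_I] at hexp
  simp only [productTerm, modeEquiv, Equiv.coe_fn_mk, thetaTerm, appellTerm, fourierMode,
    fourierTerm, qTerm_eq, hsign, Complex.exp_add, ofReal_div, ofReal_one, ofReal_ofNat, zero_mul,
    add_zero, one_mul]
  linear_combination I * quadrant n m * hexp

section

variable (τ : ℍ) {z : ℂ} (hz : 0 < z.im) (hz' : z.im < τ.im)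
include hz hz'

lemma hasSum_productTerm : HasSum (productTerm z τ) (theta1 z τ ^ 2 * mu z τ) := by
  have hθ := (summable_thetaTerm τ.im_pos 1 0 (1 / 2 : ℝ) (z + (1 / 2 : ℝ))).norm
  have happell := summable_norm_appellTerm (τ := τ) hz hz'
  rw [theta1_sq_mul_mu, thetaChar_eq_tsum, ← tsum_appellTerm hz hz',
    tsum_mul_tsum_of_summable_norm hθ happell]
  exact (summable_mul_of_summable_norm hθ happell).hasSum.mul_left _

lemma hasSum_fourierMode_prod :
    HasSum (fun x : ℤ × (ℤ × ℤ) => fourierMode τ x.1 z * (-I * fourierTerm τ x.1 x.2))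
      (theta1 z τ ^ 2 * mu z τ) :=
  (modeEquiv.hasSum_iff.mpr (hasSum_productTerm τ hz hz')).congr_fun fun x =>
    (productTerm_modeEquiv z τ x).symm

end

lemma summable_fourierTerm (τ : ℍ) (l : ℤ) : Summable (fourierTerm τ l) := by
  have hlow : 0 < (I * (τ.im / 2 : ℝ)).im := by simpa using τ.im_pos
  have hhigh : (I * (τ.im / 2 : ℝ)).im < τ.im := by simpa using τ.im_pos
  have hfiber := (hasSum_fourierMode_prod τ hlow hhigh).summable.prod_factor l
  rwa [summable_mul_left_iff (a := fourierMode τ l _) (Complex.exp_ne_zero _),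
    summable_mul_left_iff (neg_ne_zero.mpr I_ne_zero)] at hfiber

lemma hasSum_fourierMode (τ : ℍ) {z : ℂ} (hz : 0 < z.im) (hz' : z.im < τ.im) :
    HasSum (fun l => fourierMode τ l z * (-I * ∑' p, fourierTerm τ l p))
      (theta1 z τ ^ 2 * mu z τ) :=
  (hasSum_fourierMode_prod τ hz hz').prod_fiberwise fun l =>
    ((summable_fourierTerm τ l).hasSum.mul_left _).mul_left _

lemma integral_exp_two_pi_int_mul (k : ℤ) :
    ∫ x in (0 : ℝ)..1, cexp (2 * Real.pi * I * k * x) = if k = 0 then 1 else 0 := by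
  split_ifs with hk
  · simp [hk]
  · have hc : (2 * Real.pi * I * k : ℂ) ≠ 0 :=
      mul_ne_zero two_pi_I_ne_zero (Int.cast_ne_zero.mpr hk)
    have hperiod : cexp (2 * Real.pi * I * k * (1 : ℝ)) = 1 := by
      rw [ofReal_one, mul_one, mul_comm, exp_int_mul_two_pi_mul_I]
    rw [integral_exp_mul_complex hc, hperiod, ofReal_zero, mul_zero, Complex.exp_zero, sub_self,
      zero_div]

lemma integral_mul_exp_of_hasSum {a : ℤ → ℂ} {f : ℝ → ℂ}
    (hf : ∀ x : ℝ, HasSum (fun k => a k * cexp (2 * Real.pi * I * k * x)) (f x)) (l : ℤ) :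
    ∫ x in (0 : ℝ)..1, f x * cexp (-2 * Real.pi * I * l * x) = a l := by
  have hterm (k : ℤ) (x : ℝ) :
      a k * cexp (2 * Real.pi * I * k * x) * cexp (-2 * Real.pi * I * l * x) =
        a k * cexp (2 * Real.pi * I * (k - l : ℤ) * x) := by
    rw [mul_assoc, ← Complex.exp_add]
    push_cast
    ring_nf
  have hnorm (k : ℤ) (x : ℝ) : ‖cexp (2 * Real.pi * I * k * x)‖ = 1 := by
    have harg : (2 * Real.pi * I * k * x : ℂ) = (2 * Real.pi * k * x : ℝ) * I := by
      push_cast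
      ring
    rw [harg, Complex.norm_exp_ofReal_mul_I]
  have ha : Summable fun k => ‖a k‖ :=
    (hf 0).summable.norm.congr fun k => by rw [norm_mul, hnorm, mul_one]
  have hsum : HasSum (fun k => ∫ x in (0 : ℝ)..1, a k * cexp (2 * Real.pi * I * (k - l : ℤ) * x))
      (∫ x in (0 : ℝ)..1, f x * cexp (-2 * Real.pi * I * l * x)) :=
    intervalIntegral.hasSum_integral_of_dominated_convergence (fun k _ => ‖a k‖)
      (fun k => Continuous.aestronglyMeasurable (by fun_prop))
      (fun k => .of_forall fun x _ => by rw [norm_mul, hnorm, mul_one])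
      (.of_forall fun _ _ => ha) intervalIntegrable_const
      (.of_forall fun x _ => ((hf x).mul_right _).congr_fun fun k => (hterm k x).symm)
  have hval (k : ℤ) : ∫ x in (0 : ℝ)..1, a k * cexp (2 * Real.pi * I * (k - l : ℤ) * x) =
      if k = l then a l else 0 := by
    rw [intervalIntegral.integral_const_mul, integral_exp_two_pi_int_mul]
    rcases eq_or_ne k l with rfl | hkl
    · rw [sub_self, if_pos rfl, if_pos rfl, mul_one]
    · rw [if_neg (sub_ne_zero.mpr hkl), if_neg hkl, mul_zero]
  exact (hsum.congr_fun fun k => (hval k).symm).unique (hasSum_ite_eq l _)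

lemma fourierMode_add (τ : ℂ) (l : ℤ) (z w : ℂ) :
    fourierMode τ l (z + w) = fourierMode τ l w * cexp (2 * Real.pi * I * l * z) := by
  rw [fourierMode, fourierMode, ← Complex.exp_add]
  ring_nf

theorem S_eq_tsum (l : ℤ) (τ : ℍ) : S l τ = -I * ∑' p, fourierTerm τ l p := by
  have him (x : ℝ) : (x + I * (τ.im / 2) : ℂ).im = τ.im / 2 := by simp
  have hcoeff := integral_mul_exp_of_hasSum (a := fun k => fourierMode τ k (I * (τ.im / 2)) *
    (-I * ∑' p, fourierTerm τ k p)) (fun x : ℝ => (hasSum_fourierMode τ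
      ((him x).symm ▸ half_pos τ.im_pos) ((him x).symm ▸ half_lt_self τ.im_pos)).congr_fun
        fun k => by rw [fourierMode_add]; ring) l
  have hexp (x : ℝ) : cexp (-2 * Real.pi * I * l * (x + I * (τ.im / 2))) =
      cexp (-2 * Real.pi * I * l * (I * (τ.im / 2))) * cexp (-2 * Real.pi * I * l * x) := by
    rw [← Complex.exp_add]
    ring_nf
  have hmode : cexp (-2 * Real.pi * I * ((l : ℂ) ^ 2 / 4) * τ) *
      cexp (-2 * Real.pi * I * l * (I * (τ.im / 2))) * fourierMode τ l (I * (τ.im / 2)) = 1 := by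
    rw [fourierMode, ← Complex.exp_add, ← Complex.exp_add, ← Complex.exp_zero]
    ring_nf
  simp only [S, hexp, mul_left_comm _ (cexp (-2 * Real.pi * I * l * (I * (τ.im / 2))))]
  rw [intervalIntegral.integral_const_mul, hcoeff, ← mul_assoc, ← mul_assoc, hmode, one_mul]

lemma sign_intCast_add_half (m : ℤ) : Real.sign (m + 1 / 2) = if 0 ≤ m then 1 else -1 := by
  split_ifs with hm
  · have hm' : (0 : ℝ) ≤ m := Int.cast_nonneg hm
    exact Real.sign_of_pos (by linarith)
  · have hm' : (m : ℝ) ≤ -1 := by exact_mod_cast Int.le_sub_one_of_lt (not_le.mp hm)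
    exact Real.sign_of_neg (by linarith)

/-- The difference `sgn(n + ½) - sgn(n - l/2)` between the signs in `quadrant` and in `sgnCoeff`.
It depends on one variable only, so that it contributes nothing to the lattice sum. -/
def signDefect (l n : ℤ) : ℝ := Real.sign (n + 1 / 2) - Real.sign (n + -(l / 2))

lemma two_mul_fourierTerm (l : ℤ) (τ : ℍ) (p : ℤ × ℤ) : 2 * fourierTerm τ l p =
    (sgnCoeff (cosetPoint l p) : ℂ) * qTerm A₀ b₀ (cosetPoint l p) τ +
      (signDefect l p.2 : ℂ) * qTerm A₀ b₀ (cosetPoint l p) τ := by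
  have hsign : 2 * quadrant p.2 p.1 =
      ((Real.sign (p.1 + 1 / 2) + Real.sign (p.2 + 1 / 2) : ℝ) : ℂ) := by
    rw [sign_intCast_add_half, sign_intCast_add_half, quadrant]
    split_ifs <;> norm_num
  rw [fourierTerm, ← mul_assoc, hsign, ← add_mul, ← ofReal_add, sgnCoeff_eq, signDefect]
  simp only [cosetPoint, Matrix.cons_val_zero, Matrix.cons_val_one]
  ring_nf

theorem hasSum_sgnTerm (l : ℤ) (τ : ℍ) : HasSum (fun p : ℤ × ℤ =>
    (sgnCoeff (cosetPoint l p) : ℂ) * qTerm A₀ b₀ (cosetPoint l p) τ) (2 * I * S l τ) := by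
  have hsgn := summable_sgnTerm l τ
  have hdefect : Summable fun p : ℤ × ℤ =>
      (signDefect l p.2 : ℂ) * qTerm A₀ b₀ (cosetPoint l p) τ :=
    (((summable_fourierTerm τ l).mul_left 2).sub hsgn).congr fun p => by
      rw [two_mul_fourierTerm, add_sub_cancel_left]
  have hsum : 2 * I * S l τ = ∑' p : ℤ × ℤ,
      (sgnCoeff (cosetPoint l p) : ℂ) * qTerm A₀ b₀ (cosetPoint l p) τ := calc
    2 * I * S l τ = ∑' p, 2 * fourierTerm τ l p := by
      rw [S_eq_tsum, tsum_mul_left]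
      linear_combination (-2 * ∑' p, fourierTerm τ l p) * I_sq
    _ = _ := by
      rw [tsum_congr (two_mul_fourierTerm l τ), hsgn.tsum_add hdefect,
        tsum_snd_mul_qTerm (fun n => (signDefect l n : ℂ)) hdefect, add_zero]
  exact hsum ▸ hsgn.hasSum

lemma S_add_two (l : ℤ) (τ : ℍ) : S (l + 2) τ = S l τ := by
  have hpoint (p : ℤ × ℤ) :
      cosetPoint (l + 2) ((Equiv.refl ℤ).prodCongr (Equiv.addRight 1) p) = cosetPoint l p := by
    simp only [cosetPoint, Equiv.prodCongr_apply, Prod.map, Equiv.refl_apply, Equiv.coe_addRight]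
    push_cast
    ring_nf
  have hsum := ((Equiv.refl ℤ).prodCongr (Equiv.addRight (1 : ℤ))).hasSum_iff.mpr
    (hasSum_sgnTerm (l + 2) τ)
  simp only [Function.comp_def, hpoint] at hsum
  exact mul_left_cancel₀ (mul_ne_zero two_ne_zero I_ne_zero) (hsum.unique (hasSum_sgnTerm l τ))

lemma S_two_mul_add (l k : ℤ) (τ : ℍ) : S (2 * k + l) τ = S l τ := by
  have hper : Function.Periodic (fun l => S l τ) 2 := fun l => S_add_two l τ
  rw [add_comm, mul_comm, ← smul_eq_mul]
  exact hper.zsmul k l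

lemma two_mul_add_injective (r : ℤ) : Function.Injective fun k : ℤ => 2 * k + r :=
  (add_left_injective r).comp (mul_right_injective₀ two_ne_zero)

lemma isCompl_range_two_mul_add : IsCompl (Set.range fun k : ℤ => 2 * k + 0)
    (Set.range fun k : ℤ => 2 * k + 1) := by
  constructor
  · rw [Set.disjoint_left]
    rintro _ ⟨j, rfl⟩ ⟨k, hk⟩
    lia
  · rw [codisjoint_iff]
    refine Set.eq_univ_of_forall fun n => ?_
    rcases Int.even_or_odd' n with ⟨k, hk | hk⟩
    exacts [.inl ⟨k, by lia⟩, .inr ⟨k, hk.symm⟩]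

theorem theta_decomposition_strip (τ : ℍ) {z : ℂ} (hz : 0 < z.im) (hz' : z.im < τ.im) :
    theta1 z τ ^ 2 * mu z τ =
      S 0 τ * theta3 (2 * z) (2 * τ) + S 1 τ * theta2 (2 * z) (2 * τ) := by
  have hsum := hasSum_fourierMode τ hz hz'
  simp only [← S_eq_tsum] at hsum
  rw [← hsum.tsum_eq, tsum_eq_add_of_isCompl hsum.summable (two_mul_add_injective 0)
    (two_mul_add_injective 1) isCompl_range_two_mul_add]
  simp only [S_two_mul_add]
  rw [tsum_mul_right, tsum_mul_right, mul_comm (S 0 τ), mul_comm (S 1 τ), theta3, theta2,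
    thetaChar, thetaChar]
  congr 3
  all_goals
    funext n
    rw [fourierMode]
    push_cast
    ring_nf

/-! ### The theta decomposition off the lattice -/

lemma thetaChar_add_tau (a b : ℝ) (z τ : ℂ) : thetaChar a b (z + τ) τ =
    cexp (-Real.pi * I * τ - 2 * Real.pi * I * (z + b)) * thetaChar a b z τ := by
  rw [thetaChar, thetaChar, ← tsum_mul_left, ← (Equiv.addRight (1 : ℤ)).tsum_eq fun n : ℤ =>
    cexp (-Real.pi * I * τ - 2 * Real.pi * I * (z + b)) * cexp (2 * Real.pi * I * ((n + a) * b) +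
      Real.pi * I * (n + a) ^ 2 * τ + 2 * Real.pi * I * (n + a) * z)]
  refine tsum_congr fun n => ?_
  rw [← Complex.exp_add, Equiv.coe_addRight]
  push_cast
  ring_nf

lemma appell_add_tau (z τ : ℂ) : appell (z + τ) τ =
    -cexp (-2 * Real.pi * I * τ - 2 * Real.pi * I * z) * appell z τ := by
  rw [appell, appell, ← tsum_mul_left, ← (Equiv.addRight (1 : ℤ)).tsum_eq fun n : ℤ =>
    -cexp (-2 * Real.pi * I * τ - 2 * Real.pi * I * z) * ((-1 : ℂ) ^ n *
      cexp (Real.pi * I * (n * (n + 1)) * τ + 2 * Real.pi * I * n * z) /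
        (1 - cexp (2 * Real.pi * I * (z + n * τ))))]
  refine tsum_congr fun n => ?_
  have hnum : cexp (Real.pi * I * (n * (n + 1)) * τ + 2 * Real.pi * I * n * (z + τ)) =
      cexp (-2 * Real.pi * I * τ - 2 * Real.pi * I * z) *
        cexp (Real.pi * I * ((n + 1) * (n + 1 + 1)) * τ + 2 * Real.pi * I * (n + 1) * z) := by
    rw [← Complex.exp_add]
    ring_nf
  rw [Equiv.coe_addRight, Int.cast_add, Int.cast_one, hnum,
    zpow_add_one₀ (neg_ne_zero.mpr one_ne_zero), add_assoc z τ, add_comm τ, add_one_mul (n : ℂ)]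
  ring_nf

lemma theta1_sq_mul_mu_add_tau (z τ : ℂ) : theta1 (z + τ) τ ^ 2 * mu (z + τ) τ =
    cexp (-2 * Real.pi * I * τ - 4 * Real.pi * I * z) * (theta1 z τ ^ 2 * mu z τ) := by
  have hexp : cexp (Real.pi * I * (z + τ)) *
      cexp (-Real.pi * I * τ - 2 * Real.pi * I * (z + (1 / 2 : ℝ))) *
        -cexp (-2 * Real.pi * I * τ - 2 * Real.pi * I * z) =
      cexp (-2 * Real.pi * I * τ - 4 * Real.pi * I * z) * cexp (Real.pi * I * z) := by
    rw [neg_exp, ← Complex.exp_add, ← Complex.exp_add, ← Complex.exp_add]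
    push_cast
    ring_nf
  rw [theta1_sq_mul_mu, theta1_sq_mul_mu, thetaChar_add_tau, appell_add_tau]
  linear_combination I * thetaChar (1 / 2) (1 / 2) z τ * appell z τ * hexp

lemma thetaChar_two_mul_add_tau (a : ℝ) (z τ : ℂ) : thetaChar a 0 (2 * (z + τ)) (2 * τ) =
    cexp (-2 * Real.pi * I * τ - 4 * Real.pi * I * z) * thetaChar a 0 (2 * z) (2 * τ) := by
  rw [mul_add, thetaChar_add_tau, ofReal_zero]
  ring_nf

lemma continuous_thetaChar (a b : ℝ) {τ : ℂ} (hτ : 0 < τ.im) :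
    Continuous fun z => thetaChar a b z τ := by
  have hθ : Continuous fun z => jacobiTheta₂ z τ :=
    continuous_iff_continuousAt.mpr fun z => (differentiableAt_jacobiTheta₂_fst z hτ).continuousAt
  simp only [thetaChar_eq_tsum, (hasSum_thetaTerm hτ 1 0 a _).tsum_eq, zero_mul, add_zero, one_mul,
    zero_div]
  exact Continuous.mul (by fun_prop) (hθ.comp (by fun_prop))

lemma one_sub_exp_neg_abs_le (x : ℝ) : 1 - Real.exp (-|x|) ≤ |1 - Real.exp x| := by
  rcases le_total x 0 with hx | hx
  · rw [abs_of_nonpos hx, neg_neg]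
    exact le_abs_self _
  · rw [abs_of_nonneg hx, abs_sub_comm]
    exact le_trans (by linarith [Real.add_one_le_exp x, Real.add_one_le_exp (-x)]) (le_abs_self _)

section

variable {τ w : ℂ} (hw : |w.im| ≤ τ.im / 2)
include hw

lemma norm_appell_numerator_le (n : ℤ) :
    ‖(-1 : ℂ) ^ n * cexp (Real.pi * I * (n * (n + 1)) * τ + 2 * Real.pi * I * n * w)‖ ≤
      Real.exp (-Real.pi * (τ.im * n ^ 2 - 2 * τ.im * |(n : ℝ)|)) := by
  have hexp : (Real.pi * I * (n * (n + 1)) * τ + 2 * Real.pi * I * n * w : ℂ) =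
      ((Real.pi * (n * (n + 1)) : ℝ) * τ + (2 * Real.pi * n : ℝ) * w) * I := by
    push_cast
    ring
  have hlin : |n * (τ.im + 2 * w.im)| ≤ |(n : ℝ)| * (2 * τ.im) := by
    rw [abs_mul]
    refine mul_le_mul_of_nonneg_left (abs_le.mpr ?_) (abs_nonneg _)
    constructor <;> linarith [abs_le.mp hw]
  rw [norm_mul, norm_neg_one_zpow, one_mul, hexp, Complex.norm_exp, mul_I_re, add_im,
    im_ofReal_mul, im_ofReal_mul, Real.exp_le_exp]
  linarith [mul_le_mul_of_nonneg_left ((neg_le_abs _).trans hlin) Real.pi_pos.le]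

lemma one_sub_exp_le_norm_appell_denominator {n : ℤ} (hn : n ≠ 0) :
    1 - Real.exp (-(Real.pi * τ.im)) ≤ ‖1 - cexp (2 * Real.pi * I * (w + n * τ))‖ := by
  have hy : 0 ≤ τ.im := by linarith [(abs_nonneg _).trans hw]
  have hn1 : (1 : ℝ) ≤ |(n : ℝ)| := by exact_mod_cast Int.one_le_abs hn
  have him : τ.im / 2 ≤ |(w + n * τ).im| := by
    rw [add_im, ← ofReal_intCast, im_ofReal_mul]
    have htri := abs_sub_abs_le_abs_sub (n * τ.im) (-w.im)
    rw [abs_neg, sub_neg_eq_add, add_comm (n * τ.im), abs_mul, abs_of_nonneg hy] at htri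
    linarith [mul_le_mul_of_nonneg_right hn1 hy]
  have hle : Real.pi * τ.im ≤ |-2 * Real.pi * (w + n * τ).im| := by
    rw [abs_mul, abs_mul, abs_neg, abs_two, abs_of_pos Real.pi_pos]
    linarith [mul_le_mul_of_nonneg_left him Real.pi_pos.le]
  calc 1 - Real.exp (-(Real.pi * τ.im))
      ≤ 1 - Real.exp (-|-2 * Real.pi * (w + n * τ).im|) := by gcongr
    _ ≤ |1 - Real.exp (-2 * Real.pi * (w + n * τ).im)| := one_sub_exp_neg_abs_le _
    _ = |‖(1 : ℂ)‖ - ‖cexp (2 * Real.pi * I * (w + n * τ))‖| := by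
      rw [norm_exp_two_pi_I_mul, norm_one]
    _ ≤ _ := abs_norm_sub_norm_le _ _

end

lemma one_sub_exp_ne_zero {z τ : ℂ} (hz : ∀ m n : ℤ, z ≠ m * τ + n) (n : ℤ) :
    1 - cexp (2 * Real.pi * I * (z + n * τ)) ≠ 0 := by
  rw [sub_ne_zero, ne_comm, Ne, Complex.exp_eq_one_iff]
  rintro ⟨k, hk⟩
  have hlattice : z + n * τ = k :=
    mul_left_cancel₀ two_pi_I_ne_zero (hk.trans (mul_comm _ _))
  refine hz (-n) k ?_
  push_cast
  linear_combination hlattice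

lemma continuousAt_appell {τ z : ℂ} (hτ : 0 < τ.im) (hz : z.im = 0)
    (hz' : ∀ m n : ℤ, z ≠ m * τ + n) : ContinuousAt (fun w => appell w τ) z := by
  set c := ‖1 - cexp (2 * Real.pi * I * z)‖ / 2
  have hzero : 0 < ‖1 - cexp (2 * Real.pi * I * z)‖ := by
    have hne := one_sub_exp_ne_zero hz' 0
    rwa [Int.cast_zero, zero_mul, add_zero, ← norm_pos_iff] at hne
  have hnear : ∀ᶠ w in 𝓝 z, c < ‖1 - cexp (2 * Real.pi * I * w)‖ :=
    (Continuous.tendsto (by fun_prop) z).eventually_const_lt (half_lt_self hzero)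
  have hstrip : ∀ᶠ w : ℂ in 𝓝 z, |w.im| < τ.im / 2 :=
    (continuous_im.abs.tendsto z).eventually_lt_const (by rw [hz, abs_zero]; exact half_pos hτ)
  have hpos : 0 < min (1 - Real.exp (-(Real.pi * τ.im))) c :=
    lt_min (sub_pos.mpr (Real.exp_lt_one_iff.mpr (neg_neg_of_pos (mul_pos Real.pi_pos hτ))))
      (half_pos hzero)
  refine tendsto_tsum_of_dominated_convergence ((summable_pow_mul_jacobiTheta₂_term_bound τ.im hτ
    0).mul_right (min (1 - Real.exp (-(Real.pi * τ.im))) c)⁻¹)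
    (fun n => ContinuousAt.div (by fun_prop) (by fun_prop) (one_sub_exp_ne_zero hz' n)) ?_
  filter_upwards [hnear, hstrip] with w hw hw' n
  rw [norm_div, div_eq_mul_inv, pow_zero, one_mul, Int.cast_abs]
  refine mul_le_mul (norm_appell_numerator_le hw'.le n) (inv_anti₀ hpos ?_)
    (inv_nonneg.mpr (norm_nonneg _)) (Real.exp_pos _).le
  rcases eq_or_ne n 0 with rfl | hn
  · rw [Int.cast_zero, zero_mul, add_zero]
    exact (min_le_right _ _).trans hw.le
  · exact (min_le_left _ _).trans (one_sub_exp_le_norm_appell_denominator hw'.le hn)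

lemma theta_decomposition_real (τ : ℍ) {z : ℂ} (hz : z.im = 0)
    (hz' : ∀ m n : ℤ, z ≠ m * (τ : ℂ) + n) : theta1 z τ ^ 2 * mu z τ =
      S 0 τ * theta3 (2 * z) (2 * τ) + S 1 τ * theta2 (2 * z) (2 * τ) := by
  have hτ2 : 0 < (2 * (τ : ℂ)).im := by simpa using τ.im_pos
  have hθ (a : ℝ) : Continuous fun z => thetaChar a 0 (2 * z) (2 * τ) :=
    (continuous_thetaChar a 0 hτ2).comp (by fun_prop)
  have hleft : ContinuousAt (fun z => theta1 z τ ^ 2 * mu z τ) z := by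
    simp only [theta1_sq_mul_mu]
    exact ContinuousAt.mul (by fun_prop) ((continuous_thetaChar _ _ τ.im_pos).continuousAt.mul
      (continuousAt_appell τ.im_pos hz hz'))
  have hright : ContinuousAt
      (fun z => S 0 τ * theta3 (2 * z) (2 * τ) + S 1 τ * theta2 (2 * z) (2 * τ)) z :=
    (((hθ 0).const_mul _).add ((hθ (1 / 2)).const_mul _)).continuousAt
  have hpath : Tendsto (fun t : ℝ => z + I * t) (𝓝[>] 0) (𝓝 z) := by
    have hcont : ContinuousAt (fun t : ℝ => z + I * t) 0 := by fun_prop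
    simpa using hcont.tendsto.mono_left nhdsWithin_le_nhds
  have hstrip : ∀ᶠ t : ℝ in 𝓝[>] 0, 0 < (z + I * t).im ∧ (z + I * t).im < τ.im := by
    filter_upwards [Ioo_mem_nhdsGT τ.im_pos] with t ht
    simpa [hz] using ht
  exact tendsto_nhds_unique_of_frequently_eq hleft hright
    (hpath.frequently (hstrip.mono fun t ht => theta_decomposition_strip τ ht.1 ht.2).frequently)

theorem theta_decomposition (τ : ℍ) (z : ℂ) (hz : ∀ m n : ℤ, z ≠ m * (τ : ℂ) + n) :
    theta1 z τ ^ 2 * mu z τ =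
      S 0 τ * theta3 (2 * z) (2 * τ) + S 1 τ * theta2 (2 * z) (2 * τ) := by
  have hper : Function.Periodic (fun z : ℂ => theta1 z τ ^ 2 * mu z τ =
      S 0 τ * theta3 (2 * z) (2 * τ) + S 1 τ * theta2 (2 * z) (2 * τ)) τ := fun z => by
    dsimp only
    rw [theta1_sq_mul_mu_add_tau, theta3, theta2, thetaChar_two_mul_add_tau,
      thetaChar_two_mul_add_tau, mul_left_comm (S 0 τ), mul_left_comm (S 1 τ), ← mul_add,
      mul_right_inj' (Complex.exp_ne_zero _), theta3, theta2]
  obtain ⟨k, ⟨hlow, hhigh⟩, -⟩ := existsUnique_add_zsmul_mem_Ico τ.im_pos z.im 0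
  have him : (z + k * τ).im = z.im + k • τ.im := by
    rw [add_im, ← ofReal_intCast, im_ofReal_mul, zsmul_eq_mul]
    rfl
  rw [zero_add, ← him] at hhigh
  rw [← him] at hlow
  apply (iff_of_eq (hper.int_mul k z)).mp
  rcases hlow.eq_or_lt with hreal | hpos
  · refine theta_decomposition_real τ hreal.symm fun m n hmn => hz (m - k) n ?_
    push_cast
    linear_combination hmn
  · exact theta_decomposition_strip τ hpos hhigh

/-! ### Automorphy factors -/

lemma autFactor_eq_denom (γ : SL(2, ℤ)) (τ : ℍ) : autFactor γ τ = UpperHalfPlane.denom γ τ :=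
  (ModularGroup.denom_apply γ τ).symm

lemma autFactor_ne_zero (γ : SL(2, ℤ)) (τ : ℍ) : autFactor γ τ ≠ 0 := by
  rw [autFactor_eq_denom]
  exact UpperHalfPlane.denom_ne_zero _ _

lemma autFactor_mul (γ₁ γ₂ : SL(2, ℤ)) (τ : ℍ) :
    autFactor (γ₁ * γ₂) τ = autFactor γ₁ (γ₂ • τ) * autFactor γ₂ τ := by
  simp only [autFactor_eq_denom, map_mul]
  rw [UpperHalfPlane.denom_cocycle _ _ τ.im_ne_zero, ← UpperHalfPlane.coe_smul_of_det_pos (by simp)]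
  rfl

@[simp] lemma autFactor_one (τ : ℍ) : autFactor 1 τ = 1 := by
  simp [autFactor]

lemma autFactor_T_zpow (n : ℤ) (τ : ℍ) : autFactor (ModularGroup.T ^ n) τ = 1 := by
  simp [autFactor, ModularGroup.coe_T_zpow]

lemma autFactor_T (τ : ℍ) : autFactor ModularGroup.T τ = 1 := by
  simpa using autFactor_T_zpow 1 τ

lemma autFactor_S (τ : ℍ) : autFactor ModularGroup.S τ = τ := by
  simp [autFactor, ModularGroup.S]

lemma coe_T_smul (τ : ℍ) : ((ModularGroup.T • τ : ℍ) : ℂ) = τ + 1 := by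
  simpa using ModularGroup.coe_T_zpow_smul_eq τ (n := 1)

lemma S_smul_S_smul (τ : ℍ) : ModularGroup.S • ModularGroup.S • τ = τ := by
  apply UpperHalfPlane.ext
  rw [coe_S_smul, coe_S_smul]
  have := τ.ne_zero
  field_simp

lemma continuous_smul (γ : SL(2, ℤ)) : Continuous fun τ : ℍ => γ • τ :=
  continuous_const_smul (γ : GL (Fin 2) ℝ)

lemma continuous_log_autFactor (γ : SL(2, ℤ)) :
    Continuous fun τ : ℍ => log (autFactor γ τ) := by
  by_cases h : γ 1 0 = 0
  · simp only [autFactor, h, Int.cast_zero, zero_mul, zero_add]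
    exact continuous_const
  · have him (τ : ℍ) : (autFactor γ τ).im = γ 1 0 * τ.im := by simp [autFactor]
    have hcont : Continuous fun τ : ℍ => autFactor γ τ :=
      (continuous_const.mul UpperHalfPlane.continuous_coe).add continuous_const
    refine hcont.clog fun τ => Or.inr ?_
    rw [him]
    exact mul_ne_zero (by exact_mod_cast h) τ.im_pos.ne'

-- The sum of the two logarithms differs from the logarithm of the product by `2πi n(τ)`, with `n`
-- continuous and integer valued on the connected space `ℍ`, hence constant.
lemma exists_cpow_cocycle (w : ℝ) (γ₁ γ₂ : SL(2, ℤ)) : ∃ ε : ℂ, ‖ε‖ = 1 ∧ ∀ τ : ℍ,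
    autFactor γ₁ (γ₂ • τ) ^ (w : ℂ) * autFactor γ₂ τ ^ (w : ℂ) =
      ε * autFactor (γ₁ * γ₂) τ ^ (w : ℂ) := by
  have exists_int (τ : ℍ) : ∃ n : ℤ, log (autFactor γ₁ (γ₂ • τ)) + log (autFactor γ₂ τ) =
      log (autFactor (γ₁ * γ₂) τ) + n * (2 * Real.pi * I) := by
    rw [← Complex.exp_eq_exp_iff_exists_int, Complex.exp_add, exp_log (autFactor_ne_zero _ _),
      exp_log (autFactor_ne_zero _ _), exp_log (autFactor_ne_zero _ _), autFactor_mul]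
  choose n hn using exists_int
  have hn_re : (fun m : ℤ => (m : ℝ)) ∘ n = fun τ : ℍ =>
      ((log (autFactor γ₁ (γ₂ • τ)) + log (autFactor γ₂ τ) - log (autFactor (γ₁ * γ₂) τ)) /
        (2 * Real.pi * I)).re := by
    funext τ
    rw [hn, add_sub_cancel_left, mul_div_cancel_right₀ _ two_pi_I_ne_zero]
    simp
  have hcont : Continuous n := by
    rw [Int.isClosedEmbedding_coe_real.isEmbedding.continuous_iff, hn_re]
    exact continuous_re.comp (((((continuous_log_autFactor γ₁).comp (continuous_smul γ₂)).add
      (continuous_log_autFactor γ₂)).sub (continuous_log_autFactor (γ₁ * γ₂))).div_const _)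
  refine ⟨cexp ((2 * Real.pi * n UpperHalfPlane.I * w : ℝ) * I), Complex.norm_exp_ofReal_mul_I _,
    fun τ => ?_⟩
  have hconst : n UpperHalfPlane.I = n τ := PreconnectedSpace.constant inferInstance hcont
  rw [cpow_def_of_ne_zero (autFactor_ne_zero _ _), cpow_def_of_ne_zero (autFactor_ne_zero _ _),
    cpow_def_of_ne_zero (autFactor_ne_zero _ _), ← Complex.exp_add, ← add_mul, hn, hconst,
    ← Complex.exp_add]
  congr 1
  push_cast
  ring

lemma ne_zero_of_norm_eq_one {ε : ℂ} (hε : ‖ε‖ = 1) : ε ≠ 0 :=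
  norm_ne_zero_iff.mp (hε ▸ one_ne_zero)

lemma exists_cpow_inv (w : ℝ) (γ : SL(2, ℤ)) : ∃ ε : ℂ, ‖ε‖ = 1 ∧ ∀ τ : ℍ,
    autFactor γ (γ⁻¹ • τ) ^ (w : ℂ) * autFactor γ⁻¹ τ ^ (w : ℂ) = ε := by
  obtain ⟨ε, hε, hcocycle⟩ := exists_cpow_cocycle w γ γ⁻¹
  exact ⟨ε, hε, fun τ => by simpa using hcocycle τ⟩

/-! ### Functions transforming with multipliers -/

/-- The subgroup of `SL₂(ℤ)` under which `f` transforms in weight `w` with unitary multipliers. -/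
def multiplierSubgroup (w : ℝ) (f : ℍ → ℂ) : Subgroup SL(2, ℤ) where
  carrier := {γ | ∃ v : ℂ, ‖v‖ = 1 ∧ ∀ τ : ℍ, f (γ • τ) = v * autFactor γ τ ^ (w : ℂ) * f τ}
  one_mem' := ⟨1, norm_one, fun τ => by simp⟩
  mul_mem' := by
    rintro γ₁ γ₂ ⟨v₁, hv₁, hf₁⟩ ⟨v₂, hv₂, hf₂⟩
    obtain ⟨ε, hε, hcocycle⟩ := exists_cpow_cocycle w γ₁ γ₂
    refine ⟨v₁ * v₂ * ε, by simp [hv₁, hv₂, hε], fun τ => ?_⟩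
    rw [mul_smul, hf₁, hf₂]
    linear_combination (v₁ * v₂ * f τ) * hcocycle τ
  inv_mem' := by
    rintro γ ⟨v, hv, hf⟩
    obtain ⟨ε, hε, hinv⟩ := exists_cpow_inv w γ
    have hv₀ := ne_zero_of_norm_eq_one hv
    have hε₀ := ne_zero_of_norm_eq_one hε
    refine ⟨v⁻¹ * ε⁻¹, by simp [hv, hε], fun τ => ?_⟩
    have hfτ := hf (γ⁻¹ • τ)
    rw [smul_inv_smul] at hfτ
    rw [hfτ]
    field_simp
    linear_combination (-f (γ⁻¹ • τ)) * hinv τ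

/-- The relation `F(γτ) = (cτ + d)^w M F(τ)` for a vector `F` of functions. -/
def VecTransforms {ι : Type*} [Fintype ι] (w : ℝ) (F : ℍ → ι → ℂ) (γ : SL(2, ℤ))
    (M : Matrix ι ι ℂ) : Prop :=
  ∀ τ : ℍ, F (γ • τ) = autFactor γ τ ^ (w : ℂ) • (M *ᵥ F τ)

section VecTransforms

variable {ι : Type*} [Fintype ι] {w : ℝ} {F : ℍ → ι → ℂ}

lemma VecTransforms.mul {γ₁ γ₂ : SL(2, ℤ)} {M₁ M₂ : Matrix ι ι ℂ}
    (h₁ : VecTransforms w F γ₁ M₁) (h₂ : VecTransforms w F γ₂ M₂) :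
    ∃ ε : ℂ, ‖ε‖ = 1 ∧ VecTransforms w F (γ₁ * γ₂) (ε • (M₁ * M₂)) := by
  obtain ⟨ε, hε, hcocycle⟩ := exists_cpow_cocycle w γ₁ γ₂
  refine ⟨ε, hε, fun τ => ?_⟩
  rw [mul_smul, h₁, h₂, Matrix.mulVec_smul, Matrix.mulVec_mulVec, smul_smul, Matrix.smul_mulVec,
    smul_smul, hcocycle, mul_comm]

variable [DecidableEq ι]

lemma VecTransforms.inv {γ : SL(2, ℤ)} {M N : Matrix ι ι ℂ} (h : VecTransforms w F γ M)
    (hN : N * M = 1) : ∃ ε : ℂ, ‖ε‖ = 1 ∧ VecTransforms w F γ⁻¹ (ε • N) := by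
  obtain ⟨ε, hε, hinv⟩ := exists_cpow_inv w γ
  refine ⟨ε⁻¹, by simp [hε], fun τ => ?_⟩
  have hFτ := h (γ⁻¹ • τ)
  rw [smul_inv_smul] at hFτ
  rw [hFτ, Matrix.mulVec_smul, Matrix.smul_mulVec, Matrix.mulVec_mulVec, hN, Matrix.one_mulVec,
    smul_smul, smul_smul, mul_comm (autFactor γ⁻¹ τ ^ (w : ℂ)), hinv,
    mul_inv_cancel₀ (ne_zero_of_norm_eq_one hε), one_smul]

lemma exists_vecTransforms {M_S N_S M_T N_T : Matrix ι ι ℂ}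
    (hS : VecTransforms w F ModularGroup.S M_S) (hNS : N_S * M_S = 1)
    (hT : VecTransforms w F ModularGroup.T M_T) (hNT : N_T * M_T = 1) (γ : SL(2, ℤ)) :
    ∃ M, VecTransforms w F γ M := by
  have hγ : γ ∈ Subgroup.closure {ModularGroup.S, ModularGroup.T} := by
    simp [SpecialLinearGroup.SL2Z_generators]
  suffices ∃ M N, N * M = 1 ∧ VecTransforms w F γ M from
    let ⟨M, _, _, hM⟩ := this
    ⟨M, hM⟩
  induction hγ using Subgroup.closure_induction with
  | mem x hx =>
    rcases hx with rfl | rfl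
    · exact ⟨M_S, N_S, hNS, hS⟩
    · exact ⟨M_T, N_T, hNT, hT⟩
  | one => exact ⟨1, 1, one_mul 1, fun τ => by simp⟩
  | mul x y _ _ hx hy =>
    obtain ⟨M₁, N₁, hN₁, hM₁⟩ := hx
    obtain ⟨M₂, N₂, hN₂, hM₂⟩ := hy
    obtain ⟨ε, hε, hM⟩ := hM₁.mul hM₂
    refine ⟨_, ε⁻¹ • (N₂ * N₁), ?_, hM⟩
    rw [smul_mul_smul_comm, inv_mul_cancel₀ (ne_zero_of_norm_eq_one hε), one_smul,
      Matrix.mul_assoc, ← Matrix.mul_assoc N₁, hN₁, Matrix.one_mul, hN₂]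
  | inv x _ hx =>
    obtain ⟨M, N, hN, hM⟩ := hx
    obtain ⟨ε, hε, hM'⟩ := hM.inv hN
    refine ⟨_, ε⁻¹ • M, ?_, hM'⟩
    rw [smul_mul_smul_comm, inv_mul_cancel₀ (ne_zero_of_norm_eq_one hε), one_smul,
      mul_eq_one_comm.mp hN]

end VecTransforms

/-! ### Generation of `Γ₀(4)` -/

lemma exists_two_mul_abs_add_mul_le (a : ℤ) {b : ℤ} (hb : b ≠ 0) :
    ∃ n : ℤ, 2 * |a + n * b| ≤ |b| := by
  have hb' : (b : ℚ) ≠ 0 := Int.cast_ne_zero.mpr hb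
  refine ⟨-round (a / b : ℚ), ?_⟩
  suffices 2 * |(a : ℚ) + (-round (a / b : ℚ) : ℤ) * b| ≤ |(b : ℚ)| by exact_mod_cast this
  calc 2 * |(a : ℚ) + (-round (a / b : ℚ) : ℤ) * b|
      = 2 * (|(a / b : ℚ) - round (a / b : ℚ)| * |(b : ℚ)|) := by
        rw [← abs_mul, sub_mul, div_mul_cancel₀ _ hb', Int.cast_neg, neg_mul, ← sub_eq_add_neg]
    _ ≤ 2 * (1 / 2 * |(b : ℚ)|) := by
        gcongr
        exact abs_sub_round _
    _ = |(b : ℚ)| := by ring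

lemma sl_mul_apply (γ₁ γ₂ : SL(2, ℤ)) (i j : Fin 2) :
    (γ₁ * γ₂) i j = γ₁ i 0 * γ₂ 0 j + γ₁ i 1 * γ₂ 1 j := by
  simp [Matrix.mul_apply, Fin.sum_univ_two]

lemma S_mul_T_zpow_mul_S_inv (k : ℤ) :
    ((ModularGroup.S * ModularGroup.T ^ k * ModularGroup.S⁻¹ : SL(2, ℤ)) : Matrix _ _ ℤ) =
      !![1, 0; -k, 1] := by
  simp [ModularGroup.coe_T_zpow, ModularGroup.coe_S, Matrix.adjugate_fin_two]

lemma mem_of_apply_one_zero_eq_zero {K : Subgroup SL(2, ℤ)} (hT : ModularGroup.T ∈ K)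
    (hneg : (-1 : SL(2, ℤ)) ∈ K) {γ : SL(2, ℤ)} (hc : γ 1 0 = 0) : γ ∈ K := by
  have hdet : γ 0 0 * γ 1 1 = 1 := by
    have := γ.det_coe
    rwa [Matrix.det_fin_two, hc, mul_zero, sub_zero] at this
  rcases Int.mul_eq_one_iff_eq_one_or_neg_one.mp hdet with ⟨ha, hd⟩ | ⟨ha, hd⟩
  · have hγ : γ = ModularGroup.T ^ γ 0 1 := by
      ext i j
      fin_cases i <;> fin_cases j <;> simp [ModularGroup.coe_T_zpow, ha, hd, hc]
    rw [hγ]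
    exact K.zpow_mem hT _
  · have hγ : γ = -1 * ModularGroup.T ^ (-γ 0 1) := by
      ext i j
      fin_cases i <;> fin_cases j <;>
        simp [ModularGroup.coe_T_zpow, ha, hd, hc, -_root_.zpow_neg]
    rw [hγ]
    exact K.mul_mem hneg (K.zpow_mem hT _)

lemma mem_Gamma0_four {γ : SL(2, ℤ)} : γ ∈ CongruenceSubgroup.Gamma0 4 ↔ (4 : ℤ) ∣ γ 1 0 :=
  CongruenceSubgroup.Gamma0_mem.trans (ZMod.intCast_zmod_eq_zero_iff_dvd _ 4)

-- First make `|d| ≤ |c| / 2` by a power of `T`; this is strict because `d` is odd and `4 ∣ c`.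
-- Then make `|c| ≤ 2 |d|` by a power of `S T⁴ S⁻¹`.
lemma exists_abs_mul_apply_one_zero_lt {γ : SL(2, ℤ)} (hγ : γ ∈ CongruenceSubgroup.Gamma0 4)
    (hc : γ 1 0 ≠ 0) : ∃ m n : ℤ, |(γ * ModularGroup.T ^ n *
      (ModularGroup.S * ModularGroup.T ^ (4 * m) * ModularGroup.S⁻¹)) 1 0| < |γ 1 0| := by
  obtain ⟨c, hc4⟩ := mem_Gamma0_four.mp hγ
  obtain ⟨n, hn⟩ := exists_two_mul_abs_add_mul_le (γ 1 1) hc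
  set d := γ 1 1 + n * γ 1 0 with hd
  have hd_odd : Odd d := by
    have hdet : γ 0 0 * γ 1 1 - γ 0 1 * γ 1 0 = 1 := by
      rw [← Matrix.det_fin_two]
      exact γ.det_coe
    have had : Odd (γ 0 0 * γ 1 1) := ⟨γ 0 1 * (2 * c), by rw [hc4] at hdet; linarith⟩
    rw [hd, hc4]
    exact (Int.odd_mul.mp had).2.add_even ⟨n * (2 * c), by ring⟩
  have hd_ne : 4 * d ≠ 0 := mul_ne_zero four_ne_zero fun h => by simp [h] at hd_odd
  obtain ⟨m, hm⟩ := exists_two_mul_abs_add_mul_le (γ 1 0) hd_ne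
  refine ⟨-m, n, ?_⟩
  have hentry : (γ * ModularGroup.T ^ n *
      (ModularGroup.S * ModularGroup.T ^ (4 * -m) * ModularGroup.S⁻¹)) 1 0 =
        γ 1 0 + m * (4 * d) := by
    rw [sl_mul_apply, sl_mul_apply γ, sl_mul_apply γ, S_mul_T_zpow_mul_S_inv, hd]
    simp only [ModularGroup.coe_T_zpow, of_apply, cons_val', cons_val_zero, cons_val_fin_one,
      mul_one, cons_val_one, mul_zero, add_zero, mul_neg, neg_neg, add_right_inj]
    ring
  have hne : 2 * |d| ≠ |γ 1 0| := by
    rw [hc4, abs_mul, Nat.abs_ofNat]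
    have := Int.odd_iff.mp (odd_abs.mpr hd_odd)
    lia
  rw [hentry]
  rw [abs_mul 4, Nat.abs_ofNat] at hm
  lia

theorem mem_of_mem_Gamma0_four {K : Subgroup SL(2, ℤ)} (hT : ModularGroup.T ∈ K)
    (hneg : (-1 : SL(2, ℤ)) ∈ K)
    (hU : ModularGroup.S * ModularGroup.T ^ (4 : ℤ) * ModularGroup.S⁻¹ ∈ K) {γ : SL(2, ℤ)}
    (hγ : γ ∈ CongruenceSubgroup.Gamma0 4) : γ ∈ K := by
  induction hN : (γ 1 0).natAbs using Nat.strong_induction_on generalizing γ with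
  | _ N ih =>
  by_cases hc : γ 1 0 = 0
  · exact mem_of_apply_one_zero_eq_zero hT hneg hc
  obtain ⟨m, n, hlt⟩ := exists_abs_mul_apply_one_zero_lt hγ hc
  set V := ModularGroup.S * ModularGroup.T ^ (4 * m) * ModularGroup.S⁻¹ with hV
  have hVK : V ∈ K := by
    rw [hV, _root_.zpow_mul, ← conj_zpow]
    exact K.zpow_mem hU m
  have hVΓ : V ∈ CongruenceSubgroup.Gamma0 4 := by
    rw [mem_Gamma0_four, hV, S_mul_T_zpow_mul_S_inv]
    simp
  have hTΓ : ModularGroup.T ∈ CongruenceSubgroup.Gamma0 4 := by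
    rw [mem_Gamma0_four]
    simp [ModularGroup.T]
  have hmem : γ * ModularGroup.T ^ n * V ∈ K :=
    ih _ (by rw [← hN]; zify; exact hlt)
      (mul_mem (mul_mem hγ (zpow_mem hTΓ n)) hVΓ) rfl
  rwa [K.mul_mem_cancel_right hVK, K.mul_mem_cancel_right (K.zpow_mem hT n)] at hmem

/-! ### Generalized `q`-series -/

/-- The series `∑ᵢ cᵢ q^{Qᵢ}` with real exponents. -/
def qSeries {ι : Type*} (c : ι → ℂ) (Q : ι → ℝ) (τ : ℍ) : ℂ :=
  ∑' i, c i * cexp (2 * Real.pi * I * Q i * τ)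

lemma norm_mul_cexp_two_pi_I (c : ℂ) (Q : ℝ) (z : ℂ) :
    ‖c * cexp (2 * Real.pi * I * Q * z)‖ = ‖c‖ * Real.exp (-(2 * Real.pi * Q * z.im)) := by
  rw [norm_mul, Complex.norm_exp]
  congr 2
  simp

lemma norm_qSeries_term_le {ε Q : ℝ} {c z : ℂ} {y : ℝ} (hQ : c ≠ 0 → ε ≤ Q)
    (hz : y ≤ z.im) : ‖c * cexp (2 * Real.pi * I * Q * z)‖ ≤
      Real.exp (-(2 * Real.pi * ε * (z.im - y))) * (‖c‖ * Real.exp (-(2 * Real.pi * Q * y))) := by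
  rw [norm_mul_cexp_two_pi_I, mul_left_comm, ← Real.exp_add]
  by_cases hc : c = 0
  · simp [hc]
  · gcongr
    have hmul := mul_le_mul_of_nonneg_left
      (mul_le_mul_of_nonneg_right (hQ hc) (sub_nonneg.mpr hz)) Real.two_pi_pos.le
    linarith

lemma qSeries_T_smul {ι : Type*} {c : ι → ℂ} {Q : ι → ℝ} {v : ℂ}
    (hv : ∀ i, cexp (2 * Real.pi * I * Q i) = v) (τ : ℍ) :
    qSeries c Q (ModularGroup.T • τ) = v * qSeries c Q τ := by
  rw [qSeries, qSeries, ← tsum_mul_left]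
  refine tsum_congr fun i => ?_
  rw [coe_T_smul, mul_add, mul_one, Complex.exp_add, hv]
  ring

section qSeries

variable {ι : Type*} {c : ι → ℂ} {Q : ι → ℝ} {ε : ℝ} (hQ : ∀ i, c i ≠ 0 → ε ≤ Q i)
  (hs : ∀ τ : ℍ, Summable fun i => c i * cexp (2 * Real.pi * I * Q i * τ))

include hs in
lemma summable_norm_qSeries_term {y : ℝ} (hy : 0 < y) :
    Summable fun i => ‖c i‖ * Real.exp (-(2 * Real.pi * Q i * y)) := by
  refine (hs ⟨y * I, by simpa using hy⟩).norm.congr fun i => ?_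
  rw [norm_mul_cexp_two_pi_I]
  simp

include hQ hs

lemma norm_qSeries_le {y : ℝ} (hy : 0 < y) {τ : ℍ} (hτ : y ≤ τ.im) :
    ‖qSeries c Q τ‖ ≤ Real.exp (-(2 * Real.pi * ε * (τ.im - y))) *
      ∑' i, ‖c i‖ * Real.exp (-(2 * Real.pi * Q i * y)) := by
  rw [← tsum_mul_left]
  exact tsum_of_norm_bounded ((summable_norm_qSeries_term hs hy).mul_left _).hasSum
    fun i => norm_qSeries_term_le (hQ i) hτ

lemma mdifferentiable_qSeries (hε : 0 ≤ ε) : MDifferentiable 𝓘(ℂ) 𝓘(ℂ) (qSeries c Q) := by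
  rw [UpperHalfPlane.mdifferentiable_iff]
  intro z (hz : 0 < z.im)
  set U : Set ℂ := {w | z.im / 2 < w.im}
  have hU : IsOpen U := isOpen_lt continuous_const continuous_im
  have hzU : U ∈ 𝓝 z := hU.mem_nhds (half_lt_self hz)
  have hdiff : DifferentiableOn ℂ
      (fun w : ℂ => ∑' i, c i * cexp (2 * Real.pi * I * Q i * w)) U := by
    refine differentiableOn_tsum_of_summable_norm
      (summable_norm_qSeries_term hs (half_pos hz)) (fun i => by fun_prop) hU fun i w hw => ?_
    simpa using norm_qSeries_term_le (fun hc => hε.trans (hQ i hc)) (le_of_lt hw)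
  refine ((hdiff.differentiableAt hzU).congr_of_eventuallyEq ?_).differentiableWithinAt
  filter_upwards [hzU] with w hw
  simp [qSeries, UpperHalfPlane.ofComplex_apply_of_im_pos ((half_pos hz).trans hw)]

lemma isBoundedAtImInfty_qSeries (hε : 0 ≤ ε) :
    UpperHalfPlane.IsBoundedAtImInfty (qSeries c Q) :=
  UpperHalfPlane.isBoundedAtImInfty_iff.mpr ⟨_, 1, fun _ hτ => by
    simpa using norm_qSeries_le (fun i hc => hε.trans (hQ i hc)) hs one_pos hτ⟩

omit hQ hs in
lemma tendsto_exp_neg_mul_sub_mul {a : ℝ} (ha : 0 < a) (y₀ C : ℝ) :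
    Tendsto (fun y : ℝ => Real.exp (-(a * (y - y₀))) * C) atTop (𝓝 0) := by
  have hlin : Tendsto (fun y : ℝ => a * (y - y₀)) atTop atTop :=
    (tendsto_atTop_add_const_right _ (-y₀) tendsto_id).const_mul_atTop ha
  simpa using (Real.tendsto_exp_neg_atTop_nhds_zero.comp hlin).mul_const C

lemma isZeroAtImInfty_qSeries (hε : 0 < ε) : UpperHalfPlane.IsZeroAtImInfty (qSeries c Q) := by
  rw [UpperHalfPlane.isZeroAtImInfty_iff]
  intro δ hδ
  obtain ⟨A, hA⟩ := eventually_atTop.mp ((tendsto_exp_neg_mul_sub_mul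
    (mul_pos Real.two_pi_pos hε) _ _).eventually_le_const hδ)
  exact ⟨max A 1, fun τ hτ => (norm_qSeries_le hQ hs one_pos (le_of_max_le_right hτ)).trans
    (hA _ (le_of_max_le_left hτ))⟩

omit hQ hs in
lemma qSeries_term_mul_cexp (c : ℂ) (Q a : ℝ) (z : ℂ) :
    c * cexp (2 * Real.pi * I * Q * z) * cexp (-(2 * Real.pi * I * a * z)) =
      c * cexp (2 * Real.pi * I * (Q - a : ℝ) * z) := by
  rw [mul_assoc, ← Complex.exp_add]
  push_cast
  ring_nf

omit hQ in
lemma tendsto_qSeries_mul_cexp {a b : ℝ} {s : Finset ι} (hQs : ∀ i ∈ s, Q i = a)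
    (hQ : ∀ i ∉ s, c i ≠ 0 → b ≤ Q i) (hab : a < b) :
    Tendsto (fun τ : ℍ => qSeries c Q τ * cexp (-(2 * Real.pi * I * a * τ)))
      UpperHalfPlane.atImInfty (𝓝 (∑ i ∈ s, c i)) := by
  have hs' (τ : ℍ) : Summable fun i => c i * cexp (2 * Real.pi * I * (Q i - a : ℝ) * τ) :=
    ((hs τ).mul_right _).congr fun i => qSeries_term_mul_cexp (c i) (Q i) a τ
  have hsplit (τ : ℍ) : qSeries c Q τ * cexp (-(2 * Real.pi * I * a * τ)) =
      ∑ i ∈ s, c i + qSeries (fun i : {i // i ∉ s} => c i) (fun i => Q i - a) τ := by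
    rw [qSeries, ← tsum_mul_right, tsum_congr fun i => qSeries_term_mul_cexp (c i) (Q i) a τ,
      ← (hs' τ).sum_add_tsum_subtype_compl s]
    exact congrArg (· + _) (Finset.sum_congr rfl fun i hi => by simp [hQs i hi])
  have htail : UpperHalfPlane.IsZeroAtImInfty
      (qSeries (fun i : {i // i ∉ s} => c i) fun i => Q i - a) :=
    isZeroAtImInfty_qSeries (fun i hc => sub_le_sub_right (hQ i i.2 hc) a)
      (fun τ => (hs' τ).subtype _) (sub_pos.mpr hab)
  simpa only [hsplit, add_zero] using tendsto_const_nhds.add htail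

end qSeries

/-! ### Two theta functions -/

/-- `∑ q^{k²}`, summed over `k ∈ (1 + ℓ)/2 + ℤ`. -/
def fTheta (l : ℤ) (τ : ℍ) : ℂ := ∑' n : ℤ, thetaTerm 1 0 ((1 + l) / 2) 0 (2 * τ) n

/-- `∑ ν e^{πiν} q^{ν²/2}`, summed over `ν ∈ 1/2 + ℤ`. -/
def gTheta (τ : ℍ) : ℂ := ∑' n : ℤ, thetaTerm 0 1 (1 / 2) (1 / 2) τ n

lemma two_mul_im_pos (τ : ℍ) : 0 < (2 * (τ : ℂ)).im := by
  simpa using τ.im_pos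

lemma fTheta_term (l n : ℤ) (τ : ℍ) : thetaTerm 1 0 ((1 + l) / 2) 0 (2 * τ) n =
    1 * cexp (2 * Real.pi * I * (((n + (1 + l) / 2) ^ 2 : ℝ) : ℂ) * τ) := by
  rw [thetaTerm]
  push_cast
  ring_nf

lemma gTheta_term (n : ℤ) (τ : ℍ) : thetaTerm 0 1 (1 / 2) (1 / 2) τ n =
    ((n + 1 / 2) * cexp (Real.pi * I * (n + 1 / 2))) *
      cexp (2 * Real.pi * I * (((n + 1 / 2) ^ 2 / 2 : ℝ) : ℂ) * τ) := by
  rw [thetaTerm, mul_assoc (n + 1 / 2 : ℂ), ← Complex.exp_add]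
  push_cast
  ring_nf

lemma summable_fTheta (l : ℤ) (τ : ℍ) : Summable fun n : ℤ =>
    (1 : ℂ) * cexp (2 * Real.pi * I * (((n + (1 + l) / 2) ^ 2 : ℝ) : ℂ) * τ) :=
  (summable_thetaTerm (two_mul_im_pos τ) 1 0 ((1 + l) / 2) 0).congr fun n => fTheta_term l n τ

lemma summable_gTheta (τ : ℍ) : Summable fun n : ℤ =>
    ((n + 1 / 2) * cexp (Real.pi * I * (n + 1 / 2))) *
      cexp (2 * Real.pi * I * (((n + 1 / 2) ^ 2 / 2 : ℝ) : ℂ) * τ) :=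
  (summable_thetaTerm τ.im_pos 0 1 (1 / 2) (1 / 2)).congr fun n => gTheta_term n τ

lemma fTheta_eq_qSeries (l : ℤ) :
    fTheta l = qSeries (fun _ : ℤ => 1) fun n => (n + (1 + l) / 2) ^ 2 :=
  funext fun τ => tsum_congr fun n => fTheta_term l n τ

lemma gTheta_eq_qSeries : gTheta = qSeries
    (fun n : ℤ => (n + 1 / 2) * cexp (Real.pi * I * (n + 1 / 2))) fun n => (n + 1 / 2) ^ 2 / 2 :=
  funext fun τ => tsum_congr fun n => gTheta_term n τ

lemma quarter_le_sq_add_half (n : ℤ) : (1 / 4 : ℝ) ≤ (n + 1 / 2) ^ 2 := by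
  have hprod : 0 ≤ n * (n + 1) := by
    rcases le_or_gt 0 n with hn | hn
    · positivity
    · exact mul_nonneg_of_nonpos_of_nonpos hn.le (by lia)
  have hprod' : (0 : ℝ) ≤ n * (n + 1) := by exact_mod_cast hprod
  linarith

lemma mdifferentiable_fTheta (l : ℤ) : MDifferentiable 𝓘(ℂ) 𝓘(ℂ) (fTheta l) := by
  rw [fTheta_eq_qSeries]
  exact mdifferentiable_qSeries (fun _ _ => sq_nonneg _) (summable_fTheta l) le_rfl

lemma isBoundedAtImInfty_fTheta (l : ℤ) : UpperHalfPlane.IsBoundedAtImInfty (fTheta l) := by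
  rw [fTheta_eq_qSeries]
  exact isBoundedAtImInfty_qSeries (fun _ _ => sq_nonneg _) (summable_fTheta l) le_rfl

lemma mdifferentiable_gTheta : MDifferentiable 𝓘(ℂ) 𝓘(ℂ) gTheta := by
  rw [gTheta_eq_qSeries]
  exact mdifferentiable_qSeries (fun _ _ => by positivity) summable_gTheta le_rfl

lemma isZeroAtImInfty_gTheta : UpperHalfPlane.IsZeroAtImInfty gTheta := by
  rw [gTheta_eq_qSeries]
  refine isZeroAtImInfty_qSeries (ε := 1 / 8) (fun n _ => ?_) summable_gTheta (by norm_num)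
  linarith [quarter_le_sq_add_half n]

lemma cexp_eq_cexp_of_sub_int {x y : ℂ} (n : ℤ) (h : x = y + n * (2 * Real.pi * I)) :
    cexp x = cexp y := by
  rw [h, Complex.exp_add, exp_int_mul_two_pi_mul_I, mul_one]

lemma fTheta_T_smul (l : ℤ) (τ : ℍ) : fTheta l (ModularGroup.T • τ) =
    cexp (2 * Real.pi * I * ((1 + l) / 2) ^ 2) * fTheta l τ := by
  rw [fTheta_eq_qSeries]
  refine qSeries_T_smul (fun n => cexp_eq_cexp_of_sub_int (n ^ 2 + n * (1 + l)) ?_) τ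
  push_cast
  ring

lemma gTheta_T_smul (τ : ℍ) :
    gTheta (ModularGroup.T • τ) = cexp ((Real.pi / 4 : ℝ) * I) * gTheta τ := by
  rw [gTheta_eq_qSeries]
  refine qSeries_T_smul (fun n => ?_) τ
  obtain ⟨k, hk⟩ := Int.even_mul_succ_self n
  have hk' : (n : ℂ) * (n + 1) = k + k := by exact_mod_cast hk
  refine cexp_eq_cexp_of_sub_int k ?_
  push_cast
  linear_combination (Real.pi * I) * hk'

lemma cexp_int_mul_pi (n : ℤ) : cexp (Real.pi * I * n) = (-1) ^ n := by
  rw [mul_comm, Complex.exp_int_mul, exp_pi_mul_I]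

-- Poisson summation yields `∑ₙ (-1)^{n(1+ℓ)} q^{n²/4}` at `-1/τ`; the even `n` give the summand
-- `f₁` and the odd ones `f₀`.
lemma fTheta_inversion (l : ℤ) (τ : ℍ) :
    fTheta 1 (ModularGroup.S • τ) + (-1) ^ (1 + l) * fTheta 0 (ModularGroup.S • τ) =
      (-I * (2 * τ)) ^ (1 / 2 : ℂ) * fTheta l τ := by
  have hτ := τ.ne_zero
  have hinv := tsum_thetaTerm_inversion (two_mul_im_pos τ) 1 0 ((1 + l) / 2) 0
  have hsum := summable_thetaTerm (im_neg_one_div_pos (two_mul_im_pos τ)) 1 (0 / (2 * τ)) (-0)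
    ((1 + l) / 2)
  rw [mul_zero, mul_zero, neg_zero, Complex.exp_zero, one_mul] at hinv
  rw [neg_zero] at hsum
  rw [fTheta.eq_1 l, ← hinv, tsum_eq_add_of_isCompl hsum (two_mul_add_injective 0)
    (two_mul_add_injective 1) isCompl_range_two_mul_add, fTheta, fTheta, ← tsum_mul_left,
    ← (Equiv.addRight (1 : ℤ)).tsum_eq fun k => thetaTerm _ _ _ _ _ (2 * k + 0)]
  congr 1 <;> refine tsum_congr fun k => ?_
  · rw [thetaTerm, thetaTerm, coe_S_smul]
    congr 1
    · simp
    · refine (cexp_eq_cexp_of_sub_int ((k + 1) * (1 + l)) ?_).symm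
      simp only [Equiv.coe_addRight]
      push_cast
      field_simp
      ring
  · rw [thetaTerm, thetaTerm, coe_S_smul, ← cexp_int_mul_pi, mul_left_comm (cexp _),
      ← Complex.exp_add]
    congr 1
    · simp
    · refine (cexp_eq_cexp_of_sub_int (k * (1 + l)) ?_).symm
      push_cast
      field_simp
      ring

lemma gTheta_inversion (τ : ℍ) :
    gTheta (ModularGroup.S • τ) = -I * τ * (-I * τ) ^ (1 / 2 : ℂ) * gTheta τ := by
  have hτ := τ.ne_zero
  have hinv := tsum_thetaTerm_inversion τ.im_pos 0 1 (1 / 2) (1 / 2)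
  have hphase : cexp (-(2 * Real.pi * I * (1 / 2 * (1 / 2)))) = -I := by
    rw [show -(2 * Real.pi * I * (1 / 2 * (1 / 2)) : ℂ) = -(Real.pi / 2 * I) by ring,
      Complex.exp_neg, Complex.exp_pi_div_two_mul_I, inv_I]
  have hterm (n : ℤ) : thetaTerm 0 (1 / τ) (-(1 / 2)) (1 / 2) (-1 / τ) (n + 1) =
      1 / τ * thetaTerm 0 1 (1 / 2) (1 / 2) (-1 / τ) n := by
    rw [thetaTerm, thetaTerm]
    push_cast
    ring_nf
  rw [← (Equiv.addRight (1 : ℤ)).tsum_eq] at hinv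
  simp only [Equiv.coe_addRight, hterm, tsum_mul_left] at hinv
  rw [hphase] at hinv
  rw [gTheta, gTheta, coe_S_smul, mul_assoc, mul_assoc, mul_left_comm (-I), ← mul_assoc (-I),
    ← hinv]
  field_simp

/-! ### Modularity of the theta functions -/

lemma neg_I_mul_cpow (τ : ℍ) (s : ℂ) : (-I * (τ : ℂ)) ^ s = (I ^ s)⁻¹ * (τ : ℂ) ^ s := by
  have hre : 0 < (-I * (τ : ℂ)).re := by simpa using τ.im_pos
  have harg := abs_lt.mp (abs_arg_lt_pi_div_two_iff.mpr (Or.inl hre))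
  have hne : -I * (τ : ℂ) ≠ 0 := mul_ne_zero (neg_ne_zero.mpr I_ne_zero) τ.ne_zero
  have hlog : log (τ : ℂ) = log I + log (-I * τ) := by
    conv_lhs => rw [show (τ : ℂ) = I * (-I * τ) by rw [← mul_assoc]; simp]
    rw [Complex.log_mul I_ne_zero hne]
    rw [arg_I]
    constructor <;> linarith [harg.1, harg.2, Real.pi_pos]
  rw [cpow_def_of_ne_zero τ.ne_zero, cpow_def_of_ne_zero I_ne_zero, cpow_def_of_ne_zero hne, hlog,
    ← Complex.exp_neg, ← Complex.exp_add]
  ring_nf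

lemma ofReal_mul_cpow {r : ℝ} (hr : 0 < r) {z : ℂ} (hz : z ≠ 0) (s : ℂ) :
    ((r : ℂ) * z) ^ s = (r : ℂ) ^ s * z ^ s := by
  have hr' : (r : ℂ) ≠ 0 := ofReal_ne_zero.mpr hr.ne'
  rw [cpow_def_of_ne_zero (mul_ne_zero hr' hz), cpow_def_of_ne_zero hr', cpow_def_of_ne_zero hz,
    log_ofReal_mul hr hz, ofReal_log hr.le, add_mul, Complex.exp_add]

lemma norm_I_cpow_half : ‖I ^ (1 / 2 : ℂ)‖ = 1 := by
  simpa using norm_cpow_real I (1 / 2)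

lemma neg_I_mul_two_mul_cpow_half (τ : ℍ) : (-I * (2 * (τ : ℂ))) ^ (1 / 2 : ℂ) =
    Real.sqrt 2 * ((I ^ (1 / 2 : ℂ))⁻¹ * (τ : ℂ) ^ (1 / 2 : ℂ)) := by
  have hsqrt : ((2 : ℝ) : ℂ) ^ (1 / 2 : ℂ) = Real.sqrt 2 := by
    rw [Real.sqrt_eq_rpow, ofReal_cpow two_pos.le]
    norm_num
  rw [← neg_I_mul_cpow, ← hsqrt, ← ofReal_mul_cpow two_pos
    (mul_ne_zero (neg_ne_zero.mpr I_ne_zero) τ.ne_zero), ofReal_ofNat, mul_left_comm]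

lemma cpow_neg_mul_cpow {x : ℂ} (hx : x ≠ 0) (w : ℂ) : x ^ (-w) * x ^ w = 1 := by
  rw [← cpow_add _ _ hx, neg_add_cancel, cpow_zero]

lemma isModularForm_of_vecTransforms {ι : Type*} [Fintype ι] {w : ℝ} {F : ℍ → ι → ℂ}
    {Γ : Subgroup SL(2, ℤ)} (hF : ∀ γ, ∃ M, VecTransforms w F γ M)
    (hb : ∀ i, UpperHalfPlane.IsBoundedAtImInfty fun τ => F τ i) {i : ι}
    (hd : MDifferentiable 𝓘(ℂ) 𝓘(ℂ) fun τ => F τ i)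
    (hΓ : Γ ≤ multiplierSubgroup w fun τ => F τ i) : IsModularForm Γ w fun τ => F τ i := by
  refine ⟨hd, ?_, fun γ => ?_⟩
  · choose v hv using fun γ : Γ => hΓ γ.2
    exact ⟨v, fun γ => (hv γ).1, fun γ => (hv γ).2⟩
  · obtain ⟨M, hM⟩ := hF γ
    have hsum : (fun τ => autFactor γ τ ^ (-w : ℂ) * F (γ • τ) i) =
        ∑ j, fun τ => M i j * F τ j := by
      funext τ
      rw [hM, Pi.smul_apply, smul_eq_mul, ← mul_assoc, cpow_neg_mul_cpow (autFactor_ne_zero γ τ),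
        one_mul, Finset.sum_apply]
      rfl
    rw [hsum]
    exact Asymptotics.IsBigO.sum fun j _ => (hb j).const_mul_left _

lemma IsModularForm.const_mul {Γ : Subgroup SL(2, ℤ)} {w : ℝ} {f : ℍ → ℂ}
    (hf : IsModularForm Γ w f) (c : ℂ) : IsModularForm Γ w fun τ => c * f τ := by
  obtain ⟨v, hv, hmod⟩ := hf.modular
  refine ⟨mdifferentiable_const.mul hf.holo, ⟨v, hv, fun γ τ => ?_⟩, fun γ => ?_⟩
  · rw [hmod, mul_left_comm]
  · simp only [mul_left_comm _ c]
    exact (hf.cusps γ).const_mul_left c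

lemma isCuspForm_of_multiplierSubgroup {w : ℝ} {f : ℍ → ℂ}
    (hd : MDifferentiable 𝓘(ℂ) 𝓘(ℂ) f) (hf : UpperHalfPlane.IsZeroAtImInfty f)
    (htop : multiplierSubgroup w f = ⊤) (Γ : Subgroup SL(2, ℤ)) : IsCuspForm Γ w f := by
  choose v hv hmod using fun γ : SL(2, ℤ) =>
    (htop ▸ Subgroup.mem_top γ : γ ∈ multiplierSubgroup w f)
  have hzero : ∀ γ : SL(2, ℤ), UpperHalfPlane.IsZeroAtImInfty
      fun τ => autFactor γ τ ^ (-w : ℂ) * f (γ • τ) := by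
    intro γ
    have hconst : (fun τ => autFactor γ τ ^ (-w : ℂ) * f (γ • τ)) = fun τ => v γ * f τ := by
      funext τ
      rw [hmod]
      linear_combination v γ * f τ * cpow_neg_mul_cpow (autFactor_ne_zero γ τ) w
    rw [hconst]
    simpa [UpperHalfPlane.IsZeroAtImInfty, Filter.ZeroAtFilter] using hf.const_mul (v γ)
  exact ⟨⟨hd, ⟨fun γ => v γ, fun γ => hv γ, fun γ => hmod γ⟩,
    fun γ => (hzero γ).isBoundedAtImInfty⟩, hzero⟩

lemma multiplierSubgroup_gTheta : multiplierSubgroup (3 / 2) gTheta = ⊤ := by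
  rw [eq_top_iff, ← SpecialLinearGroup.SL2Z_generators, Subgroup.closure_le]
  rintro γ (rfl | rfl)
  · refine ⟨-I * (I ^ (1 / 2 : ℂ))⁻¹, by simp [norm_I_cpow_half, -one_div], fun τ => ?_⟩
    have hpow : (τ : ℂ) ^ ((3 / 2 : ℝ) : ℂ) = τ * (τ : ℂ) ^ (1 / 2 : ℂ) := by
      rw [show ((3 / 2 : ℝ) : ℂ) = 1 + 1 / 2 by norm_num, cpow_add _ _ τ.ne_zero, cpow_one]
    rw [gTheta_inversion, neg_I_mul_cpow, autFactor_S, hpow]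
    ring
  · refine ⟨cexp ((Real.pi / 4 : ℝ) * I), Complex.norm_exp_ofReal_mul_I _, fun τ => ?_⟩
    rw [gTheta_T_smul, autFactor_T, one_cpow, mul_one]

lemma isCuspForm_gTheta (Γ : Subgroup SL(2, ℤ)) : IsCuspForm Γ (3 / 2) gTheta :=
  isCuspForm_of_multiplierSubgroup mdifferentiable_gTheta isZeroAtImInfty_gTheta
    multiplierSubgroup_gTheta Γ

/-- The vector `(f₀, f₁)` of theta functions. -/
def fVec (τ : ℍ) : Fin 2 → ℂ := fun i => fTheta (i : ℕ) τ

/-- The matrix of the inversion `τ ↦ -1/τ` on the vector `(f₀, f₁)`. -/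
def fMatrix : Matrix (Fin 2) (Fin 2) ℂ := ((I ^ (1 / 2 : ℂ))⁻¹ / Real.sqrt 2) • !![-1, 1; 1, 1]

lemma ofReal_sqrt_two_sq : (Real.sqrt 2 : ℂ) ^ 2 = 2 := by
  exact_mod_cast Real.sq_sqrt (zero_le_two (α := ℝ))

lemma ofReal_sqrt_two_ne_zero : (Real.sqrt 2 : ℂ) ≠ 0 := by simp

lemma vecTransforms_fVec_S : VecTransforms (1 / 2) fVec ModularGroup.S fMatrix := by
  intro τ
  have hsub := fTheta_inversion 0 τ
  have hadd := fTheta_inversion 1 τ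
  rw [neg_I_mul_two_mul_cpow_half] at hsub hadd
  norm_num only at hsub hadd
  have hdiv : (I ^ (1 / 2 : ℂ))⁻¹ / Real.sqrt 2 = (I ^ (1 / 2 : ℂ))⁻¹ * Real.sqrt 2 / 2 := by
    rw [div_eq_div_iff ofReal_sqrt_two_ne_zero two_ne_zero]
    linear_combination -(I ^ (1 / 2 : ℂ))⁻¹ * ofReal_sqrt_two_sq
  have hf₀ : fTheta 0 (ModularGroup.S • τ) = (τ : ℂ) ^ (1 / 2 : ℂ) *
      ((I ^ (1 / 2 : ℂ))⁻¹ * Real.sqrt 2 / 2 * (-fTheta 0 τ + fTheta 1 τ)) := by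
    linear_combination (hadd - hsub) / 2
  have hf₁ : fTheta 1 (ModularGroup.S • τ) = (τ : ℂ) ^ (1 / 2 : ℂ) *
      ((I ^ (1 / 2 : ℂ))⁻¹ * Real.sqrt 2 / 2 * (fTheta 0 τ + fTheta 1 τ)) := by
    linear_combination (hadd + hsub) / 2
  rw [autFactor_S, fMatrix, hdiv]
  ext i
  fin_cases i
  · simpa [fVec, vecHead, vecTail, mul_add, -ModularGroup.sl_moeb] using hf₀
  · simpa [fVec, vecHead, vecTail, mul_add, -ModularGroup.sl_moeb] using hf₁

lemma fMatrix_mul_self : fMatrix * fMatrix = ((I ^ (1 / 2 : ℂ))⁻¹ ^ 2) • 1 := by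
  have hsq : (!![-1, 1; 1, 1] : Matrix (Fin 2) (Fin 2) ℂ) * !![-1, 1; 1, 1] = (2 : ℂ) • 1 := by
    ext i j
    fin_cases i <;> fin_cases j <;> norm_num [Matrix.mul_apply, Fin.sum_univ_two]
  rw [fMatrix, smul_mul_smul_comm, hsq, smul_smul, ← sq, div_pow, ofReal_sqrt_two_sq,
    div_mul_cancel₀ _ two_ne_zero]

lemma inv_smul_fMatrix_mul_self : ((I ^ (1 / 2 : ℂ)) ^ 2 • fMatrix) * fMatrix = 1 := by
  rw [Matrix.smul_mul, fMatrix_mul_self, smul_smul, ← mul_pow,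
    mul_inv_cancel₀ (ne_zero_of_norm_eq_one norm_I_cpow_half), one_pow, one_smul]

lemma fVec_T_smul (τ : ℍ) : fVec (ModularGroup.T • τ) = !![I, 0; 0, 1] *ᵥ fVec τ := by
  have hphase₀ : cexp (2 * Real.pi * I * ((1 + (0 : ℤ)) / 2) ^ 2) = I := by
    refine Eq.trans (congrArg _ ?_) Complex.exp_pi_div_two_mul_I
    push_cast
    ring
  have hphase₁ : cexp (2 * Real.pi * I * ((1 + (1 : ℤ)) / 2) ^ 2) = 1 := by
    refine Eq.trans (congrArg _ ?_) Complex.exp_two_pi_mul_I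
    push_cast
    ring
  ext i
  fin_cases i
  · have h₀ := fTheta_T_smul 0 τ
    rw [hphase₀] at h₀
    simpa [fVec, vecHead, vecTail, -ModularGroup.sl_moeb] using h₀
  · have h₁ := fTheta_T_smul 1 τ
    rw [hphase₁, one_mul] at h₁
    simpa [fVec, vecHead, vecTail, -ModularGroup.sl_moeb] using h₁

lemma vecTransforms_fVec_T : VecTransforms (1 / 2) fVec ModularGroup.T !![I, 0; 0, 1] :=
  fun τ => by rw [fVec_T_smul, autFactor_T, one_cpow, one_smul]

lemma vecTransforms_fVec_T_zpow_four :
    VecTransforms (1 / 2) fVec (ModularGroup.T ^ (4 : ℤ)) 1 := by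
  intro τ
  have hT : ModularGroup.T ^ (4 : ℤ) • τ =
      ModularGroup.T • ModularGroup.T • ModularGroup.T • ModularGroup.T • τ := by
    simp only [← mul_smul]
    rfl
  have hpow : (!![I, 0; 0, 1] * (!![I, 0; 0, 1] * (!![I, 0; 0, 1] * !![I, 0; 0, 1])) :
      Matrix (Fin 2) (Fin 2) ℂ) = 1 := by
    ext i j
    fin_cases i <;> fin_cases j <;> simp [Matrix.mul_apply, Fin.sum_univ_two]
  simp only [hT, fVec_T_smul, Matrix.mulVec_mulVec, hpow, autFactor_T_zpow, one_cpow, one_smul]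

lemma VecTransforms.mem_multiplierSubgroup {ι : Type*} [Fintype ι] [DecidableEq ι] {w : ℝ}
    {F : ℍ → ι → ℂ} {γ : SL(2, ℤ)} {v : ℂ} (h : VecTransforms w F γ (v • 1)) (hv : ‖v‖ = 1)
    (i : ι) : γ ∈ multiplierSubgroup w fun τ => F τ i := by
  refine ⟨v, hv, fun τ => ?_⟩
  simp only [h τ, Matrix.smul_mulVec, Matrix.one_mulVec, Pi.smul_apply, smul_eq_mul]
  ring

lemma neg_one_mem_multiplierSubgroup (w : ℝ) (f : ℍ → ℂ) :
    (-1 : SL(2, ℤ)) ∈ multiplierSubgroup w f := by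
  have hnorm : ‖(-1 : ℂ) ^ (w : ℂ)‖ = 1 := by simp [Complex.norm_cpow_real]
  refine ⟨((-1 : ℂ) ^ (w : ℂ))⁻¹, by rw [norm_inv, hnorm, inv_one], fun τ => ?_⟩
  have hneg : autFactor (-1) τ = -1 := by simp [autFactor]
  rw [hneg, inv_mul_cancel₀ (ne_zero_of_norm_eq_one hnorm), one_mul, ModularGroup.SL_neg_smul,
    one_smul]

lemma Gamma0_four_le_multiplierSubgroup_fVec (i : Fin 2) :
    CongruenceSubgroup.Gamma0 4 ≤ multiplierSubgroup (1 / 2) fun τ => fVec τ i := by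
  refine fun γ hγ => mem_of_mem_Gamma0_four ?_ (neg_one_mem_multiplierSubgroup _ _) ?_ hγ
  · refine ⟨![I, 1] i, by fin_cases i <;> simp, fun τ => ?_⟩
    simp only [fVec_T_smul, autFactor_T, one_cpow, mul_one]
    fin_cases i <;> simp [vecHead, vecTail]
  · obtain ⟨ε₁, hε₁, hST⟩ := vecTransforms_fVec_S.mul vecTransforms_fVec_T_zpow_four
    obtain ⟨ε₂, hε₂, hSinv⟩ := vecTransforms_fVec_S.inv inv_smul_fMatrix_mul_self
    obtain ⟨ε₃, hε₃, hSTS⟩ := hST.mul hSinv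
    have hscalar : ε₃ • ((ε₁ • (fMatrix * 1)) * (ε₂ • ((I ^ (1 / 2 : ℂ)) ^ 2 • fMatrix))) =
        (ε₃ * (ε₁ * ε₂)) • 1 := by
      rw [smul_mul_smul_comm, smul_smul, Matrix.mul_one,
        mul_eq_one_comm.mp inv_smul_fMatrix_mul_self]
    rw [hscalar] at hSTS
    exact hSTS.mem_multiplierSubgroup (by simp [hε₁, hε₂, hε₃]) i

lemma isModularForm_fTheta (i : Fin 2) :
    IsModularForm (CongruenceSubgroup.Gamma0 4) (1 / 2) (fTheta (i : ℕ)) := by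
  have hT : (!![-I, 0; 0, 1] * !![I, 0; 0, 1] : Matrix (Fin 2) (Fin 2) ℂ) = 1 := by
    ext i j
    fin_cases i <;> fin_cases j <;> simp [Matrix.mul_apply, Fin.sum_univ_two]
  exact isModularForm_of_vecTransforms (F := fVec)
    (exists_vecTransforms vecTransforms_fVec_S inv_smul_fMatrix_mul_self vecTransforms_fVec_T hT)
    (fun j => isBoundedAtImInfty_fTheta _) (mdifferentiable_fTheta _)
    (Gamma0_four_le_multiplierSubgroup_fVec i)

/-! ### The Eichler integral of `gTheta` -/

lemma integrableOn_rpow_mul_exp {s a y : ℝ} (hs : s ≤ 0) (ha : 0 < a) (hy : 0 < y) :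
    IntegrableOn (fun t : ℝ => (t + y) ^ s * Real.exp (-(a * t))) (Set.Ioi y) := by
  refine Integrable.mono' ((exp_neg_integrableOn_Ioi y ha).const_mul (y ^ s))
    (Measurable.aestronglyMeasurable (by fun_prop)) ?_
  filter_upwards [ae_restrict_mem measurableSet_Ioi] with t (ht : y < t)
  rw [Real.norm_of_nonneg (mul_nonneg (Real.rpow_nonneg (by linarith) _) (Real.exp_pos _).le),
    neg_mul]
  exact mul_le_mul_of_nonneg_right (Real.rpow_le_rpow_of_nonpos hy (by linarith) hs)
    (Real.exp_pos _).le

lemma integral_rpow_mul_exp {a y z : ℝ} (ha : 0 < a) (hyz : 0 ≤ y + z) :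
    ∫ t in Set.Ioi y, (t + z) ^ (-(1 / 2) : ℝ) * Real.exp (-(Real.pi * a * t)) =
      Real.exp (Real.pi * a * z) * a ^ (-(1 / 2) : ℝ) * beta (a * (y + z)) := by
  have hshift : ∫ t in Set.Ioi y, (a * (t + z)) ^ (-(1 / 2) : ℝ) *
      Real.exp (-Real.pi * (a * (t + z))) = a⁻¹ * beta (a * (y + z)) := by
    rw [beta, ← smul_eq_mul, ← integral_comp_mul_left_Ioi _ _ ha]
    simpa only [Set.preimage_add_const_Ioi, add_sub_cancel_right] using
      (measurePreserving_add_right volume z).setIntegral_preimage_emb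
        (measurableEmbedding_addRight z)
        (fun u => (a * u) ^ (-(1 / 2) : ℝ) * Real.exp (-Real.pi * (a * u))) (Set.Ioi (y + z))
  have hpow : a ^ (-(1 / 2) : ℝ) = a ^ (1 / 2 : ℝ) * a⁻¹ := by
    rw [← Real.rpow_neg_one a, ← Real.rpow_add ha]
    norm_num
  rw [hpow, mul_assoc, mul_assoc (a ^ _), ← hshift, ← mul_assoc, ← integral_const_mul]
  refine setIntegral_congr_fun measurableSet_Ioi fun t (ht : y < t) => ?_
  have hcancel : a ^ (1 / 2 : ℝ) * a ^ (-(1 / 2) : ℝ) = 1 := by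
    rw [← Real.rpow_add ha, add_neg_cancel, Real.rpow_zero]
  have hexp : Real.exp (-(Real.pi * a * t)) =
      Real.exp (Real.pi * a * z) * Real.exp (-Real.pi * (a * (t + z))) := by
    rw [← Real.exp_add]
    ring_nf
  simp only [hexp, Real.mul_rpow ha.le (by linarith : 0 ≤ t + z)]
  linear_combination (-(t + z) ^ (-(1 / 2) : ℝ) * (Real.exp (Real.pi * a * z) *
    Real.exp (-Real.pi * (a * (t + z))))) * hcancel

lemma rpow_neg_half_sq (x : ℝ) : (x ^ 2) ^ (-(1 / 2) : ℝ) = |x|⁻¹ := by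
  rw [Real.rpow_neg (sq_nonneg x), ← Real.sqrt_eq_rpow, Real.sqrt_sq_eq_abs]

lemma sign_eq_mul_abs_inv (x : ℝ) : Real.sign x = x * |x|⁻¹ := by
  rcases lt_trichotomy x 0 with hx | rfl | hx
  · rw [Real.sign_of_neg hx, abs_of_neg hx, inv_neg, mul_neg, mul_inv_cancel₀ hx.ne]
  · simp
  · rw [Real.sign_of_pos hx, abs_of_pos hx, mul_inv_cancel₀ hx.ne']

lemma add_half_sq_pos (n : ℤ) : (0 : ℝ) < (n + 1 / 2) ^ 2 :=
  (by norm_num : (0 : ℝ) < 1 / 4).trans_le (quarter_le_sq_add_half n)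

/-- The `n`-th term of the series obtained by integrating the Eichler integral of `gTheta` term by
term. -/
def eichlerTerm (τ : ℍ) (n : ℤ) : ℂ :=
  ((Real.sign (n + 1 / 2) * beta (2 * (n + 1 / 2) ^ 2 * τ.im) : ℝ) : ℂ) *
    cexp (-Real.pi * I * (n + 1 / 2) - Real.pi * I * (n + 1 / 2) ^ 2 * τ)

/-- The contribution of the `n`-th term of `gTheta` to the integrand of its Eichler integral. -/
def eichlerIntegrand (τ : ℍ) (n : ℤ) (t : ℝ) : ℂ :=
  (((n + 1 / 2 : ℝ) : ℂ) *
      cexp (((-Real.pi * (n + 1 / 2) - Real.pi * (n + 1 / 2) ^ 2 * τ.re : ℝ) : ℂ) * I)) *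
    (((t + τ.im) ^ (-(1 / 2) : ℝ) * Real.exp (-(Real.pi * (n + 1 / 2) ^ 2 * t)) : ℝ) : ℂ)

lemma integrableOn_eichlerIntegrand (τ : ℍ) (n : ℤ) :
    IntegrableOn (eichlerIntegrand τ n) (Set.Ioi τ.im) :=
  (integrableOn_rpow_mul_exp (by norm_num) (mul_pos Real.pi_pos (add_half_sq_pos n))
    τ.im_pos).ofReal.const_mul _

lemma norm_eichlerIntegrand (τ : ℍ) (n : ℤ) {t : ℝ} (ht : -τ.im ≤ t) :
    ‖eichlerIntegrand τ n t‖ = |(n + 1 / 2 : ℝ)| *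
      ((t + τ.im) ^ (-(1 / 2) : ℝ) * Real.exp (-(Real.pi * (n + 1 / 2) ^ 2 * t))) := by
  rw [eichlerIntegrand, norm_mul, norm_mul, Complex.norm_exp_ofReal_mul_I, mul_one, norm_real,
    norm_real, Real.norm_eq_abs, Real.norm_of_nonneg
      (mul_nonneg (Real.rpow_nonneg (by linarith) _) (Real.exp_pos _).le)]

lemma integral_eichlerIntegrand (τ : ℍ) (n : ℤ) :
    ∫ t in Set.Ioi τ.im, eichlerIntegrand τ n t = eichlerTerm τ n := by
  have hphase : cexp (-Real.pi * I * (n + 1 / 2) - Real.pi * I * (n + 1 / 2) ^ 2 * τ) =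
      cexp (((-Real.pi * (n + 1 / 2) - Real.pi * (n + 1 / 2) ^ 2 * τ.re : ℝ) : ℂ) * I) *
        cexp (Real.pi * (n + 1 / 2) ^ 2 * τ.im) := by
    have hτ : (τ : ℂ) = τ.re + τ.im * I := (Complex.re_add_im (τ : ℂ)).symm
    rw [← Complex.exp_add, hτ]
    congr 1
    push_cast
    linear_combination (-Real.pi * (n + 1 / 2) ^ 2 * τ.im : ℂ) * I_sq
  simp only [eichlerIntegrand]
  rw [integral_const_mul, integral_complex_ofReal, integral_rpow_mul_exp (add_half_sq_pos n)
    (add_pos τ.im_pos τ.im_pos).le, ← two_mul, mul_left_comm _ (2 : ℝ), ← mul_assoc (2 : ℝ),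
    rpow_neg_half_sq, eichlerTerm, hphase, sign_eq_mul_abs_inv]
  push_cast
  ring

lemma integral_norm_eichlerIntegrand_le (τ : ℍ) (n : ℤ) :
    ∫ t in Set.Ioi τ.im, ‖eichlerIntegrand τ n t‖ ≤
      Real.exp (-(Real.pi * τ.im) * (n + 1 / 2) ^ 2) := by
  have hν := add_half_sq_pos n
  have hν₀ : |(n + 1 / 2 : ℝ)| ≠ 0 := abs_ne_zero.mpr (sq_pos_iff.mp hν)
  have h2y := add_pos τ.im_pos τ.im_pos
  calc ∫ t in Set.Ioi τ.im, ‖eichlerIntegrand τ n t‖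
      = Real.exp (Real.pi * (n + 1 / 2) ^ 2 * τ.im) *
          beta ((n + 1 / 2) ^ 2 * (τ.im + τ.im)) := by
        rw [setIntegral_congr_fun measurableSet_Ioi fun t (ht : τ.im < t) =>
          norm_eichlerIntegrand τ n (by linarith), integral_const_mul,
          integral_rpow_mul_exp hν h2y.le, rpow_neg_half_sq, mul_comm (Real.exp _), mul_assoc,
          mul_inv_cancel_left₀ hν₀]
    _ ≤ Real.exp (Real.pi * (n + 1 / 2) ^ 2 * τ.im) *
          Real.exp (-Real.pi * ((n + 1 / 2) ^ 2 * (τ.im + τ.im))) := by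
        gcongr
        exact beta_le (mul_pos hν h2y).le
    _ = Real.exp (-(Real.pi * τ.im) * (n + 1 / 2) ^ 2) := by
        rw [← Real.exp_add]
        ring_nf

lemma norm_eichlerTerm_le (τ : ℍ) (n : ℤ) :
    ‖eichlerTerm τ n‖ ≤ Real.exp (-(Real.pi * τ.im) * (n + 1 / 2) ^ 2) := by
  rw [← integral_eichlerIntegrand]
  exact (norm_integral_le_integral_norm _).trans (integral_norm_eichlerIntegrand_le τ n)

lemma summable_eichlerTerm (τ : ℍ) : Summable (eichlerTerm τ) :=
  (summable_gaussian_int (mul_pos Real.pi_pos τ.im_pos) (1 / 2)).of_norm_bounded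
    (norm_eichlerTerm_le τ)

lemma mul_conj_gTheta_term (τ : ℍ) (n : ℤ) (t : ℝ) :
    (((t + τ.im) ^ (-(1 / 2) : ℝ) : ℝ) : ℂ) *
      (starRingEnd ℂ) (thetaTerm 0 1 (1 / 2) (1 / 2) (τ.re + I * t) n) =
        eichlerIntegrand τ n t := by
  have hconj : (starRingEnd ℂ) (thetaTerm 0 1 (1 / 2) (1 / 2) (τ.re + I * t) n) =
      ((n + 1 / 2 : ℝ) : ℂ) *
        (cexp (((-Real.pi * (n + 1 / 2) - Real.pi * (n + 1 / 2) ^ 2 * τ.re : ℝ) : ℂ) * I) *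
          cexp (-(Real.pi * (n + 1 / 2) ^ 2 * t))) := by
    rw [thetaTerm, map_mul, ← Complex.exp_conj, ← Complex.exp_add]
    congr 1
    · simp [map_ofNat]
    · congr 1
      simp only [map_add, map_mul, map_pow, map_div₀, map_one, map_ofNat, map_intCast, conj_ofReal,
        conj_I]
      push_cast
      linear_combination (Real.pi * (n + 1 / 2) ^ 2 * t : ℂ) * I_sq
  rw [hconj, eichlerIntegrand]
  push_cast
  ring

lemma eichlerIntegral_gTheta (τ : ℍ) :
    eichlerIntegral (1 / 2) gTheta τ = ∑' n, eichlerTerm τ n := by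
  have hsum : Summable fun n : ℤ => ∫ t in Set.Ioi τ.im, ‖eichlerIntegrand τ n t‖ :=
    (summable_gaussian_int (mul_pos Real.pi_pos τ.im_pos) (1 / 2)).of_nonneg_of_le
      (fun n => integral_nonneg fun t => norm_nonneg _) (integral_norm_eichlerIntegrand_le τ)
  have hint := hasSum_integral_of_summable_integral_norm (integrableOn_eichlerIntegrand τ) hsum
  simp_rw [integral_eichlerIntegrand] at hint
  rw [hint.tsum_eq, eichlerIntegral]
  refine setIntegral_congr_fun measurableSet_Ioi fun t (ht : τ.im < t) => ?_
  have him : 0 < ((τ.re : ℂ) + I * t).im := by simpa using τ.im_pos.trans ht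
  simp only [UpperHalfPlane.ofComplex_apply_of_im_pos him, gTheta, Complex.conj_tsum,
    ← tsum_mul_left]
  exact tsum_congr fun n => mul_conj_gTheta_term τ n t

/-! ### The non-holomorphic part of `ϑ^ℓ` -/

lemma betaTerm_c₁_mul_qTerm (l : ℤ) (τ : ℍ) (m k : ℤ) :
    (betaTerm A₀ c₁ (cosetPoint l (m, k - m + l)) τ : ℂ) *
      qTerm A₀ b₀ (cosetPoint l (m, k - m + l)) τ =
        -(-1) ^ l * (eichlerTerm τ m * thetaTerm 1 0 ((1 + l) / 2) 0 (2 * τ) k) := by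
  have hphase : cexp (2 * Real.pi * I * ((m + 1 / 2) / 2 + (k - m + l + -(l / 2))) +
      2 * Real.pi * I * ((m + 1 / 2) ^ 2 / 2 + 2 * (m + 1 / 2) * (k - m + l + -(l / 2)) +
        (k - m + l + -(l / 2)) ^ 2) * τ) =
      -(cexp (Real.pi * I * l) *
        cexp (-Real.pi * I * (m + 1 / 2) - Real.pi * I * (m + 1 / 2) ^ 2 * τ) *
        cexp (Real.pi * I * (2 * τ) * (k + (1 + l) / 2) ^ 2 +
          2 * Real.pi * I * (k + (1 + l) / 2) * 0)) := by
    rw [← Complex.exp_add, ← Complex.exp_add, neg_exp]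
    refine cexp_eq_cexp_of_sub_int k ?_
    ring
  rw [betaTerm_c₁, qTerm_eq, eichlerTerm, thetaTerm, ← cexp_int_mul_pi]
  simp only [cosetPoint, Matrix.cons_val_zero, Matrix.cons_val_one]
  push_cast
  rw [hphase]
  ring

lemma tsum_betaTerm_c₁ (l : ℤ) (τ : ℍ) :
    ∑' p : ℤ × ℤ, (betaTerm A₀ c₁ (cosetPoint l p) τ : ℂ) * qTerm A₀ b₀ (cosetPoint l p) τ =
      -(-1) ^ l * (fTheta l τ * eichlerIntegral (1 / 2) gTheta τ) := by
  let shear : ℤ × ℤ ≃ ℤ × ℤ :=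
    { toFun := fun p => (p.1, p.2 - p.1 + l)
      invFun := fun p => (p.1, p.2 + p.1 - l)
      left_inv := fun p => Prod.ext rfl (by ring)
      right_inv := fun p => Prod.ext rfl (by ring) }
  rw [← shear.tsum_eq, eichlerIntegral_gTheta, mul_comm (fTheta l τ), fTheta,
    tsum_mul_tsum_of_summable_norm (summable_eichlerTerm τ).norm
      (summable_thetaTerm (two_mul_im_pos τ) 1 0 ((1 + l) / 2) 0).norm, ← tsum_mul_left]
  exact tsum_congr fun p => betaTerm_c₁_mul_qTerm l τ p.1 p.2

lemma tsum_betaTerm_c₂ (l : ℤ) (τ : ℍ) :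
    ∑' p : ℤ × ℤ, (betaTerm A₀ c₂ (cosetPoint l p) τ : ℂ) * qTerm A₀ b₀ (cosetPoint l p) τ = 0 := by
  have hsum := summable_betaTerm_c₂ l τ
  simp only [betaTerm_c₂, cosetPoint, Matrix.cons_val_one] at hsum ⊢
  exact tsum_snd_mul_qTerm (fun n => ((-(Real.sign (n + -(l / 2)) *
    beta (4 * (n + -(l / 2)) ^ 2 * τ.im)) : ℝ) : ℂ)) hsum

lemma vartheta_eq_sub_add (l : ℤ) (τ : ℍ) : vartheta l τ = 2 * I * S l τ -
    (∑' p : ℤ × ℤ, (betaTerm A₀ c₁ (cosetPoint l p) τ : ℂ) * qTerm A₀ b₀ (cosetPoint l p) τ) +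
    ∑' p : ℤ × ℤ, (betaTerm A₀ c₂ (cosetPoint l p) τ : ℂ) * qTerm A₀ b₀ (cosetPoint l p) τ := by
  rw [vartheta_eq_tsum]
  refine HasSum.tsum_eq ((((hasSum_sgnTerm l τ).sub (summable_betaTerm_c₁ l τ).hasSum).add
    (summable_betaTerm_c₂ l τ).hasSum).congr_fun fun p => ?_)
  rw [rho_eq_sgnCoeff]
  push_cast
  ring

theorem vartheta_eq_add_eichlerIntegral (l : ℤ) (τ : ℍ) : vartheta l τ =
    2 * I * S l τ + (-1) ^ l * (fTheta l τ * eichlerIntegral (1 / 2) gTheta τ) := by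
  rw [vartheta_eq_sub_add, tsum_betaTerm_c₁, tsum_betaTerm_c₂]
  ring

/-! ### `S_ℓ` as holomorphic part -/

lemma two_mul_I_ne_zero : (2 * I : ℂ) ≠ 0 := mul_ne_zero two_ne_zero I_ne_zero

/-- The coefficients of the series of `2i S_ℓ` in powers of `q`. -/
def sgnPhase (l : ℤ) (p : ℤ × ℤ) : ℂ :=
  sgnCoeff (cosetPoint l p) * cexp (2 * Real.pi * I * bilin A₀ (cosetPoint l p) b₀)

lemma hasSum_sgnPhase_mul (l : ℤ) (τ : ℍ) : HasSum (fun p : ℤ × ℤ =>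
    sgnPhase l p * cexp (2 * Real.pi * I * quad A₀ (cosetPoint l p) * τ)) (2 * I * S l τ) := by
  refine (hasSum_sgnTerm l τ).congr_fun fun p => ?_
  rw [qTerm, Complex.exp_add, sgnPhase]
  ring

lemma S_eq_qSeries (l : ℤ) :
    S l = fun τ => (2 * I)⁻¹ * qSeries (sgnPhase l) (fun p => quad A₀ (cosetPoint l p)) τ := by
  funext τ
  rw [qSeries, (hasSum_sgnPhase_mul l τ).tsum_eq, inv_mul_cancel_left₀ two_mul_I_ne_zero]

lemma quad_nonneg_of_sgnPhase_ne_zero {l : ℤ} {p : ℤ × ℤ} (hp : sgnPhase l p ≠ 0) :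
    0 ≤ quad A₀ (cosetPoint l p) := by
  have hprod := mul_nonneg_of_sgnCoeff_ne_zero (ofReal_ne_zero.mp (left_ne_zero_of_mul hp))
  rw [quad_A₀]
  nlinarith [sq_nonneg (cosetPoint l p 0), sq_nonneg (cosetPoint l p 1)]

lemma mdifferentiable_S (l : ℤ) : MDifferentiable 𝓘(ℂ) 𝓘(ℂ) (S l) := by
  rw [S_eq_qSeries]
  exact mdifferentiable_const.mul (mdifferentiable_qSeries
    (fun _ => quad_nonneg_of_sgnPhase_ne_zero) (fun τ => (hasSum_sgnPhase_mul l τ).summable) le_rfl)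

lemma isBoundedAtImInfty_S (l : ℤ) : UpperHalfPlane.IsBoundedAtImInfty (S l) := by
  rw [S_eq_qSeries]
  exact (isBoundedAtImInfty_qSeries (fun _ => quad_nonneg_of_sgnPhase_ne_zero)
    (fun τ => (hasSum_sgnPhase_mul l τ).summable) le_rfl).const_mul_left _

/-- The completion `ϑ^ℓ / 2i` of `S_ℓ`. -/
def completion (l : ℤ) (τ : ℍ) : ℂ := vartheta l τ / (2 * I)

lemma completion_eq_add_eichlerIntegral (l : ℤ) (τ : ℍ) : completion l τ =
    S l τ + (-1) ^ l / (2 * I) * fTheta l τ * eichlerIntegral (1 / 2) gTheta τ := by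
  rw [completion, vartheta_eq_add_eichlerIntegral, add_div,
    mul_div_cancel_left₀ _ two_mul_I_ne_zero]
  ring

theorem isHolomorphicPart_S (i : Fin 2) :
    IsHolomorphicPart (CongruenceSubgroup.Gamma0 4) 1 (S (i : ℕ)) (completion (i : ℕ)) := by
  have hf : 1 - (1 : ℝ) / 2 = 1 / 2 := by norm_num
  have hg : 2 - (1 / 2 : ℝ) = 3 / 2 := by norm_num
  refine ⟨mdifferentiable_S _, isBoundedAtImInfty_S _, 1, fun _ => 1,
    fun _ τ => ((-1) ^ ((i : ℕ) : ℤ) / (2 * I)) * fTheta (i : ℕ) τ, fun _ => gTheta,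
    fun _ => ?_, fun _ => ?_, fun τ => ?_⟩
  · simpa only [Int.cast_one] using
      (isModularForm_fTheta i).const_mul ((-1) ^ ((i : ℕ) : ℤ) / (2 * I))
  · simpa only [Int.cast_one, hf, hg] using isCuspForm_gTheta _
  · simpa only [Int.cast_one, hf, Finset.univ_unique, Finset.sum_singleton] using
      completion_eq_add_eichlerIntegral i τ

/-! ### Growth of the completions -/

lemma isBoundedAtImInfty_eichlerIntegral_gTheta :
    UpperHalfPlane.IsBoundedAtImInfty (eichlerIntegral (1 / 2) gTheta) := by
  refine UpperHalfPlane.isBoundedAtImInfty_iff.mpr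
    ⟨∑' n : ℤ, Real.exp (-Real.pi * (n + 1 / 2) ^ 2), 1, fun τ hτ => ?_⟩
  rw [eichlerIntegral_gTheta]
  refine tsum_of_norm_bounded (summable_gaussian_int Real.pi_pos (1 / 2)).hasSum fun n =>
    (norm_eichlerTerm_le τ n).trans ?_
  gcongr
  exact le_mul_of_one_le_right Real.pi_pos.le hτ

lemma isBoundedAtImInfty_completion (l : ℤ) :
    UpperHalfPlane.IsBoundedAtImInfty (completion l) := by
  rw [funext (completion_eq_add_eichlerIntegral l)]
  refine (isBoundedAtImInfty_S l).add ?_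
  exact Filter.BoundedAtFilter.mul ((isBoundedAtImInfty_fTheta l).const_mul_left _)
    isBoundedAtImInfty_eichlerIntegral_gTheta

lemma quad_cosetPoint_zero {p : ℤ × ℤ} (hp : p ∈ ({(0, 0), (-1, 0)} : Finset (ℤ × ℤ))) :
    quad A₀ (cosetPoint 0 p) = 1 / 8 := by
  rcases Finset.mem_insert.mp hp with rfl | hp
  · norm_num [quad_A₀, cosetPoint]
  · norm_num [Finset.mem_singleton.mp hp, quad_A₀, cosetPoint]

lemma quarter_le_quad_of_sgnPhase_ne_zero {p : ℤ × ℤ}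
    (hp : p ∉ ({(0, 0), (-1, 0)} : Finset (ℤ × ℤ))) (hphase : sgnPhase 0 p ≠ 0) :
    1 / 4 ≤ quad A₀ (cosetPoint 0 p) := by
  obtain ⟨m, n⟩ := p
  have hcross := mul_nonneg_of_sgnCoeff_ne_zero (ofReal_ne_zero.mp (left_ne_zero_of_mul hphase))
  rw [quad_A₀]
  simp only [cosetPoint, Matrix.cons_val_zero, Matrix.cons_val_one, Int.cast_zero, zero_div,
    neg_zero, add_zero] at hcross ⊢
  by_cases hn : n = 0
  · subst hn
    simp only [Finset.mem_insert, Prod.mk.injEq, and_true, Finset.mem_singleton, not_or] at hp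
    have hm : 2 ≤ m * (m + 1) := by
      rcases (by lia : 1 ≤ m ∨ m ≤ -2) with hm | hm <;> nlinarith
    have hm' : (2 : ℝ) ≤ m * (m + 1) := by exact_mod_cast hm
    push_cast
    linarith
  · have hn' : (1 : ℝ) ≤ (n : ℝ) ^ 2 := by
      exact_mod_cast Int.add_one_le_of_lt (sq_pos_of_ne_zero hn)
    linarith [sq_nonneg ((m : ℝ) + 1 / 2)]

lemma sgnPhase_zero : sgnPhase 0 (0, 0) = I := by
  have hsgn : sgnCoeff ![1 / 2, 0] = 1 := by
    simp [sgnCoeff_eq, Real.sign_of_pos]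
  have hpoint : cosetPoint 0 (0, 0) = ![1 / 2, 0] := by simp [cosetPoint]
  rw [sgnPhase, hpoint, hsgn, bilin_b₀, ofReal_one, one_mul]
  refine Eq.trans (congrArg cexp ?_) Complex.exp_pi_div_two_mul_I
  simp only [Matrix.cons_val_zero, Matrix.cons_val_one]
  push_cast
  ring

lemma sgnPhase_neg_one : sgnPhase 0 (-1, 0) = I := by
  have hsgn : sgnCoeff ![-(1 / 2), 0] = -1 := by
    simp [sgnCoeff_eq, Real.sign_of_neg]
  have hpoint : cosetPoint 0 (-1, 0) = ![-(1 / 2), 0] := by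
    norm_num [cosetPoint]
  rw [sgnPhase, hpoint, hsgn, bilin_b₀, ofReal_neg, ofReal_one, neg_one_mul, neg_exp]
  refine Eq.trans (congrArg cexp ?_) Complex.exp_pi_div_two_mul_I
  simp only [Matrix.cons_val_zero, Matrix.cons_val_one]
  push_cast
  ring

-- `2i S₀ = 2i q^{1/8} + O(q^{1/4})` and `f₀ = O(q^{1/4})`.
lemma tendsto_completion_zero_mul_cexp :
    Tendsto (fun τ : ℍ => completion 0 τ * cexp (-(2 * Real.pi * I * (1 / 8 : ℝ) * τ)))
      UpperHalfPlane.atImInfty (𝓝 1) := by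
  have hS := (tendsto_qSeries_mul_cexp (fun τ => (hasSum_sgnPhase_mul 0 τ).summable)
    (fun _ => quad_cosetPoint_zero) (fun _ => quarter_le_quad_of_sgnPhase_ne_zero)
    (by norm_num)).const_mul (2 * I)⁻¹
  rw [Finset.sum_pair (by decide), sgnPhase_zero, sgnPhase_neg_one, ← two_mul,
    inv_mul_cancel₀ two_mul_I_ne_zero] at hS
  have hf := tendsto_qSeries_mul_cexp (a := 1 / 8) (s := ∅) (summable_fTheta 0) (by simp)
    (fun n _ _ => by simpa using quarter_le_sq_add_half n) (by norm_num)
  have hfE := hf.zero_mul_isBoundedUnder_le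
    ((Asymptotics.isBigO_one_iff ℝ).mp isBoundedAtImInfty_eichlerIntegral_gTheta)
  have hsum := hS.add (hfE.const_mul (2 * I)⁻¹)
  rw [mul_zero, add_zero] at hsum
  refine hsum.congr fun τ => ?_
  rw [completion_eq_add_eichlerIntegral, S_eq_qSeries, fTheta_eq_qSeries]
  ring_nf

lemma exists_completion_zero_ne_zero : ∃ τ : ℍ, completion 0 τ ≠ 0 := by
  obtain ⟨τ, hτ⟩ := (tendsto_completion_zero_mul_cexp.eventually_ne one_ne_zero).exists
  exact ⟨τ, left_ne_zero_of_mul hτ⟩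

/-! ### The representation -/

lemma completion_S_smul (l : ℤ) (τ : ℍ) : completion l (ModularGroup.S • τ) =
    τ * (-I / Real.sqrt 2 * (completion 0 τ + (-1) ^ l * completion 1 τ)) := by
  have hinv := vartheta_inversion l (ModularGroup.S • τ)
  rw [S_smul_S_smul, coe_S_smul] at hinv
  have hτ : (τ : ℂ) ≠ 0 := τ.ne_zero
  have hsqrt := ofReal_sqrt_two_ne_zero
  rw [completion, completion, completion, hinv]
  field_simp

lemma im_T_smul (τ : ℍ) : (ModularGroup.T • τ : ℍ).im = τ.im := by
  rw [← UpperHalfPlane.coe_im, coe_T_smul, add_im, one_im, add_zero, UpperHalfPlane.coe_im]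

lemma completion_T_smul (l : ℤ) (τ : ℍ) : completion l (ModularGroup.T • τ) =
    cexp (2 * Real.pi * I * (1 / 8 - l / 2 + l ^ 2 / 4)) * completion l τ := by
  rw [completion, completion, mul_div_assoc', vartheta_eq_tsum, vartheta_eq_tsum, ← tsum_mul_left]
  refine congrArg (· / (2 * I)) (tsum_congr fun p => ?_)
  have hrho : rho A₀ c₁ c₂ (cosetPoint l p) (ModularGroup.T • τ) =
      rho A₀ c₁ c₂ (cosetPoint l p) τ := by
    rw [rho, rho, im_T_smul]
  rw [hrho, mul_left_comm, qTerm_eq, qTerm_eq, coe_T_smul, ← Complex.exp_add]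
  congr 1
  obtain ⟨k, hk⟩ := Int.even_mul_succ_self p.1
  have hk' : (p.1 : ℂ) * (p.1 + 1) = k + k := by exact_mod_cast hk
  refine cexp_eq_cexp_of_sub_int (k + 2 * p.1 * p.2 - p.1 * l + p.2 + p.2 ^ 2 - p.2 * l) ?_
  simp only [cosetPoint, Matrix.cons_val_zero, Matrix.cons_val_one]
  push_cast
  linear_combination (Real.pi * I) * hk'

lemma completion_zero_T_smul (τ : ℍ) :
    completion 0 (ModularGroup.T • τ) = cexp (Real.pi * I / 4) * completion 0 τ := by
  rw [completion_T_smul]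
  push_cast
  ring_nf

lemma completion_one_T_smul (τ : ℍ) :
    completion 1 (ModularGroup.T • τ) = cexp (-(Real.pi * I / 4)) * completion 1 τ := by
  rw [completion_T_smul]
  push_cast
  ring_nf

/-- The vector of the two completions `ϑ^ℓ / 2i`, whose transformation law defines `rep`. -/
def completionVec (τ : ℍ) : Fin 2 → ℂ := fun i => completion (i : ℕ) τ

/-- The matrix by which `S` acts on the vector of completions. -/
def repS : Matrix (Fin 2) (Fin 2) ℂ := (-I / (Real.sqrt 2 : ℂ)) • !![1, 1; 1, -1]

/-- The matrix by which `T` acts on the vector of completions. -/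
def repT : Matrix (Fin 2) (Fin 2) ℂ :=
  !![cexp (Real.pi * I / 4), 0; 0, cexp (-(Real.pi * I / 4))]

lemma vecTransforms_completionVec_S : VecTransforms 1 completionVec ModularGroup.S repS := by
  intro τ
  have h₀ := completion_S_smul 0 τ
  have h₁ := completion_S_smul 1 τ
  rw [_root_.zpow_zero, one_mul] at h₀
  rw [_root_.zpow_one] at h₁
  rw [autFactor_S, ofReal_one, cpow_one, repS, smul_mulVec]
  ext i
  fin_cases i
  · simpa [completionVec, vecHead, vecTail, -ModularGroup.sl_moeb] using h₀
  · simpa [completionVec, vecHead, vecTail, -ModularGroup.sl_moeb] using h₁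

lemma vecTransforms_completionVec_T : VecTransforms 1 completionVec ModularGroup.T repT := by
  intro τ
  rw [autFactor_T, one_cpow, one_smul, repT]
  ext i
  fin_cases i
  · simpa [completionVec, vecHead, vecTail, -ModularGroup.sl_moeb] using completion_zero_T_smul τ
  · simpa [completionVec, vecHead, vecTail, -ModularGroup.sl_moeb] using completion_one_T_smul τ

lemma repS_mul_self : repS * repS = -1 := by
  have hsq : (!![1, 1; 1, -1] : Matrix (Fin 2) (Fin 2) ℂ) * !![1, 1; 1, -1] = (2 : ℂ) • 1 := by
    ext i j
    fin_cases i <;> fin_cases j <;> norm_num [Matrix.mul_apply, Fin.sum_univ_two]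
  rw [repS, smul_mul_smul_comm, hsq, smul_smul, ← sq, div_pow, ofReal_sqrt_two_sq,
    div_mul_cancel₀ _ two_ne_zero, neg_sq, I_sq, neg_one_smul]

lemma repT_eq_diagonal : repT =
    Matrix.diagonal ![cexp (Real.pi * I / 4), cexp (-(Real.pi * I / 4))] := by
  ext i j
  fin_cases i <;> fin_cases j <;> simp [repT]

lemma cexp_pi_div_four_pow_four : cexp (Real.pi * I / 4) ^ 4 = -1 := by
  rw [← Complex.exp_nat_mul, ← exp_pi_mul_I]
  push_cast
  ring_nf

lemma repT_pow_four : repT ^ 4 = -1 := by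
  rw [repT_eq_diagonal, Matrix.diagonal_pow]
  ext i j
  fin_cases i <;> fin_cases j <;> simp [cexp_pi_div_four_pow_four, Complex.exp_neg, inv_neg]

lemma exists_vecTransforms_completionVec (γ : SL(2, ℤ)) :
    ∃ M, VecTransforms 1 completionVec γ M := by
  refine exists_vecTransforms (N_S := -repS) (N_T := -repT ^ 3) vecTransforms_completionVec_S ?_
    vecTransforms_completionVec_T ?_ γ
  · rw [neg_mul, repS_mul_self, neg_neg]
  · rw [neg_mul, ← pow_succ, repT_pow_four, neg_neg]

lemma cexp_pi_div_four_ne_cexp_neg : cexp (Real.pi * I / 4) ≠ cexp (-(Real.pi * I / 4)) := by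
  intro heq
  have hsq : cexp (Real.pi * I / 4) ^ 2 = 1 := by
    rw [sq]
    nth_rw 2 [heq]
    rw [← Complex.exp_add, add_neg_cancel, Complex.exp_zero]
  have hpow := cexp_pi_div_four_pow_four
  rw [show 4 = 2 * 2 from rfl, pow_mul, hsq] at hpow
  norm_num at hpow

-- The two completions belong to different eigenvalues of `T`, and `S` maps the second one to a
-- combination in which the first one occurs.
lemma eq_zero_of_completion_combination {a b : ℂ}
    (h : ∀ τ, a * completion 0 τ + b * completion 1 τ = 0) : a = 0 ∧ b = 0 := by
  have hω := sub_ne_zero.mpr cexp_pi_div_four_ne_cexp_neg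
  have hT (τ : ℍ) := h (ModularGroup.T • τ)
  simp only [completion_zero_T_smul, completion_one_T_smul] at hT
  have h₀ (τ : ℍ) : a * completion 0 τ = 0 := by
    refine (mul_eq_zero.mp ?_).resolve_left hω
    linear_combination hT τ - cexp (-(Real.pi * I / 4)) * h τ
  have h₁ (τ : ℍ) : b * completion 1 τ = 0 := by
    simpa only [h₀, zero_add] using h τ
  obtain ⟨τ, hτ⟩ := exists_completion_zero_ne_zero
  refine ⟨(mul_eq_zero.mp (h₀ τ)).resolve_right hτ, ?_⟩
  by_contra hb
  have hzero (τ : ℍ) : completion 1 τ = 0 := (mul_eq_zero.mp (h₁ τ)).resolve_left hb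
  have hS := completion_S_smul 1 τ
  rw [hzero, hzero, mul_zero, add_zero] at hS
  exact mul_ne_zero τ.ne_zero
    (mul_ne_zero (div_ne_zero (neg_ne_zero.mpr I_ne_zero) ofReal_sqrt_two_ne_zero) hτ) hS.symm

lemma eq_of_mulVec_completionVec {M N : Matrix (Fin 2) (Fin 2) ℂ}
    (h : ∀ τ, M *ᵥ completionVec τ = N *ᵥ completionVec τ) : M = N := by
  have hrow (i : Fin 2) : M i 0 - N i 0 = 0 ∧ M i 1 - N i 1 = 0 := by
    refine eq_zero_of_completion_combination fun τ => ?_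
    have hi := congrFun (h τ) i
    simp only [Matrix.mulVec, dotProduct, Fin.sum_univ_two, completionVec, Fin.val_zero,
      Fin.val_one, Nat.cast_zero, Nat.cast_one] at hi
    linear_combination hi
  ext i j
  fin_cases j
  · exact sub_eq_zero.mp (hrow i).1
  · exact sub_eq_zero.mp (hrow i).2

lemma VecTransforms.matrix_eq {γ : SL(2, ℤ)} {M N : Matrix (Fin 2) (Fin 2) ℂ}
    (hM : VecTransforms 1 completionVec γ M) (hN : VecTransforms 1 completionVec γ N) : M = N := by
  refine eq_of_mulVec_completionVec fun τ => ?_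
  have hγ := (hM τ).symm.trans (hN τ)
  rw [ofReal_one, cpow_one] at hγ
  exact smul_right_injective _ (autFactor_ne_zero γ τ) hγ

/-- The representation of `SL₂(ℤ)` by which the vector of completions transforms in weight `1`; it
is multiplicative because the completions are linearly independent. -/
def rep : SL(2, ℤ) →* Matrix (Fin 2) (Fin 2) ℂ where
  toFun γ := (exists_vecTransforms_completionVec γ).choose
  map_one' := (exists_vecTransforms_completionVec 1).choose_spec.matrix_eq fun τ => by simp
  map_mul' γ₁ γ₂ := (exists_vecTransforms_completionVec (γ₁ * γ₂)).choose_spec.matrix_eq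
    fun τ => by
      rw [mul_smul, (exists_vecTransforms_completionVec γ₁).choose_spec,
        (exists_vecTransforms_completionVec γ₂).choose_spec, Matrix.mulVec_smul,
        Matrix.mulVec_mulVec, smul_smul, ofReal_one, cpow_one, cpow_one, cpow_one, autFactor_mul]

lemma vecTransforms_rep (γ : SL(2, ℤ)) : VecTransforms 1 completionVec γ (rep γ) :=
  (exists_vecTransforms_completionVec γ).choose_spec

lemma rep_S : rep ModularGroup.S = repS :=
  (vecTransforms_rep _).matrix_eq vecTransforms_completionVec_S

lemma rep_T : rep ModularGroup.T = repT :=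
  (vecTransforms_rep _).matrix_eq vecTransforms_completionVec_T

lemma completion_smul (γ : SL(2, ℤ)) (τ : ℍ) (i : Fin 2) : completion (i : ℕ) (γ • τ) =
    autFactor γ τ * ∑ j : Fin 2, rep γ i j * completion (j : ℕ) τ := by
  have hi := congrFun (vecTransforms_rep γ τ) i
  rwa [ofReal_one, cpow_one] at hi

lemma isBoundedAtImInfty_slash_completion (γ : SL(2, ℤ)) (i : Fin 2) :
    UpperHalfPlane.IsBoundedAtImInfty
      fun τ => autFactor γ τ ^ (-1 : ℤ) * completion (i : ℕ) (γ • τ) := by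
  have hslash (τ : ℍ) : autFactor γ τ ^ (-1 : ℤ) * completion (i : ℕ) (γ • τ) =
      ∑ j : Fin 2, rep γ i j * completion (j : ℕ) τ := by
    rw [completion_smul, _root_.zpow_neg_one, inv_mul_cancel_left₀ (autFactor_ne_zero γ τ)]
  rw [funext hslash]
  exact Asymptotics.IsBigO.fun_sum fun j _ =>
    (isBoundedAtImInfty_completion (j : ℕ)).const_mul_left _

/-! ### The characters on `Γ₀(4)` -/

/-- The elements of `SL₂(ℤ)` that act on the vector of completions by diagonal unitary matrices. -/
def diagSubgroup : Subgroup SL(2, ℤ) where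
  carrier := {γ | ∃ d : Fin 2 → ℂ, (∀ i, ‖d i‖ = 1) ∧ rep γ = Matrix.diagonal d}
  one_mem' := ⟨1, fun _ => by simp, by simp⟩
  mul_mem' := by
    rintro γ₁ γ₂ ⟨d₁, hd₁, hγ₁⟩ ⟨d₂, hd₂, hγ₂⟩
    exact ⟨fun i => d₁ i * d₂ i, fun i => by rw [norm_mul, hd₁, hd₂, one_mul], by
      rw [map_mul, hγ₁, hγ₂, Matrix.diagonal_mul_diagonal]⟩
  inv_mem' := by
    rintro γ ⟨d, hd, hγ⟩
    refine ⟨fun i => (d i)⁻¹, fun i => by rw [norm_inv, hd, inv_one], ?_⟩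
    have hleft : rep γ⁻¹ * rep γ = 1 := by rw [← map_mul, inv_mul_cancel, map_one]
    refine left_inv_eq_right_inv hleft ?_
    simp [hγ, Matrix.diagonal_mul_diagonal, fun i => ne_zero_of_norm_eq_one (hd i)]

lemma norm_cexp_pi_div_four : ‖cexp (Real.pi * I / 4)‖ = 1 := by
  rw [mul_div_right_comm, ← ofReal_ofNat, ← ofReal_div, norm_exp_ofReal_mul_I]

lemma T_mem_diagSubgroup : ModularGroup.T ∈ diagSubgroup := by
  refine ⟨_, fun i => ?_, rep_T.trans repT_eq_diagonal⟩
  fin_cases i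
  · exact norm_cexp_pi_div_four
  · simp [Complex.exp_neg, norm_cexp_pi_div_four]

lemma mem_diagSubgroup_of_rep_eq_neg_one {γ : SL(2, ℤ)} (hγ : rep γ = -1) : γ ∈ diagSubgroup :=
  ⟨fun _ => -1, fun _ => by simp, by
    rw [hγ, ← Matrix.diagonal_one, ← Matrix.diagonal_neg]⟩

lemma rep_neg_one : rep (-1) = -1 := by
  have hneg : (-1 : SL(2, ℤ)) = ModularGroup.S * ModularGroup.S := by decide
  rw [hneg, map_mul, rep_S, repS_mul_self]

lemma rep_S_mul_T_zpow_four_mul_S_inv :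
    rep (ModularGroup.S * ModularGroup.T ^ (4 : ℤ) * ModularGroup.S⁻¹) = -1 := by
  have hcancel : rep ModularGroup.S * rep ModularGroup.S⁻¹ = 1 := by
    rw [← map_mul, mul_inv_cancel, map_one]
  rw [map_mul, map_mul, zpow_ofNat, map_pow, rep_T, repT_pow_four, mul_neg, mul_one, neg_mul,
    hcancel]

lemma Gamma0_four_le_diagSubgroup : CongruenceSubgroup.Gamma0 4 ≤ diagSubgroup := fun _ =>
  mem_of_mem_Gamma0_four T_mem_diagSubgroup (mem_diagSubgroup_of_rep_eq_neg_one rep_neg_one)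
    (mem_diagSubgroup_of_rep_eq_neg_one rep_S_mul_T_zpow_four_mul_S_inv)

/-- The character `χ_i` of `Γ₀(4)`: the `i`-th diagonal entry of the restriction of `rep`. -/
def repChar (i : Fin 2) : CongruenceSubgroup.Gamma0 4 →* ℂ where
  toFun γ := rep γ i i
  map_one' := by simp
  map_mul' γ₁ γ₂ := by
    obtain ⟨d₁, -, hγ₁⟩ := Gamma0_four_le_diagSubgroup γ₁.2
    obtain ⟨d₂, -, hγ₂⟩ := Gamma0_four_le_diagSubgroup γ₂.2
    rw [Subgroup.coe_mul, map_mul, hγ₁, hγ₂, Matrix.diagonal_mul_diagonal]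
    simp

theorem isMockModularForm_S (i : Fin 2) : IsMockModularForm (CongruenceSubgroup.Gamma0 4) 1
    (repChar i) (S (i : ℕ)) (completion (i : ℕ)) := by
  refine ⟨fun γ => ?_, isHolomorphicPart_S i, fun γ τ => ?_,
    fun γ => isBoundedAtImInfty_slash_completion γ i⟩
  · obtain ⟨d, hd, hγ⟩ := Gamma0_four_le_diagSubgroup γ.2
    change ‖rep γ i i‖ = 1
    rw [hγ, Matrix.diagonal_apply_eq, hd]
  · obtain ⟨d, -, hγ⟩ := Gamma0_four_le_diagSubgroup γ.2
    change _ = rep γ i i * _ * _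
    rw [completion_smul, hγ, Matrix.diagonal_apply_eq, _root_.zpow_one,
      Finset.sum_eq_single_of_mem i (Finset.mem_univ i) fun j _ hj => by
        rw [Matrix.diagonal_apply_ne' _ hj, zero_mul], Matrix.diagonal_apply_eq, mul_left_comm,
      mul_assoc]

theorem isVectorMockModularForm_S : IsVectorMockModularForm 1 rep
    (fun i : Fin 2 => S (i : ℕ)) fun i : Fin 2 => completion (i : ℕ) := by
  refine ⟨⟨CongruenceSubgroup.Gamma0 4, inferInstance, isHolomorphicPart_S⟩, fun γ τ i => ?_,
    fun i => isBoundedAtImInfty_completion _⟩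
  rw [_root_.zpow_one]
  exact completion_smul γ τ i

end MockTheta

end

theorem proposition1p2 :
    -- `S₀`, `S₁` are the theta-decomposition coefficients of `θ₁² μ`
    (∀ (τ : ℍ) (z : ℂ), (∀ m n : ℤ, z ≠ m * (τ : ℂ) + n) →
      theta1 z τ ^ 2 * mu z τ
        = S 0 τ * theta3 (2 * z) (2 * τ) + S 1 τ * theta2 (2 * z) (2 * τ)) ∧
    -- the data of the indefinite theta functions are admissible
    (A₀.IsSymm ∧ A₀.det < 0 ∧ quad A₀ c₁ < 0 ∧ quad A₀ c₂ < 0 ∧ bilin A₀ c₁ c₂ < 0) ∧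
    -- `ϑ^ℓ` converges absolutely, and `2i S_ℓ` is its holomorphic part
    (∀ (l : ℤ) (τ : ℍ),
      Summable (fun n : Fin 2 → ℤ =>
        (rho A₀ c₁ c₂ (shift (a₀ l) n) τ : ℂ) * qTerm A₀ b₀ (shift (a₀ l) n) τ) ∧
      HasSum (fun n : Fin 2 → ℤ =>
        ((Real.sign (bilin A₀ (shift (a₀ l) n) c₁) - Real.sign (bilin A₀ (shift (a₀ l) n) c₂) : ℝ)
          : ℂ) * qTerm A₀ b₀ (shift (a₀ l) n) τ) (2 * Complex.I * S l τ) ∧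
      Summable (fun n : Fin 2 → ℤ =>
        (betaTerm A₀ c₁ (shift (a₀ l) n) τ : ℂ) * qTerm A₀ b₀ (shift (a₀ l) n) τ) ∧
      Summable (fun n : Fin 2 → ℤ =>
        (betaTerm A₀ c₂ (shift (a₀ l) n) τ : ℂ) * qTerm A₀ b₀ (shift (a₀ l) n) τ) ∧
      vartheta l τ = 2 * Complex.I * S l τ
        - (∑' n : Fin 2 → ℤ,
            (betaTerm A₀ c₁ (shift (a₀ l) n) τ : ℂ) * qTerm A₀ b₀ (shift (a₀ l) n) τ)
        + ∑' n : Fin 2 → ℤ,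
            (betaTerm A₀ c₂ (shift (a₀ l) n) τ : ℂ) * qTerm A₀ b₀ (shift (a₀ l) n) τ) ∧
    -- each `S_ℓ` is a mock modular form of weight one on `Γ₀(4)`, completed by `ϑ^ℓ / 2i`
    (∀ l : Fin 2, ∃ χ : CongruenceSubgroup.Gamma0 4 →* ℂ,
      IsMockModularForm (CongruenceSubgroup.Gamma0 4) 1 χ (S (l : ℕ))
        (fun τ => vartheta (l : ℕ) τ / (2 * Complex.I))) ∧
    -- `(S₀, S₁)` is a vector-valued mock modular form of weight one on `SL₂(ℤ)`
    (∃ R : SL(2, ℤ) →* Matrix (Fin 2) (Fin 2) ℂ,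
      R ModularGroup.T = !![Complex.exp (Real.pi * Complex.I / 4), 0;
        0, Complex.exp (-(Real.pi * Complex.I / 4))] ∧
      R ModularGroup.S = (-Complex.I / (Real.sqrt 2 : ℂ)) • !![1, 1; 1, -1] ∧
      IsVectorMockModularForm 1 R (fun l : Fin 2 => S (l : ℕ))
        (fun l : Fin 2 => fun τ => vartheta (l : ℕ) τ / (2 * Complex.I))) := by
  refine ⟨theta_decomposition,
    ⟨isSymm_A₀, by norm_num [det_A₀], by norm_num [quad_c₁], by norm_num [quad_c₂],
      by norm_num [bilin_c₁_c₂]⟩,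
    fun l τ => ?_, fun l => ⟨repChar l, isMockModularForm_S l⟩, rep, rep_T, rep_S,
    isVectorMockModularForm_S⟩
  let hol (ν : Fin 2 → ℝ) : ℂ := sgnCoeff ν * qTerm A₀ b₀ ν τ
  let total (ν : Fin 2 → ℝ) : ℂ := rho A₀ c₁ c₂ ν τ * qTerm A₀ b₀ ν τ
  let nonhol (c ν : Fin 2 → ℝ) : ℂ := betaTerm A₀ c ν τ * qTerm A₀ b₀ ν τ
  refine ⟨((hasSum_shift_a₀ (f := total)).mpr (hasSum_rho l τ)).summable,
    (hasSum_shift_a₀ (f := hol)).mpr (hasSum_sgnTerm l τ),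
    ((hasSum_shift_a₀ (f := nonhol c₁)).mpr (summable_betaTerm_c₁ l τ).hasSum).summable,
    ((hasSum_shift_a₀ (f := nonhol c₂)).mpr (summable_betaTerm_c₂ l τ).hasSum).summable, ?_⟩
  rw [tsum_shift_a₀ (nonhol c₁), tsum_shift_a₀ (nonhol c₂)]
  exact vartheta_eq_sub_add l τ
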